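/- **Conventions.** A mosaic tile is a unit square that is blank, or carries one arc joining the midpoints of two adjacent sides (four tiles), or one segment joining the midpoints of two opposite sides (two tiles), or two disjoint arcs, each joining the midpoints of two adjacent sides (two tiles), or a crossing of a horizontal and a vertical segment with over/under information (two tiles). The connection points of a tile are the midpoints of its sides at which a drawn curve ends. An $n$-mosaic is an $n\times n$ array of tiles in which every connection point of a tile meets a connection point of an adjacent tile; it is a diagram of a knot or link. The (unoriented) knot or link depicted is considered up to planar isotopies and Reidemeister moves of mosaics; a planar isotopy of mosaics is a finite sequence of local planar isotopy moves in $2\times 2$ subarrays, of insertions of a row or a column that only prolongs the strands it cuts (blank if it cuts none), and of the inverses of these. Let $K$ be a knot or link. - The mosaic number $m(K)$ is the least $n$ such that $K$ is depicted by an $n$-mosaic. - The tile number of a mosaic is the number of its non-blank tiles. The tile number $t(K)$ is the least tile number of all mosaics of $K$, and the minimal mosaic tile number $t_M(K)$ is the least tile number of all $m(K)$-mosaics of $K$. - A mosaic is reduced if no simple closed curve meets the diagram transversely in exactly one crossing and nowhere else. An $n$-mosaic is space-efficient if it is reduced and no $n$-mosaic that is planar isotopic to it has a smaller tile number. - $K$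 has an unknotted, unlinked component if it has a diagram in which some component is a circle without crossings that bounds a disc disjoint from the rest of the diagram. **Theorem.** Let $K$ be a knot or link with $m(K)=5$ and without unknotted, unlinked components. Then $$t(K)=t_M(K)=17 .$$ Moreover, every space-efficient $5$-mosaic of $K$ has, up to a reflection of the square in its vertical axis, the layout $$\begin{array}{|c|c|c|c|c|}\hline \cdot & \ulcorner & \urcorner & \cdot & \cdot\\ \hline \ulcorner & * & * & \urcorner & \cdot\\ \hline \llcorner & * & * & * & \urcorner\\ \hline \cdot & \llcorner & * & * & \lrcorner\\ \hline \cdot & \cdot & \llcorner & \lrcorner & \cdot\\ \hline \end{array}$$ where $\cdot$ is the blank tile, $\ulcorner,\urcorner,\llcorner,\lrcorner$ are the single arc tiles joining the midpoints of the bottom and right, left and bottom, top and right, top and left sides respectively, and each $*$ is a tile with four connection points (two arcs or a crossing). The knots $4_1$, $5_1$, $5_2$, $6_1$, $6_2$ and $7_4$, and their mirror images, have mosaic number $5$ and no unknotted, unlinked components; hence each of them has tile number and minimal mosaic tile number $17$. -/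

import Mathlib

/-- The eleven mosaic tiles. The sides of a tile are called left, right, top, bottom.
`T0` is blank; `T1`, `T2`, `T3`, `T4` carry a single arc (left-bottom, bottom-right, right-top,
top-left); `T5`, `T6` carry a horizontal and a vertical segment; `T7` carries the two arcs
left-bottom and right-top; `T8` the two arcs top-left and bottom-right; `T9` is the crossing whose
horizontal strand is the over-strand, `T10` the crossing whose vertical strand is the over-strand. -/
inductive Tile where
  | T0 | T1 | T2 | T3 | T4 | T5 | T6 | T7 | T8 | T9 | T10
  deriving DecidableEq

namespace Tile

/-- Is the midpoint of the left side a connection point? -/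
def left : Tile → Bool
  | T0 | T2 | T3 | T6 => false
  | _ => true

/-- Is the midpoint of the right side a connection point? -/
def right : Tile → Bool
  | T0 | T1 | T4 | T6 => false
  | _ => true

/-- Is the midpoint of the top side a connection point? -/
def top : Tile → Bool
  | T0 | T1 | T2 | T5 => false
  | _ => true

/-- Is the midpoint of the bottom side a connection point? -/
def bottom : Tile → Bool
  | T0 | T3 | T4 | T5 => false
  | _ => true

/-- The tile is a crossing. -/
def IsCrossing (t : Tile) : Prop := t = T9 ∨ t = T10

/-- The crossing tile with over-strand horizontal (`true`) or vertical (`false`). -/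
def cross : Bool → Tile
  | true => T9
  | false => T10

/-- The tile turned counterclockwise by a quarter turn. -/
def rotate : Tile → Tile
  | T0 => T0 | T1 => T2 | T2 => T3 | T3 => T4 | T4 => T1 | T5 => T6 | T6 => T5
  | T7 => T8 | T8 => T7 | T9 => T10 | T10 => T9

/-- The tile reflected in its vertical axis (over-strands stay over-strands). -/
def reflect : Tile → Tile
  | T0 => T0 | T1 => T2 | T2 => T1 | T3 => T4 | T4 => T3 | T5 => T5 | T6 => T6
  | T7 => T8 | T8 => T7 | T9 => T9 | T10 => T10

/-- The tile with over- and under-strand exchanged. -/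
def switch : Tile → Tile
  | T9 => T10 | T10 => T9 | t => t

end Tile

open Tile (T0 T1 T2 T3 T4 T5 T6 T7 T8 T9 T10 cross)

/-- An unbounded board of tiles: `B i j` is the tile in row `i` (counted downwards) and column `j`
(counted to the right), both starting from `0`. -/
abbrev Board := ℕ → ℕ → Tile

/-- `B` is a knot `n`-mosaic: an `n × n` array of tiles (the board is blank outside of it), each
of which is suitably connected. -/
structure IsKnotMosaic (n : ℕ) (B : Board) : Prop where
  blank_outside : ∀ i j, n ≤ i ∨ n ≤ j → B i j = T0
  left_edge : ∀ i, (B i 0).left = false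
  top_edge : ∀ j, (B 0 j).top = false
  connected_right : ∀ i j, (B i j).right = (B i (j + 1)).left
  connected_bottom : ∀ i j, (B i j).bottom = (B (i + 1) j).top

/-- A knot mosaic of some size. -/
structure Mosaic where
  board : Board
  isMosaic : ∃ n, IsKnotMosaic n board

/-- The tile number of a mosaic: the number of its non-blank tiles. -/
noncomputable def Mosaic.tileCount (M : Mosaic) : ℕ :=
  {p : ℕ × ℕ | M.board p.1 p.2 ≠ T0}.ncard

/-! ### Planar isotopy and Reidemeister moves -/

/-- A `k × k` array of tiles. -/
abbrev Block (k : ℕ) := Matrix (Fin k) (Fin k) Tile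

/-- The `k × k` array on the board `B` whose top left tile is in row `r` and column `c`. -/
def block (k : ℕ) (B : Board) (r c : ℕ) : Block k := fun i j => B (r + i) (c + j)

namespace Block

variable {k : ℕ}

/-- Counterclockwise quarter turn. -/
def rotate (P : Block k) : Block k := fun i j => (P j i.rev).rotate

/-- Reflection in the vertical axis. -/
def reflect (P : Block k) : Block k := fun i j => (P i j.rev).reflect

/-- Change of all crossings. -/
def switch (P : Block k) : Block k := fun i j => (P i j).switch

end Block

/-- `AddArc a p q`: the tile `q` arises from `p` by adding the single arc of the tile `a`, without
a new crossing. -/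
inductive AddArc : Tile → Tile → Tile → Prop
  | a1 : AddArc T1 T0 T1
  | b1 : AddArc T1 T3 T7
  | a2 : AddArc T2 T0 T2
  | b2 : AddArc T2 T4 T8
  | a3 : AddArc T3 T0 T3
  | b3 : AddArc T3 T1 T7
  | a4 : AddArc T4 T0 T4
  | b4 : AddArc T4 T2 T8

/-- The tile `q` contains the single arc of the tile `a`. -/
def HasArc (a q : Tile) : Prop := ∃ p, AddArc a p q

/-- The `2 × 2` planar isotopy moves, up to rotation, reflection and change of the crossings.
In the first three, a strand is pushed across the common corner of the four tiles; in the last two,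
a crossing slides to an adjacent or to the diagonally adjacent tile. -/
inductive PlanarMove : Block 2 → Block 2 → Prop
  | push_two {a a' b b' c c' d d' : Tile} :
      AddArc T2 a a' → AddArc T4 d d' →
      ((b = T4 ∧ b' = T6) ∨ (b = T5 ∧ b' = T2)) →
      ((c = T4 ∧ c' = T5) ∨ (c = T6 ∧ c' = T2)) →
      PlanarMove !![a', b; c, d] !![a, b'; c', d']
  | push_three {a a' b b' c c' d d' : Tile} :
      ((a = T3 ∧ a' = T6) ∨ (a = T5 ∧ a' = T1)) →
      ((b = T4 ∧ b' = T6) ∨ (b = T5 ∧ b' = T2)) →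
      AddArc T3 c c' → AddArc T4 d d' →
      PlanarMove !![a, b; c, d] !![a', b'; c', d']
  | push_four {b b' c c' d d' : Tile} :
      AddArc T1 b b' → AddArc T3 c c' → AddArc T4 d d' →
      PlanarMove !![T4, b; c, d] !![T7, b'; c', d']
  | slide_adjacent {a b : Tile} (h : Bool) :
      HasArc T2 a → HasArc T1 b →
      PlanarMove !![a, b; T8, cross h] !![a, b; cross (!h), T7]
  | slide_diagonal {a d : Tile} (h : Bool) :
      HasArc T2 a → HasArc T4 d →
      PlanarMove !![a, T8; cross h, d] !![a, cross h; T8, d]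

/-- The first two Reidemeister moves inside a `2 × 2` array, up to rotation, reflection and change
of the crossings. -/
inductive ReidemeisterMove₂ : Block 2 → Block 2 → Prop
  | one {a b c : Tile} (h : Bool) :
      HasArc T2 a → HasArc T1 b → HasArc T3 c →
      ReidemeisterMove₂ !![a, b; c, T7] !![a, b; c, cross h]
  | two_adjacent {a b : Tile} (h : Bool) :
      HasArc T2 a → HasArc T1 b →
      ReidemeisterMove₂ !![a, b; T8, T7] !![a, b; cross h, cross h]
  | two_diagonal {a d : Tile} (h : Bool) :
      HasArc T2 a → HasArc T4 d →
      ReidemeisterMove₂ !![a, T8; T8, d] !![a, cross h; cross (!h), d]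

/-- The third Reidemeister move inside a `3 × 3` array, up to symmetry. A horizontal strand `A` and
a vertical strand `B` cross in the middle tile, and a third strand `C` passes from one side of this
crossing to the other. `ab` says that `A` lies over `B`, `ac` that `A` lies over `C`, and `bc` that
`B` lies over `C`; the hypothesis says that the three strands lie at three different heights. -/
inductive ReidemeisterMove₃ : Block 3 → Block 3 → Prop
  | three (ab ac bc : Bool) :
      ¬ (ab = true ∧ bc = true ∧ ac = false) → ¬ (ab = false ∧ bc = false ∧ ac = true) →
      ReidemeisterMove₃
        !![T2, cross (!bc), T5; cross ac, cross ab, T5; T6, T6, T0]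
        !![T0, T6, T2; T5, cross ab, cross ac; T2, cross (!bc), T4]

/-- The closure of a set of moves under rotation, reflection and change of all crossings. -/
inductive UpToSymmetry {k : ℕ} (R : Block k → Block k → Prop) : Block k → Block k → Prop
  | base {P Q : Block k} : R P Q → UpToSymmetry R P Q
  | rotate {P Q : Block k} : UpToSymmetry R P Q → UpToSymmetry R P.rotate Q.rotate
  | reflect {P Q : Block k} : UpToSymmetry R P Q → UpToSymmetry R P.reflect Q.reflect
  | switch {P Q : Block k} : UpToSymmetry R P Q → UpToSymmetry R P.switch Q.switch

/-- The board `B'` arises from `B` by replacing one `k × k` array by means of a move in `R`. -/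
def ReplaceBlock {k : ℕ} (R : Block k → Block k → Prop) (B B' : Board) : Prop :=
  ∃ r c : ℕ, UpToSymmetry R (block k B r c) (block k B' r c) ∧
    ∀ i j, ¬ (r ≤ i ∧ i < r + k ∧ c ≤ j ∧ j < c + k) → B' i j = B i j

/-- Push all rows from row `r` on down by one, and join up the strands that were cut by vertical
segments. -/
def insertRow (r : ℕ) (B : Board) : Board := fun i j =>
  if i < r then B i j
  else if i = r then (if (B r j).top then T6 else T0)
  else B (i - 1) j

/-- Push all columns from column `c` on to the right by one, and join up the strands that were cut
by horizontal segments. -/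
def insertCol (c : ℕ) (B : Board) : Board := fun i j =>
  if j < c then B i j
  else if j = c then (if (B i c).left then T5 else T0)
  else B i (j - 1)

/-- One elementary planar isotopy of mosaics, either inside the board or through stretching it. -/
def PlanarStep (M N : Mosaic) : Prop :=
  ReplaceBlock PlanarMove M.board N.board ∨
    (∃ r, N.board = insertRow r M.board) ∨ (∃ c, N.board = insertCol c M.board)

/-- Two mosaics are planar isotopic: a finite sequence of elementary planar isotopies and their
inverses leads from one to the other. -/
def PlanarIsotopic : Mosaic → Mosaic → Prop := Relation.EqvGen PlanarStep

/-- One elementary planar isotopy or one Reidemeister move. -/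
def LinkStep (M N : Mosaic) : Prop :=
  PlanarStep M N ∨ ReplaceBlock ReidemeisterMove₂ M.board N.board ∨
    ReplaceBlock ReidemeisterMove₃ M.board N.board

/-- Knots and links (tame, unoriented): mosaics up to planar isotopies, Reidemeister moves and their
inverses. -/
def LinkType : Type := Quot LinkStep

/-- The knot or link that is depicted by a mosaic. -/
def Mosaic.linkType (M : Mosaic) : LinkType := Quot.mk LinkStep M

/-! ### Mosaic number and tile numbers -/

/-- The least `n` for which `K` can be represented as an `n`-mosaic. -/
noncomputable def mosaicNumber (K : LinkType) : ℕ :=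
  sInf {n | ∃ M : Mosaic, IsKnotMosaic n M.board ∧ M.linkType = K}

/-- The fewest non-blank tiles needed to construct `K` on a mosaic of any size. -/
noncomputable def tileNumber (K : LinkType) : ℕ :=
  sInf {t | ∃ M : Mosaic, M.linkType = K ∧ M.tileCount = t}

/-- The fewest non-blank tiles needed to construct `K` on a mosaic of the smallest possible size. -/
noncomputable def minimalMosaicTileNumber (K : LinkType) : ℕ :=
  sInf {t | ∃ M : Mosaic, IsKnotMosaic (mosaicNumber K) M.board ∧ M.linkType = K ∧
    M.tileCount = t}

/-- `K` has an unknotted, unlinked component: it has a diagram in which one component is a small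
circle that bounds a disc disjoint from the rest of the diagram. -/
def HasUnknottedUnlinkedComponent (K : LinkType) : Prop :=
  ∃ M : Mosaic, M.linkType = K ∧ ∃ r c : ℕ, block 2 M.board r c = !![T2, T1; T3, T4]

/-! ### Reduced and space-efficient mosaics -/

/-- Adjacency of the vertices of the grid in the complement of the diagram; `(i, j)` is the top left
vertex of the tile in row `i` and column `j`. Two vertices are adjacent if they are the ends of a
side of a tile that the diagram does not meet, or opposite vertices of a tile that are
joined by the region between its two arcs. -/
inductive Touch (B : Board) : ℕ × ℕ → ℕ × ℕ → Prop
  | horizontal (i j : ℕ) : (B i j).top = false → Touch B (i, j) (i, j + 1)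
  | vertical (i j : ℕ) : (B i j).left = false → Touch B (i, j) (i + 1, j)
  | diagonal (i j : ℕ) : B i j = T7 → Touch B (i, j) (i + 1, j + 1)
  | antidiagonal (i j : ℕ) : B i j = T8 → Touch B (i, j + 1) (i + 1, j)

/-- Two vertices of the grid lie in the same region of the complement of the diagram. -/
def SameRegion (B : Board) : ℕ × ℕ → ℕ × ℕ → Prop := Relation.EqvGen (Touch B)

/-- A mosaic is reduced: at no crossing do two opposite corners belong to the same region, that is,
no simple closed curve meets the diagram transversely in a single crossing and nowhere else. -/
def IsReducedMosaic (B : Board) : Prop :=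
  ∀ i j, (B i j).IsCrossing →
    ¬ SameRegion B (i, j) (i + 1, j + 1) ∧ ¬ SameRegion B (i, j + 1) (i + 1, j)

/-- `M` is a space-efficient `n`-mosaic: it is a reduced `n`-mosaic, and no `n`-mosaic that is
planar isotopic to it has fewer non-blank tiles. -/
def IsSpaceEfficient (n : ℕ) (M : Mosaic) : Prop :=
  IsKnotMosaic n M.board ∧ IsReducedMosaic M.board ∧
    ∀ N : Mosaic, IsKnotMosaic n N.board → PlanarIsotopic M N → M.tileCount ≤ N.tileCount

/-! ### The layout -/

/-- The layout: `some t` prescribes the tile `t`, and `none` stands for a tile with four connection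
points (a double arc or a crossing). -/
def layout : Matrix (Fin 5) (Fin 5) (Option Tile) :=
  !![some T0, some T2, some T1, some T0, some T0;
     some T2, none,    none,    some T1, some T0;
     some T3, none,    none,    none,    some T1;
     some T0, some T3, none,    none,    some T4;
     some T0, some T0, some T3, some T4, some T0]

/-- The `5 × 5` array `P` has the prescribed layout. -/
def FitsLayout (P : Block 5) : Prop :=
  ∀ i j, match layout i j with
    | some t => P i j = t
    | none => (P i j).left = true ∧ (P i j).right = true ∧ (P i j).top = true ∧
        (P i j).bottom = true

/-- The mosaic, or its reflection in the vertical axis, has the prescribed layout. -/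
def HasLayout (M : Mosaic) : Prop :=
  FitsLayout (block 5 M.board 0 0) ∨ FitsLayout (block 5 M.board 0 0).reflect

/-! ### The knots `4_1`, `5_1`, `5_2`, `6_1`, `6_2`, `7_4` -/

/-- The mirror image: all crossings are changed. -/
def Mosaic.mirror (M : Mosaic) : Mosaic where
  board := fun i j => (M.board i j).switch
  isMosaic := by
    have hl : ∀ t : Tile, t.switch.left = t.left := by intro t; cases t <;> rfl
    have hr : ∀ t : Tile, t.switch.right = t.right := by intro t; cases t <;> rfl
    have ht : ∀ t : Tile, t.switch.top = t.top := by intro t; cases t <;> rfl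
    have hb : ∀ t : Tile, t.switch.bottom = t.bottom := by intro t; cases t <;> rfl
    obtain ⟨n, h⟩ := M.isMosaic
    refine ⟨n, ⟨?_, ?_, ?_, ?_, ?_⟩⟩
    · intro i j hij
      simp only [h.blank_outside i j hij, Tile.switch]
    · intro i
      rw [hl, h.left_edge]
    · intro j
      rw [ht, h.top_edge]
    · intro i j
      rw [hr, hl, h.connected_right]
    · intro i j
      rw [hb, ht, h.connected_bottom]

/-- The board with the given `n × n` array of tiles in its top left corner. -/
def boardOf {n : ℕ} (P : Block n) : Board := fun i j =>
  if h : i < n ∧ j < n then P ⟨i, h.1⟩ ⟨j, h.2⟩ else T0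

theorem boardOf_isKnotMosaic {n : ℕ} (P : Block n)
    (hl : ∀ i < n, (boardOf P i 0).left = false) (ht : ∀ j < n, (boardOf P 0 j).top = false)
    (hr : ∀ i < n, ∀ j < n, (boardOf P i j).right = (boardOf P i (j + 1)).left)
    (hb : ∀ i < n, ∀ j < n, (boardOf P i j).bottom = (boardOf P (i + 1) j).top) :
    IsKnotMosaic n (boardOf P) := by
  have h0 : ∀ i j, n ≤ i ∨ n ≤ j → boardOf P i j = T0 := by
    intro i j h
    simp only [boardOf]
    rw [dif_neg]
    omega
  refine ⟨h0, ?_, ?_, ?_, ?_⟩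
  · intro i
    by_cases hi : i < n
    · exact hl i hi
    · rw [h0 i 0 (by omega)]; rfl
  · intro j
    by_cases hj : j < n
    · exact ht j hj
    · rw [h0 0 j (by omega)]; rfl
  · intro i j
    by_cases h : i < n ∧ j < n
    · exact hr i h.1 j h.2
    · rw [h0 i j (by omega), h0 i (j + 1) (by omega)]; rfl
  · intro i j
    by_cases h : i < n ∧ j < n
    · exact hb i h.1 j h.2
    · rw [h0 i j (by omega), h0 (i + 1) j (by omega)]; rfl

/-- The reduced alternating diagram of `4_1` (Dowker code 4 6 8 2). -/
def knot4_1 : Mosaic where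
  board := boardOf
    !![T0, T2,  T1,  T0,  T0;
       T2, T10, T9,  T1,  T0;
       T3, T7,  T10, T9,  T1;
       T0, T3,  T7,  T8,  T4;
       T0, T0,  T3,  T4,  T0]
  isMosaic := ⟨5, boardOf_isKnotMosaic _ (by decide) (by decide) (by decide) (by decide)⟩

/-- The reduced alternating diagram of `5_1` (Dowker code 6 8 10 2 4). -/
def knot5_1 : Mosaic where
  board := boardOf
    !![T0, T2,  T1,  T0,  T0;
       T2, T10, T9,  T1,  T0;
       T3, T9,  T7,  T9,  T1;
       T0, T3,  T9,  T8,  T4;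
       T0, T0,  T3,  T4,  T0]
  isMosaic := ⟨5, boardOf_isKnotMosaic _ (by decide) (by decide) (by decide) (by decide)⟩

/-- The reduced alternating diagram of `5_2` (Dowker code 4 8 10 2 6). -/
def knot5_2 : Mosaic where
  board := boardOf
    !![T0, T2,  T1,  T0,  T0;
       T2, T10, T9,  T1,  T0;
       T3, T9,  T10, T9,  T1;
       T0, T3,  T7,  T8,  T4;
       T0, T0,  T3,  T4,  T0]
  isMosaic := ⟨5, boardOf_isKnotMosaic _ (by decide) (by decide) (by decide) (by decide)⟩

/-- The reduced alternating diagram of `6_1` (Dowker code 4 8 12 10 2 6). -/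
def knot6_1 : Mosaic where
  board := boardOf
    !![T0, T2,  T1,  T0,  T0,  T0;
       T2, T9,  T10, T1,  T0,  T0;
       T3, T10, T7,  T10, T1,  T0;
       T0, T3,  T7,  T9,  T10, T1;
       T0, T0,  T3,  T7,  T8,  T4;
       T0, T0,  T0,  T3,  T4,  T0]
  isMosaic := ⟨6, boardOf_isKnotMosaic _ (by decide) (by decide) (by decide) (by decide)⟩

/-- The reduced alternating diagram of `6_2` (Dowker code 4 8 10 12 2 6). -/
def knot6_2 : Mosaic where
  board := boardOf
    !![T0, T2,  T1,  T0,  T0;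
       T2, T10, T9,  T1,  T0;
       T3, T9,  T10, T9,  T1;
       T0, T3,  T9,  T8,  T4;
       T0, T0,  T3,  T4,  T0]
  isMosaic := ⟨5, boardOf_isKnotMosaic _ (by decide) (by decide) (by decide) (by decide)⟩

/-- The reduced alternating diagram of `7_4` (Dowker code 6 10 12 14 4 2 8). -/
def knot7_4 : Mosaic where
  board := boardOf
    !![T0, T2,  T1,  T0,  T0;
       T2, T9,  T10, T1,  T0;
       T3, T10, T9,  T10, T1;
       T0, T3,  T10, T9,  T4;
       T0, T0,  T3,  T4,  T0]
  isMosaic := ⟨5, boardOf_isKnotMosaic _ (by decide) (by decide) (by decide) (by decide)⟩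

/-!
The tile number is bounded by a local analysis of boards, and links are told apart by Fox
colourings.

Call a two by two window *bad* if all four of its tiles, or, with few exceptions, three of them,
carry the arc around its centre, or if it has one of some similar shapes (`badWindow`). A bad window
contains a circle around its centre, or the loop of a first Reidemeister move, or else a planar
isotopy move inside it saves tiles (`Mosaic.badWindow_cases`). A circle is an unknotted, unlinked
component, and a mosaic with a loop is not reduced, and has more crossings than necessary. Hence
only boards without bad windows matter. A kernel-checked enumeration (`search_five`) shows that
every such five by five board fits into a four by four square, or loses tiles under a short sequence
of planar isotopy moves, or has the layout (`Mosaic.five_cases`). The layout has 17 non-blank tiles,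
so this settles five by five mosaics (`Mosaic.hasLayout`, `Mosaic.tileCount_of_hasLayout`).

For the lower bound `Mosaic.seventeen_le`, which concerns mosaics of every size, choose a mosaic of
the link in a rectangle such that the tile number, the size of the rectangle, the number of tiles
off two opposite sides and the number of crossings are minimal, in this order of priority
(`IsMinimalMosaic`). Suppose that the rectangle has at least six rows; columns are treated in the
same way. The first two rows contain no bad window, no strand of the second row can be pushed into
the first one, and neither row consists of blank tiles and vertical segments only. A scan of the two
rows from left to right shows that at least four strands leave them through their lower side
(`four_le_bottom`). Thus the second and the third row have at least four non-blank tiles each, as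
have the corresponding two rows at the opposite side, and with one tile in the first row there are
at least `1 + 4 * 4 = 17` tiles (`Framed.seventeen_le`). A rectangle with at most five rows and
columns is covered by the enumeration.

For the six knots, every planar isotopy and Reidemeister move carries the colourings of a diagram
over to colourings of the other one, and non-constant ones to non-constant ones
(`Mosaic.transfer_of_linkType_eq`). A diagram of a knot has only constant colourings with two
colours (`Mosaic.twoConstant_of_knotCheck`). A small circle next to another component gives a
non-constant one, and a small circle alone has only constant colourings over every ring; so a knot
with a colouring whose triple is non-constant has no unknotted, unlinked component
(`not_hasUnknottedUnlinkedComponent`). Nor does it have a four by four mosaic: by the same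
enumeration (`search_four`), what remains there is blank, or has several components, or consists of
four tiles surrounded by a ring of arcs with exactly three crossings, and then the triple of every
colouring is constant (`three_mul_eq`), as for the unknot and the trefoil. Such colourings exist
modulo 5, 7, 9 or 11 (`mosaicNumber_eq_five_of_check`). The given diagrams fit into a five by five
square, except for that of `6_1`, which is related to a five by five mosaic by an explicit sequence
of moves (`fiveMosaic6_1_linkType`).
-/

/-! ### Mosaics in a rectangle, and the equivalence relations -/

theorem Mosaic.ext {M N : Mosaic} (h : M.board = N.board) : M = N := by
  cases M; cases N; cases h; rfl

/-- All non-blank tiles lie in the first `a` rows and `b` columns. -/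
def Fits (a b : ℕ) (B : Board) : Prop := ∀ i j, a ≤ i ∨ b ≤ j → B i j = T0

/-- Every connection point meets another one, and none lies on the upper or left edge. -/
structure Connected (B : Board) : Prop where
  left_edge : ∀ i, (B i 0).left = false
  top_edge : ∀ j, (B 0 j).top = false
  right : ∀ i j, (B i j).right = (B i (j + 1)).left
  bottom : ∀ i j, (B i j).bottom = (B (i + 1) j).top

theorem isKnotMosaic_iff {n : ℕ} {B : Board} :
    IsKnotMosaic n B ↔ Connected B ∧ Fits n n B :=
  ⟨fun h => ⟨⟨h.left_edge, h.top_edge, h.connected_right, h.connected_bottom⟩, h.blank_outside⟩,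
    fun h => ⟨h.2, h.1.left_edge, h.1.top_edge, h.1.right, h.1.bottom⟩⟩

theorem Mosaic.connected (M : Mosaic) : Connected M.board :=
  (isKnotMosaic_iff.1 M.isMosaic.choose_spec).1

theorem Mosaic.exists_fits (M : Mosaic) : ∃ n, Fits n n M.board :=
  M.isMosaic.imp fun _ h => h.blank_outside

theorem Fits.mono {a b a' b' : ℕ} {B : Board} (h : Fits a b B) (ha : a ≤ a') (hb : b ≤ b') :
    Fits a' b' B := fun i j hij => h i j (by omega)

/-- The mosaic with a given board. -/
def Connected.mosaic {B : Board} (hB : Connected B) {a b : ℕ} (h : Fits a b B) : Mosaic :=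
  ⟨B, max a b, isKnotMosaic_iff.2 ⟨hB, h.mono (le_max_left ..) (le_max_right ..)⟩⟩

theorem PlanarIsotopic.refl (M : Mosaic) : PlanarIsotopic M M := Relation.EqvGen.refl _

theorem PlanarIsotopic.symm {M N : Mosaic} (h : PlanarIsotopic M N) : PlanarIsotopic N M :=
  Relation.EqvGen.symm _ _ h

theorem PlanarIsotopic.trans {M N P : Mosaic} (h : PlanarIsotopic M N) (h' : PlanarIsotopic N P) :
    PlanarIsotopic M P := Relation.EqvGen.trans _ _ _ h h'

theorem PlanarIsotopic.linkType_eq {M N : Mosaic} (h : PlanarIsotopic M N) :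
    M.linkType = N.linkType := by
  induction h with
  | rel _ _ h => exact Quot.sound (Or.inl h)
  | refl => rfl
  | symm _ _ _ ih => exact ih.symm
  | trans _ _ _ _ _ ih ih' => exact ih.trans ih'

theorem Mosaic.support_finite (M : Mosaic) : {p : ℕ × ℕ | M.board p.1 p.2 ≠ T0}.Finite := by
  obtain ⟨n, hn⟩ := M.exists_fits
  refine ((Set.finite_Iio n).prod (Set.finite_Iio n)).subset fun p hp => ?_
  simp only [Set.mem_prod, Set.mem_Iio]
  by_contra h
  exact hp (hn _ _ (by omega))

/-! ### Insertion and deletion of rows and columns -/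

/-- The board without row `r`. -/
def deleteRow (r : ℕ) (B : Board) : Board := fun i j => if i < r then B i j else B (i + 1) j

/-- The board without column `c`. -/
def deleteCol (c : ℕ) (B : Board) : Board := fun i j => if j < c then B i j else B i (j + 1)

/-- Row `r` consists of blank tiles and vertical segments, so that it can be deleted. -/
def PureRow (r : ℕ) (B : Board) : Prop := ∀ j, B r j = T0 ∨ B r j = T6

/-- Column `c` consists of blank tiles and horizontal segments, so that it can be deleted. -/
def PureCol (c : ℕ) (B : Board) : Prop := ∀ i, B i c = T0 ∨ B i c = T5

theorem Connected.insertRow {B : Board} (h : Connected B) (r : ℕ) : Connected (insertRow r B) := by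
  have hp : ∀ r j, (if (B r j).top = true then T6 else T0).left = false := by
    intro r j; split <;> rfl
  have hq : ∀ r j, (if (B r j).top = true then T6 else T0).right = false := by
    intro r j; split <;> rfl
  have ht : ∀ r j, (if (B r j).top = true then T6 else T0).top = (B r j).top := by
    intro r j; split <;> simp_all [Tile.top]
  have hb : ∀ r j, (if (B r j).top = true then T6 else T0).bottom = (B r j).top := by
    intro r j; split <;> simp_all [Tile.bottom]
  refine ⟨fun i => ?_, fun j => ?_, fun i j => ?_, fun i j => ?_⟩
  · simp only [_root_.insertRow]
    split_ifs
    exacts [h.left_edge _, rfl, rfl, h.left_edge _]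
  · simp only [_root_.insertRow]
    by_cases h1 : 0 < r
    · rw [if_pos h1]; exact h.top_edge j
    · obtain rfl : r = 0 := by omega
      rw [if_neg h1, if_pos rfl, ht]; exact h.top_edge j
  · simp only [_root_.insertRow]
    by_cases h1 : i < r
    · simp only [if_pos h1, h.right]
    · by_cases h2 : i = r
      · simp only [if_neg h1, if_pos h2, hp, hq]
      · simp only [if_neg h1, if_neg h2, h.right]
  · simp only [_root_.insertRow]
    by_cases h1 : i < r
    · by_cases h3 : i + 1 < r
      · simp only [if_pos h1, if_pos h3, h.bottom]
      · have h4 : i + 1 = r := by omega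
        subst h4
        simp only [if_pos h1, lt_irrefl, if_true, if_false, ht, h.bottom]
    · by_cases h2 : i = r
      · subst h2
        simp only [lt_irrefl, if_true, if_false, hb, if_neg (show ¬ i + 1 < i by omega),
          if_neg (show ¬ i + 1 = i by omega), Nat.add_sub_cancel]
      · simp only [if_neg h1, if_neg h2, if_neg (show ¬ i + 1 < r by omega),
          if_neg (show ¬ i + 1 = r by omega), h.bottom, show i - 1 + 1 = i + 1 - 1 by omega]

theorem Connected.insertCol {B : Board} (h : Connected B) (c : ℕ) : Connected (insertCol c B) := by
  have hp : ∀ i j, (if (B i j).left = true then T5 else T0).top = false := by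
    intro r j; split <;> rfl
  have hq : ∀ i j, (if (B i j).left = true then T5 else T0).bottom = false := by
    intro r j; split <;> rfl
  have ht : ∀ i j, (if (B i j).left = true then T5 else T0).left = (B i j).left := by
    intro r j; split <;> simp_all [Tile.left]
  have hb : ∀ i j, (if (B i j).left = true then T5 else T0).right = (B i j).left := by
    intro r j; split <;> simp_all [Tile.right]
  refine ⟨fun j => ?_, fun i => ?_, fun j i => ?_, fun j i => ?_⟩
  · simp only [_root_.insertCol]
    by_cases h1 : 0 < c
    · rw [if_pos h1]; exact h.left_edge j
    · obtain rfl : c = 0 := by omega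
      rw [if_neg h1, if_pos rfl, ht]; exact h.left_edge j
  · simp only [_root_.insertCol]
    split_ifs
    exacts [h.top_edge _, rfl, rfl, h.top_edge _]
  · simp only [_root_.insertCol]
    by_cases h1 : i < c
    · by_cases h3 : i + 1 < c
      · simp only [if_pos h1, if_pos h3, h.right]
      · have h4 : i + 1 = c := by omega
        subst h4
        simp only [if_pos h1, lt_irrefl, if_true, if_false, ht, h.right]
    · by_cases h2 : i = c
      · subst h2
        simp only [lt_irrefl, if_true, if_false, hb, if_neg (show ¬ i + 1 < i by omega),
          if_neg (show ¬ i + 1 = i by omega), Nat.add_sub_cancel]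
      · simp only [if_neg h1, if_neg h2, if_neg (show ¬ i + 1 < c by omega),
          if_neg (show ¬ i + 1 = c by omega), h.right, show i - 1 + 1 = i + 1 - 1 by omega]
  · simp only [_root_.insertCol]
    by_cases h1 : i < c
    · simp only [if_pos h1, h.bottom]
    · by_cases h2 : i = c
      · simp only [if_neg h1, if_pos h2, hp, hq]
      · simp only [if_neg h1, if_neg h2, h.bottom]

theorem Fits.insertRow {B : Board} {a b : ℕ} (h : Fits a b B) (r : ℕ) :
    Fits (a + 1) b (insertRow r B) := by
  intro i j hij
  simp only [_root_.insertRow]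
  split_ifs with h1 h2 h3
  · exact h i j (by omega)
  · rw [h r j (by omega)] at h3; exact absurd h3 (by decide)
  · rfl
  · exact h _ j (by omega)

theorem Fits.insertCol {B : Board} {a b : ℕ} (h : Fits a b B) (c : ℕ) :
    Fits a (b + 1) (insertCol c B) := by
  intro i j hij
  simp only [_root_.insertCol]
  split_ifs with h1 h2 h3
  · exact h i j (by omega)
  · rw [h i c (by omega)] at h3; exact absurd h3 (by decide)
  · rfl
  · exact h i _ (by omega)

theorem Mosaic.exists_insertRow (M : Mosaic) (r : ℕ) :
    ∃ N : Mosaic, N.board = insertRow r M.board ∧ PlanarIsotopic M N := by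
  obtain ⟨n, hn⟩ := M.exists_fits
  exact ⟨(M.connected.insertRow r).mosaic
    (hn.insertRow r), rfl,
    .rel _ _ (Or.inr (Or.inl ⟨r, rfl⟩))⟩

theorem Mosaic.exists_insertCol (M : Mosaic) (c : ℕ) :
    ∃ N : Mosaic, N.board = insertCol c M.board ∧ PlanarIsotopic M N := by
  obtain ⟨n, hn⟩ := M.exists_fits
  exact ⟨(M.connected.insertCol c).mosaic
    (hn.insertCol c), rfl,
    .rel _ _ (Or.inr (Or.inr ⟨c, rfl⟩))⟩

theorem PureRow.top_eq_bottom {B : Board} {r : ℕ} (h : PureRow r B) (j : ℕ) :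
    (B r j).top = (B r j).bottom := by
  rcases h j with h | h <;> rw [h] <;> rfl

theorem PureCol.left_eq_right {B : Board} {c : ℕ} (h : PureCol c B) (i : ℕ) :
    (B i c).left = (B i c).right := by
  rcases h i with h | h <;> rw [h] <;> rfl

theorem Connected.deleteRow {B : Board} (h : Connected B) {r : ℕ} (hr : PureRow r B) :
    Connected (deleteRow r B) := by
  refine ⟨fun i => ?_, fun j => ?_, fun i j => ?_, fun i j => ?_⟩
  · simp only [_root_.deleteRow]; split_ifs <;> exact h.left_edge _
  · simp only [_root_.deleteRow]
    split_ifs with h1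
    · exact h.top_edge j
    · obtain rfl : r = 0 := by omega
      rw [← h.bottom, ← hr.top_eq_bottom, h.top_edge]
  · simp only [_root_.deleteRow]; split_ifs <;> exact h.right _ _
  · simp only [_root_.deleteRow]
    by_cases h1 : i + 1 < r
    · rw [if_pos h1, if_pos (by omega), h.bottom]
    · by_cases h2 : i < r
      · obtain rfl : r = i + 1 := by omega
        rw [if_pos h2, if_neg h1, h.bottom, hr.top_eq_bottom, h.bottom]
      · rw [if_neg h1, if_neg h2, h.bottom]

theorem Connected.deleteCol {B : Board} (h : Connected B) {c : ℕ} (hc : PureCol c B) :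
    Connected (deleteCol c B) := by
  refine ⟨fun i => ?_, fun j => ?_, fun i j => ?_, fun i j => ?_⟩
  · simp only [_root_.deleteCol]
    split_ifs with h1
    · exact h.left_edge i
    · obtain rfl : c = 0 := by omega
      rw [← h.right, ← hc.left_eq_right, h.left_edge]
  · simp only [_root_.deleteCol]; split_ifs <;> exact h.top_edge _
  · simp only [_root_.deleteCol]
    by_cases h1 : j + 1 < c
    · rw [if_pos h1, if_pos (by omega), h.right]
    · by_cases h2 : j < c
      · obtain rfl : c = j + 1 := by omega
        rw [if_pos h2, if_neg h1, h.right, hc.left_eq_right, h.right]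
      · rw [if_neg h1, if_neg h2, h.right]
  · simp only [_root_.deleteCol]; split_ifs <;> exact h.bottom _ _

theorem insertRow_deleteRow {B : Board} (h : Connected B) {r : ℕ} (hr : PureRow r B) :
    insertRow r (deleteRow r B) = B := by
  funext i j
  simp only [insertRow, deleteRow]
  by_cases h1 : i < r
  · simp only [if_pos h1]
  · by_cases h2 : i = r
    · subst h2
      simp only [lt_irrefl, if_true, if_false, ← h.bottom]
      rcases hr j with h | h <;> rw [h] <;> rfl
    · rw [if_neg h1, if_neg h2, if_neg (by omega), show i - 1 + 1 = i by omega]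

theorem insertCol_deleteCol {B : Board} (h : Connected B) {c : ℕ} (hc : PureCol c B) :
    insertCol c (deleteCol c B) = B := by
  funext i j
  simp only [insertCol, deleteCol]
  by_cases h1 : j < c
  · simp only [if_pos h1]
  · by_cases h2 : j = c
    · subst h2
      simp only [lt_irrefl, if_true, if_false, ← h.right]
      rcases hc i with h | h <;> rw [h] <;> rfl
    · rw [if_neg h1, if_neg h2, if_neg (by omega), show j - 1 + 1 = j by omega]

theorem Fits.deleteRow {B : Board} {a b r : ℕ} (h : Fits a b B) (hr : r < a) :
    Fits (a - 1) b (deleteRow r B) := by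
  intro i j hij
  simp only [_root_.deleteRow]
  split_ifs <;> exact h _ _ (by omega)

theorem Fits.deleteCol {B : Board} {a b c : ℕ} (h : Fits a b B) (hc : c < b) :
    Fits a (b - 1) (deleteCol c B) := by
  intro i j hij
  simp only [_root_.deleteCol]
  split_ifs <;> exact h _ _ (by omega)

/-- A row of blank tiles and vertical segments can be deleted by a planar isotopy. -/
theorem Mosaic.exists_deleteRow (M : Mosaic) {r : ℕ} (hr : PureRow r M.board) :
    ∃ N : Mosaic, N.board = deleteRow r M.board ∧ PlanarIsotopic M N ∧
      N.tileCount ≤ M.tileCount ∧ ((∃ j, M.board r j ≠ T0) → N.tileCount < M.tileCount) := by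
  obtain ⟨n, hn⟩ := M.exists_fits
  let N : Mosaic := (M.connected.deleteRow hr).mosaic
    (((hn.mono (le_max_left n (r + 1)) le_rfl).deleteRow (r := r) (by omega)))
  let f : ℕ × ℕ → ℕ × ℕ := fun p => (if p.1 < r then p.1 else p.1 + 1, p.2)
  have hf : Function.Injective f := by
    rintro ⟨i, j⟩ ⟨i', j'⟩ h
    simp only [f, Prod.mk.injEq] at h ⊢
    refine ⟨?_, h.2⟩
    have := h.1
    split_ifs at this <;> omega
  have himg : f '' {p | N.board p.1 p.2 ≠ T0} ⊆ {p | M.board p.1 p.2 ≠ T0} := by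
    rintro _ ⟨⟨i, j⟩, hp, rfl⟩
    have hp' : (if i < r then M.board i j else M.board (i + 1) j) ≠ T0 := hp
    simp only [f, Set.mem_ofPred_eq]
    split_ifs at hp' ⊢ <;> exact hp'
  have hcard : N.tileCount = (f '' {p | N.board p.1 p.2 ≠ T0}).ncard :=
    (Set.ncard_image_of_injective _ hf).symm
  refine ⟨N, rfl, ?_, ?_, ?_⟩
  · exact Relation.EqvGen.symm _ _ (.rel _ _ (Or.inr (Or.inl
      ⟨r, (insertRow_deleteRow M.connected hr).symm⟩)))
  · rw [hcard]; exact Set.ncard_le_ncard himg M.support_finite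
  · rintro ⟨j, hj⟩
    rw [hcard]
    refine Set.ncard_lt_ncard (himg.ssubset_of_ne fun h => ?_) M.support_finite
    have : (r, j) ∈ f '' {p | N.board p.1 p.2 ≠ T0} := by rw [h]; exact hj
    obtain ⟨⟨i, j'⟩, -, h⟩ := this
    simp only [f, Prod.mk.injEq] at h
    have := h.1
    split_ifs at this <;> omega

/-- A column of blank tiles and horizontal segments can be deleted by a planar isotopy. -/
theorem Mosaic.exists_deleteCol (M : Mosaic) {c : ℕ} (hc : PureCol c M.board) :
    ∃ N : Mosaic, N.board = deleteCol c M.board ∧ PlanarIsotopic M N ∧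
      N.tileCount ≤ M.tileCount ∧ ((∃ i, M.board i c ≠ T0) → N.tileCount < M.tileCount) := by
  obtain ⟨n, hn⟩ := M.exists_fits
  let N : Mosaic := (M.connected.deleteCol hc).mosaic
    (((hn.mono le_rfl (le_max_left n (c + 1))).deleteCol (c := c) (by omega)))
  let f : ℕ × ℕ → ℕ × ℕ := fun p => (p.1, if p.2 < c then p.2 else p.2 + 1)
  have hf : Function.Injective f := by
    rintro ⟨i, j⟩ ⟨i', j'⟩ h
    simp only [f, Prod.mk.injEq] at h ⊢
    refine ⟨h.1, ?_⟩
    have := h.2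
    split_ifs at this <;> omega
  have himg : f '' {p | N.board p.1 p.2 ≠ T0} ⊆ {p | M.board p.1 p.2 ≠ T0} := by
    rintro _ ⟨⟨i, j⟩, hp, rfl⟩
    have hp' : (if j < c then M.board i j else M.board i (j + 1)) ≠ T0 := hp
    simp only [f, Set.mem_ofPred_eq]
    split_ifs at hp' ⊢ <;> exact hp'
  have hcard : N.tileCount = (f '' {p | N.board p.1 p.2 ≠ T0}).ncard :=
    (Set.ncard_image_of_injective _ hf).symm
  refine ⟨N, rfl, ?_, ?_, ?_⟩
  · exact Relation.EqvGen.symm _ _ (.rel _ _ (Or.inr (Or.inr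
      ⟨c, (insertCol_deleteCol M.connected hc).symm⟩)))
  · rw [hcard]; exact Set.ncard_le_ncard himg M.support_finite
  · rintro ⟨i, hi⟩
    rw [hcard]
    refine Set.ncard_lt_ncard (himg.ssubset_of_ne fun h => ?_) M.support_finite
    have : (i, c) ∈ f '' {p | N.board p.1 p.2 ≠ T0} := by rw [h]; exact hi
    obtain ⟨⟨i', j'⟩, -, h⟩ := this
    simp only [f, Prod.mk.injEq] at h
    have := h.2
    split_ifs at this <;> omega

/-! ### Replacement of a block -/

section Replace

variable {k : ℕ}

/-- The board with the block in row `r` and column `c` replaced by `Q`. -/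
def setBlock (B : Board) (r c : ℕ) (Q : Block k) : Board := fun i j =>
  if h : (r ≤ i ∧ i < r + k) ∧ (c ≤ j ∧ j < c + k) then
    Q ⟨i - r, by omega⟩ ⟨j - c, by omega⟩ else B i j

/-- `Q` has the same connection points on its boundary as `P`, and is connected inside. -/
def Block.Compatible (P Q : Block k) : Prop :=
  (∀ i j : Fin k, (j : ℕ) = 0 → (Q i j).left = (P i j).left) ∧
  (∀ i j : Fin k, (i : ℕ) = 0 → (Q i j).top = (P i j).top) ∧
  (∀ i j : Fin k, (j : ℕ) + 1 = k → (Q i j).right = (P i j).right) ∧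
  (∀ i j : Fin k, (i : ℕ) + 1 = k → (Q i j).bottom = (P i j).bottom) ∧
  (∀ i j j' : Fin k, (j : ℕ) + 1 = (j' : ℕ) → (Q i j).right = (Q i j').left) ∧
  (∀ i i' j : Fin k, (i : ℕ) + 1 = (i' : ℕ) → (Q i j).bottom = (Q i' j).top)

instance (P Q : Block k) : Decidable (P.Compatible Q) := by
  unfold Block.Compatible; infer_instance

/-- The number of non-blank tiles of a block. -/
def Block.count (P : Block k) : ℕ :=
  (Finset.univ.filter fun p : Fin k × Fin k => P p.1 p.2 ≠ T0).card

theorem setBlock_of_not {B : Board} {r c i j : ℕ} {Q : Block k}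
    (h : ¬ (r ≤ i ∧ i < r + k ∧ c ≤ j ∧ j < c + k)) : setBlock B r c Q i j = B i j :=
  dif_neg (by tauto)

theorem setBlock_add {B : Board} {r c : ℕ} {Q : Block k} (i j : Fin k) :
    setBlock B r c Q (r + i) (c + j) = Q i j := by
  have h : (r ≤ r + i ∧ r + (i : ℕ) < r + k) ∧ (c ≤ c + j ∧ c + (j : ℕ) < c + k) := by omega
  simp only [setBlock, dif_pos h, Nat.add_sub_cancel_left]

theorem block_setBlock {B : Board} {r c : ℕ} {Q : Block k} :
    block k (setBlock B r c Q) r c = Q := by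
  funext i j; exact setBlock_add i j

theorem Connected.setBlock {B : Board} (hB : Connected B) {r c : ℕ} {P Q : Block k}
    (hP : block k B r c = P) (h : P.Compatible Q) : Connected (setBlock B r c Q) := by
  subst hP
  obtain ⟨hl, ht, hr, hb, hir, hib⟩ := h
  have key : ∀ i j, (r ≤ i ∧ i < r + k) ∧ (c ≤ j ∧ j < c + k) → ∃ (a b : Fin k), i = r + a ∧
      j = c + b := fun i j h =>
    ⟨⟨i - r, by omega⟩, ⟨j - c, by omega⟩, by simp only; omega, by simp only; omega⟩
  refine ⟨fun i => ?_, fun j => ?_, fun i j => ?_, fun i j => ?_⟩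
  · by_cases h : (r ≤ i ∧ i < r + k) ∧ (c ≤ 0 ∧ 0 < c + k)
    · obtain ⟨a, b, rfl, hb⟩ := key i 0 h
      rw [hb, setBlock_add, hl _ _ (by omega)]
      simp only [block, ← hb]; exact hB.left_edge _
    · rw [setBlock_of_not (by tauto)]; exact hB.left_edge _
  · by_cases h : (r ≤ 0 ∧ 0 < r + k) ∧ (c ≤ j ∧ j < c + k)
    · obtain ⟨a, b, hb, rfl⟩ := key 0 j h
      rw [hb, setBlock_add, ht _ _ (by omega)]
      simp only [block, ← hb]; exact hB.top_edge _
    · rw [setBlock_of_not (by tauto)]; exact hB.top_edge _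
  · by_cases h : (r ≤ i ∧ i < r + k) ∧ (c ≤ j ∧ j < c + k)
    · obtain ⟨a, b, rfl, rfl⟩ := key i j h
      rw [setBlock_add]
      by_cases h' : (b : ℕ) + 1 = k
      · rw [setBlock_of_not (by omega), hr _ _ h', ← hB.right]; rfl
      · rw [show c + (b : ℕ) + 1 = c + ((⟨b + 1, by omega⟩ : Fin k) : ℕ) by simp only; omega,
          setBlock_add]
        exact hir _ _ _ rfl
    · rw [setBlock_of_not (i := i) (j := j) (by tauto)]
      by_cases h' : (r ≤ i ∧ i < r + k) ∧ (c ≤ j + 1 ∧ j + 1 < c + k)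
      · obtain ⟨a, b, rfl, hb⟩ := key i (j + 1) h'
        rw [hb, setBlock_add, hl _ _ (by omega), hB.right, hb]; rfl
      · rw [setBlock_of_not (by tauto), hB.right]
  · by_cases h : (r ≤ i ∧ i < r + k) ∧ (c ≤ j ∧ j < c + k)
    · obtain ⟨a, b, rfl, rfl⟩ := key i j h
      rw [setBlock_add]
      by_cases h' : (a : ℕ) + 1 = k
      · rw [setBlock_of_not (by omega), hb _ _ h', ← hB.bottom]; rfl
      · rw [show r + (a : ℕ) + 1 = r + ((⟨a + 1, by omega⟩ : Fin k) : ℕ) by simp only; omega,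
          setBlock_add]
        exact hib _ _ _ rfl
    · rw [setBlock_of_not (i := i) (j := j) (by tauto)]
      by_cases h' : (r ≤ i + 1 ∧ i + 1 < r + k) ∧ (c ≤ j ∧ j < c + k)
      · obtain ⟨a, b, ha, rfl⟩ := key (i + 1) j h'
        rw [ha, setBlock_add, ht _ _ (by omega), hB.bottom, ha]; rfl
      · rw [setBlock_of_not (by tauto), hB.bottom]

theorem Fits.setBlock {B : Board} {a b r c : ℕ} (h : Fits a b B) (Q : Block k)
    (hr : r + k ≤ a) (hc : c + k ≤ b) : Fits a b (setBlock B r c Q) := fun i j hij => by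
  rw [setBlock_of_not (by omega), h i j hij]

theorem Mosaic.exists_setBlock (M : Mosaic) {r c : ℕ} {P Q : Block k}
    (hP : block k M.board r c = P) (h : P.Compatible Q) :
    ∃ N : Mosaic, N.board = setBlock M.board r c Q := by
  obtain ⟨n, hn⟩ := M.exists_fits
  exact ⟨(M.connected.setBlock hP h).mosaic (a := n + r + k) (b := n + c + k)
    ((hn.mono (by omega) (by omega)).setBlock Q (by omega) (by omega)), rfl⟩

theorem replaceBlock_setBlock {B : Board} {R : Block k → Block k → Prop} {r c : ℕ} {P Q : Block k}
    (hP : block k B r c = P) (h : UpToSymmetry R P Q) : ReplaceBlock R B (setBlock B r c Q) :=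
  ⟨r, c, by rw [hP, block_setBlock]; exact h, fun _ _ hij => setBlock_of_not hij⟩

theorem replaceBlock_setBlock_symm {B : Board} {R : Block k → Block k → Prop} {r c : ℕ}
    {P Q : Block k} (hP : block k B r c = P) (h : UpToSymmetry R Q P) :
    ReplaceBlock R (setBlock B r c Q) B :=
  ⟨r, c, by rw [hP, block_setBlock]; exact h, fun _ _ hij => (setBlock_of_not hij).symm⟩

theorem Mosaic.tileCount_setBlock {M N : Mosaic} {r c : ℕ} {P Q : Block k}
    (hP : block k M.board r c = P) (hN : N.board = setBlock M.board r c Q) :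
    N.tileCount + P.count = M.tileCount + Q.count := by
  let e : Fin k × Fin k → ℕ × ℕ := fun p => (r + p.1, c + p.2)
  have he : Function.Injective e := by
    rintro ⟨i, j⟩ ⟨i', j'⟩ h
    simp only [e, Prod.mk.injEq] at h
    ext <;> simp only <;> omega
  have hW : ∀ B : Board, ({p : ℕ × ℕ | B p.1 p.2 ≠ T0} ∩ Set.range e).ncard
      = (block k B r c).count := by
    intro B
    have : {p : ℕ × ℕ | B p.1 p.2 ≠ T0} ∩ Set.range e =
        e '' {p : Fin k × Fin k | block k B r c p.1 p.2 ≠ T0} := by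
      ext p
      constructor
      · rintro ⟨hp, q, rfl⟩; exact ⟨q, hp, rfl⟩
      · rintro ⟨q, hq, rfl⟩; exact ⟨hq, q, rfl⟩
    rw [this, Set.ncard_image_of_injective _ he, Block.count, ← Set.ncard_coe_finset]
    congr 1; ext p; simp
  have hout : {p : ℕ × ℕ | N.board p.1 p.2 ≠ T0} \ Set.range e =
      {p : ℕ × ℕ | M.board p.1 p.2 ≠ T0} \ Set.range e := by
    ext ⟨i, j⟩
    simp only [Set.mem_sdiff, Set.mem_ofPred_eq]
    refine and_congr_left fun h => ?_
    rw [hN, setBlock_of_not]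
    rintro ⟨h1, h2, h3, h4⟩
    exact h ⟨(⟨i - r, by omega⟩, ⟨j - c, by omega⟩), by simp only [e, Prod.mk.injEq]; omega⟩
  have h1 := Set.ncard_inter_add_ncard_sdiff_eq_ncard {p : ℕ × ℕ | M.board p.1 p.2 ≠ T0}
    (Set.range e) M.support_finite
  have h2 := Set.ncard_inter_add_ncard_sdiff_eq_ncard {p : ℕ × ℕ | N.board p.1 p.2 ≠ T0}
    (Set.range e) N.support_finite
  rw [hW, hP] at h1
  rw [hW, hN, block_setBlock, ← hN, hout] at h2
  unfold Mosaic.tileCount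
  omega

end Replace

/-! ### Recognition of the moves -/

section Symmetry

variable {k : ℕ}

theorem Block.rotate_four (P : Block k) : P.rotate.rotate.rotate.rotate = P := by
  funext i j
  simp only [Block.rotate, Fin.rev_rev]
  cases P i j <;> rfl

theorem Block.reflect_reflect (P : Block k) : P.reflect.reflect = P := by
  funext i j
  simp only [Block.reflect, Fin.rev_rev]
  cases P i j <;> rfl

theorem Block.switch_switch (P : Block k) : P.switch.switch = P := by
  funext i j
  simp only [Block.switch]
  cases P i j <;> rfl

variable {R : Block k → Block k → Prop} {P Q : Block k}

theorem UpToSymmetry.of_rotate (h : UpToSymmetry R P.rotate Q.rotate) : UpToSymmetry R P Q := by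
  have := h.rotate.rotate.rotate
  rwa [Block.rotate_four, Block.rotate_four] at this

theorem UpToSymmetry.of_reflect (h : UpToSymmetry R P.reflect Q.reflect) :
    UpToSymmetry R P Q := by
  have := h.reflect
  rwa [Block.reflect_reflect, Block.reflect_reflect] at this

/-- One of the eight symmetries of the square takes the pair of blocks to one accepted by `f`. -/
def dihedralCheck (f : Block k → Block k → Bool) (P Q : Block k) : Bool :=
  let g : Block k → Block k → Bool := fun P Q => f P Q || f P.reflect Q.reflect
  g P Q || (g P.rotate Q.rotate || (g P.rotate.rotate Q.rotate.rotate ||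
    g P.rotate.rotate.rotate Q.rotate.rotate.rotate))

theorem upToSymmetry_of_dihedralCheck {f : Block k → Block k → Bool}
    (hf : ∀ P Q, f P Q = true → UpToSymmetry R P Q) (h : dihedralCheck f P Q = true) :
    UpToSymmetry R P Q := by
  have hg : ∀ P Q, (f P Q || f P.reflect Q.reflect) = true → UpToSymmetry R P Q := by
    intro P Q h
    rcases Bool.or_eq_true_iff.1 h with h | h
    · exact hf _ _ h
    · exact (hf _ _ h).of_reflect
  simp only [dihedralCheck, Bool.or_eq_true] at h hg
  rcases h with h | h | h | h
  · exact hg _ _ h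
  · exact (hg _ _ h).of_rotate
  · exact (hg _ _ h).of_rotate.of_rotate
  · exact (hg _ _ h).of_rotate.of_rotate.of_rotate

end Symmetry

/-- Decision procedure for `AddArc`. -/
def addArcB : Tile → Tile → Tile → Bool
  | T1, T0, T1 | T1, T3, T7 | T2, T0, T2 | T2, T4, T8 | T3, T0, T3 | T3, T1, T7
  | T4, T0, T4 | T4, T2, T8 => true
  | _, _, _ => false

theorem addArc_of_addArcB {a p q : Tile} (h : addArcB a p q = true) : AddArc a p q := by
  unfold addArcB at h
  split at h <;> first | constructor | cases h

/-- The tile contains the arc of `T2`. -/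
def Tile.has2 : Tile → Bool | T2 | T8 => true | _ => false
/-- The tile contains the arc of `T1`. -/
def Tile.has1 : Tile → Bool | T1 | T7 => true | _ => false
/-- The tile contains the arc of `T3`. -/
def Tile.has3 : Tile → Bool | T3 | T7 => true | _ => false
/-- The tile contains the arc of `T4`. -/
def Tile.has4 : Tile → Bool | T4 | T8 => true | _ => false

theorem Tile.has1_iff {t : Tile} : t.has1 = true ↔ HasArc T1 t := by
  constructor
  · cases t <;> intro h <;> first | exact ⟨_, AddArc.a1⟩ | exact ⟨_, AddArc.b1⟩ | cases h
  · rintro ⟨p, h⟩; cases h <;> rfl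

theorem Tile.has2_iff {t : Tile} : t.has2 = true ↔ HasArc T2 t := by
  constructor
  · cases t <;> intro h <;> first | exact ⟨_, AddArc.a2⟩ | exact ⟨_, AddArc.b2⟩ | cases h
  · rintro ⟨p, h⟩; cases h <;> rfl

theorem Tile.has3_iff {t : Tile} : t.has3 = true ↔ HasArc T3 t := by
  constructor
  · cases t <;> intro h <;> first | exact ⟨_, AddArc.a3⟩ | exact ⟨_, AddArc.b3⟩ | cases h
  · rintro ⟨p, h⟩; cases h <;> rfl

theorem Tile.has4_iff {t : Tile} : t.has4 = true ↔ HasArc T4 t := by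
  constructor
  · cases t <;> intro h <;> first | exact ⟨_, AddArc.a4⟩ | exact ⟨_, AddArc.b4⟩ | cases h
  · rintro ⟨p, h⟩; cases h <;> rfl

/-- The pair `(p, q)` of tiles is one of two given pairs. -/
def pairB (p q : Tile) (p₁ q₁ p₂ q₂ : Tile) : Bool :=
  (p == p₁ && q == q₁) || (p == p₂ && q == q₂)

theorem pair_of_pairB {p q p₁ q₁ p₂ q₂ : Tile} (h : pairB p q p₁ q₁ p₂ q₂ = true) :
    (p = p₁ ∧ q = q₁) ∨ (p = p₂ ∧ q = q₂) := by
  simpa [pairB] using h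

/-- Recognition of the planar isotopy moves in standard position. -/
def isPlanarBase (P Q : Block 2) : Bool :=
  match P 0 0, P 0 1, P 1 0, P 1 1, Q 0 0, Q 0 1, Q 1 0, Q 1 1 with
  | a, b, c, d, a', b', c', d' =>
    (addArcB T2 a' a && addArcB T4 d d' && pairB b b' T4 T6 T5 T2 && pairB c c' T4 T5 T6 T2) ||
    (pairB a a' T3 T6 T5 T1 && pairB b b' T4 T6 T5 T2 && addArcB T3 c c' && addArcB T4 d d') ||
    (a == T4 && a' == T7 && addArcB T1 b b' && addArcB T3 c c' && addArcB T4 d d') ||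
    (a == a' && b == b' && a.has2 && b.has1 && c == T8 && d' == T7 &&
      pairB d c' T9 T10 T10 T9) ||
    (a == a' && d == d' && a.has2 && d.has4 && b == T8 && c' == T8 && pairB c b' T9 T9 T10 T10)

theorem planarMove_of_isPlanarBase {P Q : Block 2} (h : isPlanarBase P Q = true) :
    UpToSymmetry PlanarMove P Q := by
  refine .base ?_
  rw [Matrix.eta_fin_two P, Matrix.eta_fin_two Q]
  simp only [isPlanarBase] at h
  generalize P 0 0 = a, P 0 1 = b, P 1 0 = c, P 1 1 = d at h ⊢
  generalize Q 0 0 = a', Q 0 1 = b', Q 1 0 = c', Q 1 1 = d' at h ⊢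
  simp only [Bool.or_eq_true, Bool.and_eq_true, beq_iff_eq] at h
  rcases h with (((h | h) | h) | h) | h
  · obtain ⟨⟨⟨h1, h2⟩, h3⟩, h4⟩ := h
    exact .push_two (addArc_of_addArcB h1) (addArc_of_addArcB h2) (pair_of_pairB h3)
      (pair_of_pairB h4)
  · obtain ⟨⟨⟨h1, h2⟩, h3⟩, h4⟩ := h
    exact .push_three (pair_of_pairB h1) (pair_of_pairB h2) (addArc_of_addArcB h3)
      (addArc_of_addArcB h4)
  · obtain ⟨⟨⟨⟨rfl, rfl⟩, h2⟩, h3⟩, h4⟩ := h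
    exact .push_four (addArc_of_addArcB h2) (addArc_of_addArcB h3) (addArc_of_addArcB h4)
  · obtain ⟨⟨⟨⟨⟨⟨rfl, rfl⟩, h1⟩, h2⟩, rfl⟩, rfl⟩, h3⟩ := h
    rcases pair_of_pairB h3 with ⟨rfl, rfl⟩ | ⟨rfl, rfl⟩
    · exact .slide_adjacent true (Tile.has2_iff.1 h1) (Tile.has1_iff.1 h2)
    · exact .slide_adjacent false (Tile.has2_iff.1 h1) (Tile.has1_iff.1 h2)
  · obtain ⟨⟨⟨⟨⟨⟨rfl, rfl⟩, h1⟩, h2⟩, rfl⟩, rfl⟩, h3⟩ := h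
    rcases pair_of_pairB h3 with ⟨rfl, rfl⟩ | ⟨rfl, rfl⟩
    · exact .slide_diagonal true (Tile.has2_iff.1 h1) (Tile.has4_iff.1 h2)
    · exact .slide_diagonal false (Tile.has2_iff.1 h1) (Tile.has4_iff.1 h2)

/-- Recognition of the first two Reidemeister moves in standard position. -/
def isReidemeisterBase₂ (P Q : Block 2) : Bool :=
  match P 0 0, P 0 1, P 1 0, P 1 1, Q 0 0, Q 0 1, Q 1 0, Q 1 1 with
  | a, b, c, d, a', b', c', d' =>
    (a == a' && b == b' && c == c' && a.has2 && b.has1 && c.has3 && d == T7 &&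
      (d' == T9 || d' == T10)) ||
    (a == a' && b == b' && a.has2 && b.has1 && c == T8 && d == T7 && pairB c' d' T9 T9 T10 T10) ||
    (a == a' && d == d' && a.has2 && d.has4 && b == T8 && c == T8 && pairB b' c' T9 T10 T10 T9)

theorem reidemeisterMove_of_isReidemeisterBase₂ {P Q : Block 2}
    (h : isReidemeisterBase₂ P Q = true) : UpToSymmetry ReidemeisterMove₂ P Q := by
  refine .base ?_
  rw [Matrix.eta_fin_two P, Matrix.eta_fin_two Q]
  simp only [isReidemeisterBase₂] at h
  generalize P 0 0 = a, P 0 1 = b, P 1 0 = c, P 1 1 = d at h ⊢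
  generalize Q 0 0 = a', Q 0 1 = b', Q 1 0 = c', Q 1 1 = d' at h ⊢
  simp only [Bool.or_eq_true, Bool.and_eq_true, beq_iff_eq] at h
  rcases h with (h | h) | h
  · obtain ⟨⟨⟨⟨⟨⟨⟨rfl, rfl⟩, rfl⟩, h1⟩, h2⟩, h3⟩, rfl⟩, h4⟩ := h
    rcases h4 with rfl | rfl
    · exact .one true (Tile.has2_iff.1 h1) (Tile.has1_iff.1 h2) (Tile.has3_iff.1 h3)
    · exact .one false (Tile.has2_iff.1 h1) (Tile.has1_iff.1 h2) (Tile.has3_iff.1 h3)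
  · obtain ⟨⟨⟨⟨⟨⟨rfl, rfl⟩, h1⟩, h2⟩, rfl⟩, rfl⟩, h3⟩ := h
    rcases pair_of_pairB h3 with ⟨rfl, rfl⟩ | ⟨rfl, rfl⟩
    · exact .two_adjacent true (Tile.has2_iff.1 h1) (Tile.has1_iff.1 h2)
    · exact .two_adjacent false (Tile.has2_iff.1 h1) (Tile.has1_iff.1 h2)
  · obtain ⟨⟨⟨⟨⟨⟨rfl, rfl⟩, h1⟩, h2⟩, rfl⟩, rfl⟩, h3⟩ := h
    rcases pair_of_pairB h3 with ⟨rfl, rfl⟩ | ⟨rfl, rfl⟩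
    · exact .two_diagonal true (Tile.has2_iff.1 h1) (Tile.has4_iff.1 h2)
    · exact .two_diagonal false (Tile.has2_iff.1 h1) (Tile.has4_iff.1 h2)

/-- A planar isotopy move in either direction leads from the block `P` to the block `Q`. -/
def planarCheck (P Q : Block 2) : Bool :=
  decide (P.Compatible Q) && (dihedralCheck isPlanarBase P Q || dihedralCheck isPlanarBase Q P)

/-- One of the first two Reidemeister moves, in either direction, leads from `P` to `Q`. -/
def reidemeisterCheck₂ (P Q : Block 2) : Bool :=
  decide (P.Compatible Q) &&
    (dihedralCheck isReidemeisterBase₂ P Q || dihedralCheck isReidemeisterBase₂ Q P)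

theorem Mosaic.exists_of_planarCheck (M : Mosaic) {r c : ℕ} {P Q : Block 2}
    (hP : block 2 M.board r c = P) (h : planarCheck P Q = true) :
    ∃ N : Mosaic, N.board = setBlock M.board r c Q ∧ PlanarIsotopic M N := by
  simp only [planarCheck, Bool.and_eq_true, decide_eq_true_eq, Bool.or_eq_true] at h
  obtain ⟨N, hN⟩ := M.exists_setBlock hP h.1
  refine ⟨N, hN, ?_⟩
  rcases h.2 with h | h
  · have := upToSymmetry_of_dihedralCheck (fun _ _ => planarMove_of_isPlanarBase) h
    exact .rel _ _ (Or.inl (hN ▸ replaceBlock_setBlock hP this))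
  · have := upToSymmetry_of_dihedralCheck (fun _ _ => planarMove_of_isPlanarBase) h
    exact .symm (.rel _ _ (Or.inl (hN ▸ replaceBlock_setBlock_symm hP this)))

theorem Mosaic.exists_of_reidemeisterCheck₂ (M : Mosaic) {r c : ℕ} {P Q : Block 2}
    (hP : block 2 M.board r c = P) (h : reidemeisterCheck₂ P Q = true) :
    ∃ N : Mosaic, N.board = setBlock M.board r c Q ∧ N.linkType = M.linkType := by
  simp only [reidemeisterCheck₂, Bool.and_eq_true, decide_eq_true_eq, Bool.or_eq_true] at h
  obtain ⟨N, hN⟩ := M.exists_setBlock hP h.1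
  refine ⟨N, hN, ?_⟩
  rcases h.2 with h | h
  · have := upToSymmetry_of_dihedralCheck (fun _ _ => reidemeisterMove_of_isReidemeisterBase₂) h
    have hs : LinkStep M N := Or.inr (Or.inl (hN ▸ replaceBlock_setBlock hP this))
    exact (Quot.sound hs).symm
  · have := upToSymmetry_of_dihedralCheck (fun _ _ => reidemeisterMove_of_isReidemeisterBase₂) h
    have hs : LinkStep N M := Or.inr (Or.inl (hN ▸ replaceBlock_setBlock_symm hP this))
    exact Quot.sound hs

/-! ### Windows -/

/-- The tile with the over/under information of a crossing forgotten: `T9` stands for both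
crossings. -/
def Tile.flat : Tile → Tile | T10 => T9 | t => t

/-- The tiles with a given image under `Tile.flat`. -/
def Tile.lifts : Tile → List Tile | T9 => [T9, T10] | T10 => [] | t => [t]

/-- The ten tiles without over/under information. -/
def flatTiles : List Tile := [T0, T1, T2, T3, T4, T5, T6, T7, T8, T9]

namespace Tile

theorem mem_lifts_flat (t : Tile) : t ∈ t.flat.lifts := by cases t <;> simp [flat, lifts]

theorem flat_of_mem_lifts {s t : Tile} (h : t ∈ s.lifts) : t.flat = s := by
  revert h; cases s <;> simp [lifts] <;> rintro (rfl | rfl) <;> rfl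

theorem flat_mem (t : Tile) : t.flat ∈ flatTiles := by cases t <;> decide

@[simp] theorem flat_flat (t : Tile) : t.flat.flat = t.flat := by cases t <;> rfl
@[simp] theorem flat_left (t : Tile) : t.flat.left = t.left := by cases t <;> rfl
@[simp] theorem flat_right (t : Tile) : t.flat.right = t.right := by cases t <;> rfl
@[simp] theorem flat_top (t : Tile) : t.flat.top = t.top := by cases t <;> rfl
@[simp] theorem flat_bottom (t : Tile) : t.flat.bottom = t.bottom := by cases t <;> rfl
@[simp] theorem flat_has1 (t : Tile) : t.flat.has1 = t.has1 := by cases t <;> rfl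
@[simp] theorem flat_has2 (t : Tile) : t.flat.has2 = t.has2 := by cases t <;> rfl
@[simp] theorem flat_has3 (t : Tile) : t.flat.has3 = t.has3 := by cases t <;> rfl
@[simp] theorem flat_has4 (t : Tile) : t.flat.has4 = t.has4 := by cases t <;> rfl

theorem flat_eq_iff {s t : Tile} (ht : t ≠ T9 ∧ t ≠ T10) : s.flat = t ↔ s = t := by
  obtain ⟨h1, h2⟩ := ht
  cases s <;> cases t <;> simp_all [flat]

theorem flat_eq_zero {t : Tile} : t.flat = T0 ↔ t = T0 := flat_eq_iff (by decide)

/-- The tile carries two arcs. -/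
def isDouble : Tile → Bool | T7 | T8 => true | _ => false

@[simp] theorem flat_isDouble (t : Tile) : t.flat.isDouble = t.isDouble := by cases t <;> rfl

/-- The tile without the arc of `T1`. -/
def erase1 : Tile → Tile | T1 => T0 | T7 => T3 | t => t
/-- The tile without the arc of `T2`. -/
def erase2 : Tile → Tile | T2 => T0 | T8 => T4 | t => t
/-- The tile without the arc of `T3`. -/
def erase3 : Tile → Tile | T3 => T0 | T7 => T1 | t => t
/-- The tile without the arc of `T4`. -/
def erase4 : Tile → Tile | T4 => T0 | T8 => T2 | t => t

end Tile

/-- The block with over/under information forgotten. -/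
def Block.flat {k : ℕ} (P : Block k) : Block k := fun i j => (P i j).flat

/-- The `2 × 2` blocks with a given image under `Block.flat`. -/
def Block.lifts (P : Block 2) : List (Block 2) :=
  (P 0 0).lifts.flatMap fun a => (P 0 1).lifts.flatMap fun b => (P 1 0).lifts.flatMap fun c =>
    (P 1 1).lifts.map fun d => !![a, b; c, d]

theorem Block.mem_lifts {P Q : Block 2} (h : P.flat = Q) : P ∈ Q.lifts := by
  subst h
  simp only [Block.lifts, List.mem_flatMap, List.mem_map]
  exact ⟨_, Tile.mem_lifts_flat _, _, Tile.mem_lifts_flat _, _, Tile.mem_lifts_flat _, _,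
    Tile.mem_lifts_flat _, (Matrix.eta_fin_two P).symm⟩

theorem Block.flat_of_mem_lifts {P Q : Block 2} (h : P ∈ Q.lifts) : P.flat = Q := by
  simp only [Block.lifts, List.mem_flatMap, List.mem_map] at h
  obtain ⟨a, ha, b, hb, c, hc, d, hd, rfl⟩ := h
  rw [Matrix.eta_fin_two Q, ← Tile.flat_of_mem_lifts ha, ← Tile.flat_of_mem_lifts hb,
    ← Tile.flat_of_mem_lifts hc, ← Tile.flat_of_mem_lifts hd]
  funext i j
  fin_cases i <;> fin_cases j <;> rfl

theorem Block.count_flat {k : ℕ} (P : Block k) : P.flat.count = P.count := by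
  simp only [Block.count, Block.flat, ne_eq, Tile.flat_eq_zero]

/-- For every choice of the over-strands in `P` there is one in `Q` such that a planar isotopy move
leads from `P` to `Q`. -/
def flatCheck (P Q : Block 2) : Bool :=
  P.lifts.all fun P' => Q.lifts.any fun Q' => planarCheck P' Q'

theorem Mosaic.exists_of_flatCheck (M : Mosaic) {r c : ℕ} {P Q : Block 2}
    (hP : (block 2 M.board r c).flat = P) (h : flatCheck P Q = true) :
    ∃ (N : Mosaic) (Q' : Block 2), Q'.flat = Q ∧ N.board = setBlock M.board r c Q' ∧
      PlanarIsotopic M N ∧ N.tileCount + P.count = M.tileCount + Q.count := by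
  simp only [flatCheck, List.all_eq_true, List.any_eq_true] at h
  obtain ⟨Q', hQ', h⟩ := h _ (Block.mem_lifts hP)
  obtain ⟨N, hN, hMN⟩ := M.exists_of_planarCheck rfl h
  refine ⟨N, Q', Block.flat_of_mem_lifts hQ', hN, hMN, ?_⟩
  have := Mosaic.tileCount_setBlock rfl hN
  rwa [← Block.count_flat (block 2 M.board r c), hP, ← Block.count_flat Q',
    Block.flat_of_mem_lifts hQ'] at this

/-- The two by two window with tiles `a`, `b`, `c`, `d` can be simplified: three of its tiles
contain the arc around the common corner, and not all four carry two arcs, or two adjacent ones do,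
not both double, and the other two are not joined, or two opposite tiles carry parallel single
arcs. -/
def badWindow (a b c d : Tile) : Bool :=
  match a.has2, b.has1, c.has3, d.has4 with
  | true, true, true, true => true
  | true, true, true, false | true, true, false, true | true, false, true, true
  | false, true, true, true => !(a.isDouble && b.isDouble && c.isDouble && d.isDouble)
  | true, true, false, false => !(c.right || (a.isDouble && b.isDouble))
  | false, false, true, true => !(a.right || (c.isDouble && d.isDouble))
  | true, false, true, false => !(b.bottom || (a.isDouble && c.isDouble))
  | false, true, false, true => !(a.bottom || (b.isDouble && d.isDouble))
  | true, false, false, false => !a.isDouble && d.has2 && !d.isDouble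
  | false, true, false, false => !b.isDouble && c.has1 && !c.isDouble
  | false, false, true, false => !c.isDouble && b.has3 && !b.isDouble
  | false, false, false, true => !d.isDouble && a.has4 && !a.isDouble
  | _, _, _, _ => false

/-- The result of the planar isotopy move that simplifies a window. -/
def reduceWindow (a b c d : Tile) : Block 2 :=
  match a.has2, b.has1, c.has3, d.has4 with
  | true, true, true, _ => !![a.erase2, b.erase1; c.erase3, T2]
  | true, true, false, true => !![a.erase2, b.erase1; T1, d.erase4]
  | true, false, true, true => !![a.erase2, T3; c.erase3, d.erase4]
  | false, true, true, true => !![T4, b.erase1; c.erase3, d.erase4]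
  | true, true, false, false =>
    !![a.erase2, b.erase1; if c = T6 then T2 else T5, if d = T6 then T1 else T5]
  | false, false, true, true =>
    !![if a = T6 then T3 else T5, if b = T6 then T4 else T5; c.erase3, d.erase4]
  | true, false, true, false =>
    !![a.erase2, if b = T5 then T2 else T6; c.erase3, if d = T5 then T3 else T6]
  | false, true, false, true =>
    !![if a = T5 then T1 else T6, b.erase1; if c = T5 then T4 else T6, d.erase4]
  | true, false, false, false => !![T0, if b = T4 then T6 else T2; if c = T4 then T5 else T2, T8]
  | false, true, false, false => !![if a = T3 then T6 else T1, T0; T7, if d = T3 then T5 else T1]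
  | false, false, true, false => !![if a = T1 then T5 else T3, T7; T0, if d = T1 then T6 else T3]
  | false, false, false, true => !![T8, if b = T2 then T5 else T4; if c = T2 then T6 else T4, T0]
  | _, _, _, _ => !![a, b; c, d]

/-- All four tiles of the window contain the arc around the common corner. -/
def circleWindow (a b c d : Tile) : Bool := a.has2 && b.has1 && c.has3 && d.has4

/-- Three tiles of the window contain the arc around the common corner, and the fourth one is a
crossing. -/
def loopWindow (a b c d : Tile) : Bool :=
  (a.has2 && b.has1 && c.has3 && d.flat == T9) || (a.has2 && b.has1 && c.flat == T9 && d.has4) ||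
  (a.has2 && b.flat == T9 && c.has3 && d.has4) || (a.flat == T9 && b.has1 && c.has3 && d.has4)

/-- The tiles of the window fit together. -/
def joinedWindow (a b c d : Tile) : Bool :=
  a.right == b.left && c.right == d.left && a.bottom == c.top && b.bottom == d.top

set_option maxRecDepth 10000 in
/-- Every bad window that is free of circles and loops is simplified by `reduceWindow`. That its
lower right tile is not blank ensures that the window lies inside every rectangle that contains the
mosaic. -/
theorem badWindow_cases_flat : ∀ a ∈ flatTiles, ∀ b ∈ flatTiles, ∀ c ∈ flatTiles, ∀ d ∈ flatTiles,
    joinedWindow a b c d = true → badWindow a b c d = true →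
      d ≠ T0 ∧ (circleWindow a b c d = true ∨ loopWindow a b c d = true ∨
        (flatCheck !![a, b; c, d] (reduceWindow a b c d) = true ∧
          (reduceWindow a b c d).count < Block.count !![a, b; c, d])) := by
  decide +kernel

/-- The four tiles of the `2 × 2` window in row `r` and column `c` satisfy `f`. -/
def Window (f : Tile → Tile → Tile → Tile → Bool) (B : Board) (r c : ℕ) : Prop :=
  f (B r c) (B r (c + 1)) (B (r + 1) c) (B (r + 1) (c + 1)) = true

theorem badWindow_flat (a b c d : Tile) :
    badWindow a.flat b.flat c.flat d.flat = badWindow a b c d := by simp [badWindow]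

theorem circleWindow_flat (a b c d : Tile) :
    circleWindow a.flat b.flat c.flat d.flat = circleWindow a b c d := by simp [circleWindow]

theorem loopWindow_flat (a b c d : Tile) :
    loopWindow a.flat b.flat c.flat d.flat = loopWindow a b c d := by simp [loopWindow]

theorem Connected.joinedWindow_flat {B : Board} (h : Connected B) (r c : ℕ) :
    _root_.joinedWindow (B r c).flat (B r (c + 1)).flat (B (r + 1) c).flat
      (B (r + 1) (c + 1)).flat = true := by
  simp [_root_.joinedWindow, h.right, h.bottom]

theorem block_two_flat (B : Board) (r c : ℕ) :
    (block 2 B r c).flat = !![(B r c).flat, (B r (c + 1)).flat; (B (r + 1) c).flat,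
      (B (r + 1) (c + 1)).flat] :=
  Matrix.eta_fin_two _

/-- A bad window of a mosaic contains a circle or the loop of a first Reidemeister move, or a
planar isotopy move in it saves tiles. -/
theorem Mosaic.badWindow_cases (M : Mosaic) {r c : ℕ} (h : Window badWindow M.board r c) :
    Window circleWindow M.board r c ∨ Window loopWindow M.board r c ∨
      ∃ N : Mosaic, PlanarIsotopic M N ∧ N.tileCount < M.tileCount ∧
        ∀ a b, Fits a b M.board → Fits a b N.board := by
  rw [Window, ← badWindow_flat] at h
  obtain ⟨hd, h⟩ := badWindow_cases_flat _ (Tile.flat_mem _) _ (Tile.flat_mem _) _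
    (Tile.flat_mem _) _ (Tile.flat_mem _) (M.connected.joinedWindow_flat r c) h
  rw [circleWindow_flat, loopWindow_flat] at h
  refine h.imp id (Or.imp id ?_)
  rintro ⟨hf, hc⟩
  obtain ⟨N, Q, -, hN, hMN, ht⟩ := M.exists_of_flatCheck (block_two_flat _ r c) hf
  refine ⟨N, hMN, by omega, fun a b hab => ?_⟩
  rw [hN]
  have : ¬ (a ≤ r + 1 ∨ b ≤ c + 1) := fun hn => hd (Tile.flat_eq_zero.2 (hab _ _ hn))
  exact hab.setBlock Q (by omega) (by omega)

/-! ### Loops -/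

/-- The number of crossings of a mosaic. -/
noncomputable def Mosaic.crossingCount (M : Mosaic) : ℕ :=
  {p : ℕ × ℕ | (M.board p.1 p.2).IsCrossing}.ncard

theorem Mosaic.crossing_finite (M : Mosaic) :
    {p : ℕ × ℕ | (M.board p.1 p.2).IsCrossing}.Finite :=
  M.support_finite.subset fun p hp h => by
    rcases hp with hp | hp <;> rw [hp] at h <;> cases h

/-- `Q` arises from `P` by replacing a crossing in position `(i, j)` by two arcs. -/
def smoothedAt (P Q : Block 2) (i j : Fin 2) : Bool :=
  (P i j == T9 || P i j == T10) && (Q i j).isDouble &&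
    decide (∀ i' j', (i' == i && j' == j || Q i' j' == P i' j') = true)

/-- A first Reidemeister move that replaces a crossing by two arcs keeps the positions of the blank
tiles and lowers the number of crossings. -/
theorem Mosaic.exists_of_smoothedAt (M : Mosaic) {r c : ℕ} {Q : Block 2}
    (h : reidemeisterCheck₂ (block 2 M.board r c) Q = true) {i j : Fin 2}
    (hs : smoothedAt (block 2 M.board r c) Q i j = true) :
    ∃ N : Mosaic, N.linkType = M.linkType ∧ (∀ i j, N.board i j = T0 ↔ M.board i j = T0) ∧
      N.crossingCount < M.crossingCount := by
  obtain ⟨N, hN, hMN⟩ := M.exists_of_reidemeisterCheck₂ rfl h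
  simp only [smoothedAt, Bool.and_eq_true, Bool.or_eq_true, beq_iff_eq, decide_eq_true_eq] at hs
  obtain ⟨⟨hP, hQ⟩, hne⟩ := hs
  have hNp : N.board (r + i) (c + j) = Q i j := by rw [hN]; exact setBlock_add i j
  have hN' : ∀ i' j', ¬ (i' = r + i ∧ j' = c + j) → N.board i' j' = M.board i' j' := by
    intro i' j' hij
    rw [hN]
    by_cases hin : r ≤ i' ∧ i' < r + 2 ∧ c ≤ j' ∧ j' < c + 2
    · obtain ⟨u, rfl⟩ : ∃ u : Fin 2, i' = r + u := ⟨⟨i' - r, by omega⟩, by simp only; omega⟩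
      obtain ⟨v, rfl⟩ : ∃ v : Fin 2, j' = c + v := ⟨⟨j' - c, by omega⟩, by simp only; omega⟩
      rw [setBlock_add]
      exact (hne u v).resolve_left fun h => hij (by rw [h.1, h.2]; exact ⟨rfl, rfl⟩)
    · exact setBlock_of_not hin
  refine ⟨N, hMN, fun i' j' => ?_, Set.ncard_lt_ncard ⟨fun p hp => ?_, fun hsub => ?_⟩
    M.crossing_finite⟩
  · by_cases hij : i' = r + i ∧ j' = c + j
    · obtain ⟨rfl, rfl⟩ := hij
      rw [hNp]
      refine ⟨fun h => ?_, fun h => ?_⟩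
      · rw [h] at hQ; cases hQ
      · rw [show block 2 M.board r c i j = T0 from h] at hP
        rcases hP with hP | hP <;> cases hP
    · rw [hN' _ _ hij]
  · by_cases hij : p.1 = r + i ∧ p.2 = c + j
    · have hp' : (N.board p.1 p.2).IsCrossing := hp
      rw [hij.1, hij.2, hNp] at hp'
      rcases hp' with hp' | hp' <;> rw [hp'] at hQ <;> cases hQ
    · have hp' : (N.board p.1 p.2).IsCrossing := hp
      rwa [hN' _ _ hij] at hp'
  · have h1 : (r + (i : ℕ), c + (j : ℕ)) ∈ {p : ℕ × ℕ | (N.board p.1 p.2).IsCrossing} := hsub hP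
    have h2 : (N.board (r + i) (c + j)).IsCrossing := h1
    rw [hNp] at h2
    rcases h2 with h2 | h2 <;> rw [h2] at hQ <;> cases hQ

theorem Tile.has1_cases {t : Tile} (h : t.has1 = true) : t = T1 ∨ t = T7 := by
  cases t <;> simp_all [Tile.has1]
theorem Tile.has2_cases {t : Tile} (h : t.has2 = true) : t = T2 ∨ t = T8 := by
  cases t <;> simp_all [Tile.has2]
theorem Tile.has3_cases {t : Tile} (h : t.has3 = true) : t = T3 ∨ t = T7 := by
  cases t <;> simp_all [Tile.has3]
theorem Tile.has4_cases {t : Tile} (h : t.has4 = true) : t = T4 ∨ t = T8 := by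
  cases t <;> simp_all [Tile.has4]

theorem Tile.flat_eq_T9_iff {t : Tile} : t.flat = T9 ↔ t.IsCrossing := by
  cases t <;> simp [Tile.flat, Tile.IsCrossing]

theorem Window.loop_cases {B : Board} {r c : ℕ} (h : Window loopWindow B r c) :
    ((B r c).has2 = true ∧ (B r (c + 1)).has1 = true ∧ (B (r + 1) c).has3 = true ∧
      (B (r + 1) (c + 1)).IsCrossing) ∨
    ((B r c).has2 = true ∧ (B r (c + 1)).has1 = true ∧ (B (r + 1) c).IsCrossing ∧
      (B (r + 1) (c + 1)).has4 = true) ∨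
    ((B r c).has2 = true ∧ (B r (c + 1)).IsCrossing ∧ (B (r + 1) c).has3 = true ∧
      (B (r + 1) (c + 1)).has4 = true) ∨
    ((B r c).IsCrossing ∧ (B r (c + 1)).has1 = true ∧ (B (r + 1) c).has3 = true ∧
      (B (r + 1) (c + 1)).has4 = true) := by
  simpa only [Window, loopWindow, Bool.or_eq_true, Bool.and_eq_true, beq_iff_eq,
    Tile.flat_eq_T9_iff, or_assoc, and_assoc] using h

/-- A loop can be removed by a first Reidemeister move. -/
theorem Mosaic.exists_of_loopWindow (M : Mosaic) {r c : ℕ} (h : Window loopWindow M.board r c) :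
    ∃ N : Mosaic, N.linkType = M.linkType ∧ (∀ i j, N.board i j = T0 ↔ M.board i j = T0) ∧
      N.crossingCount < M.crossingCount := by
  have hb : block 2 M.board r c = !![M.board r c, M.board r (c + 1); M.board (r + 1) c,
      M.board (r + 1) (c + 1)] := Matrix.eta_fin_two _
  have key : ∀ (Q : Block 2) (i j : Fin 2), reidemeisterCheck₂ (block 2 M.board r c) Q = true →
      smoothedAt (block 2 M.board r c) Q i j = true → _ := fun Q i j h hs =>
    M.exists_of_smoothedAt h hs
  rw [hb] at key
  rcases h.loop_cases with ⟨ha, hb, hc, hd⟩ | ⟨ha, hb, hc, hd⟩ | ⟨ha, hb, hc, hd⟩ |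
    ⟨ha, hb, hc, hd⟩
  · rcases Tile.has2_cases ha with ha | ha <;> rcases Tile.has1_cases hb with hb | hb <;>
    rcases Tile.has3_cases hc with hc | hc <;> rcases hd with hd | hd <;>
    rw [ha, hb, hc, hd] at key <;>
    refine key !![M.board r c, M.board r (c + 1); M.board (r + 1) c, T7] 1 1 ?_ ?_ <;>
    rw [ha, hb, hc] <;> decide +kernel
  · rcases Tile.has2_cases ha with ha | ha <;> rcases Tile.has1_cases hb with hb | hb <;>
    rcases Tile.has4_cases hd with hd | hd <;> rcases hc with hc | hc <;>
    rw [ha, hb, hc, hd] at key <;>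
    refine key !![M.board r c, M.board r (c + 1); T8, M.board (r + 1) (c + 1)] 1 0 ?_ ?_ <;>
    rw [ha, hb, hd] <;> decide +kernel
  · rcases Tile.has2_cases ha with ha | ha <;> rcases Tile.has3_cases hc with hc | hc <;>
    rcases Tile.has4_cases hd with hd | hd <;> rcases hb with hb | hb <;>
    rw [ha, hb, hc, hd] at key <;>
    refine key !![M.board r c, T8; M.board (r + 1) c, M.board (r + 1) (c + 1)] 0 1 ?_ ?_ <;>
    rw [ha, hc, hd] <;> decide +kernel
  · rcases Tile.has1_cases hb with hb | hb <;> rcases Tile.has3_cases hc with hc | hc <;>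
    rcases Tile.has4_cases hd with hd | hd <;> rcases ha with ha | ha <;>
    rw [ha, hb, hc, hd] at key <;>
    refine key !![T7, M.board r (c + 1); M.board (r + 1) c, M.board (r + 1) (c + 1)] 0 0 ?_ ?_ <;>
    rw [hb, hc, hd] <;> decide +kernel

theorem Connected.sameRegion_of_has1 {B : Board} (hB : Connected B) {i j : ℕ}
    (h : (B i j).has1 = true) : SameRegion B (i, j) (i + 1, j + 1) := by
  rcases Tile.has1_cases h with h | h
  · refine .trans _ _ _ (.rel _ _ (.horizontal i j ?_)) (.rel _ _ (.vertical i (j + 1) ?_))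
    · rw [h]; rfl
    · rw [← hB.right, h]; rfl
  · exact .rel _ _ (.diagonal i j h)

theorem Connected.sameRegion_of_has3 {B : Board} (hB : Connected B) {i j : ℕ}
    (h : (B i j).has3 = true) : SameRegion B (i, j) (i + 1, j + 1) := by
  rcases Tile.has3_cases h with h | h
  · refine .trans _ _ _ (.rel _ _ (.vertical i j ?_)) (.rel _ _ (.horizontal (i + 1) j ?_))
    · rw [h]; rfl
    · rw [← hB.bottom, h]; rfl
  · exact .rel _ _ (.diagonal i j h)

theorem sameRegion_of_has2 {B : Board} {i j : ℕ}
    (h : (B i j).has2 = true) : SameRegion B (i, j + 1) (i + 1, j) := by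
  rcases Tile.has2_cases h with h | h
  · refine .trans _ _ _ (.symm _ _ (.rel _ _ (.horizontal i j ?_)))
      (.rel _ _ (.vertical i j ?_))
    · rw [h]; rfl
    · rw [h]; rfl
  · exact .rel _ _ (.antidiagonal i j h)

theorem Connected.sameRegion_of_has4 {B : Board} (hB : Connected B) {i j : ℕ}
    (h : (B i j).has4 = true) : SameRegion B (i, j + 1) (i + 1, j) := by
  rcases Tile.has4_cases h with h | h
  · refine .trans _ _ _ (.rel _ _ (.vertical i (j + 1) ?_))
      (.symm _ _ (.rel _ _ (.horizontal (i + 1) j ?_)))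
    · rw [← hB.right, h]; rfl
    · rw [← hB.bottom, h]; rfl
  · exact .rel _ _ (.antidiagonal i j h)

theorem Mosaic.not_isReduced_of_loopWindow (M : Mosaic) {r c : ℕ}
    (h : Window loopWindow M.board r c) : ¬ IsReducedMosaic M.board := by
  have hB := M.connected
  intro hred
  rcases h.loop_cases with ⟨ha, hb, hc, hd⟩ | ⟨ha, hb, hc, hd⟩ | ⟨ha, hb, hc, hd⟩ |
    ⟨ha, hb, hc, hd⟩
  · exact (hred _ _ hd).2 (.trans _ _ _ (.symm _ _ (hB.sameRegion_of_has1 hb))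
      (.trans _ _ _ (sameRegion_of_has2 ha) (hB.sameRegion_of_has3 hc)))
  · exact (hred _ _ hc).1 (.trans _ _ _ (.symm _ _ (sameRegion_of_has2 ha))
      (.trans _ _ _ (hB.sameRegion_of_has1 hb) (hB.sameRegion_of_has4 hd)))
  · exact (hred _ _ hb).1 (.trans _ _ _ (sameRegion_of_has2 ha)
      (.trans _ _ _ (hB.sameRegion_of_has3 hc) (.symm _ _ (hB.sameRegion_of_has4 hd))))
  · exact (hred _ _ ha).2 (.trans _ _ _ (hB.sameRegion_of_has1 hb)
      (.trans _ _ _ (hB.sameRegion_of_has4 hd) (.symm _ _ (hB.sameRegion_of_has3 hc))))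

/-! ### Sequences of moves in a rectangle -/

/-- The image of a board under a map of tiles. -/
def mapBoard (φ : Tile → Tile) (B : Board) : Board := fun i j => φ (B i j)

/-- The image of a block under a map of tiles. -/
def mapBlock {k : ℕ} (φ : Tile → Tile) (P : Block k) : Block k := fun i j => φ (P i j)

/-- The entry number `n` of a list, with default value `d`. The recursors are applied directly,
which the kernel evaluates faster than a recursive definition. -/
def entry {α : Type} (d : α) (l : List α) : ℕ → α :=
  List.rec (fun _ => d) (fun a _ ih n => Nat.casesOn n a ih) l

theorem entry_eq {α : Type} (d : α) (l : List α) (n : ℕ) : entry d l n = l.getD n d := by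
  induction l generalizing n with
  | nil => rfl
  | cons a l ih =>
    cases n with
    | zero => rfl
    | succ n => exact ih n

/-- The tile in row `i` and column `j` of a list of rows, blank outside of the list. -/
def tileAt (L : List (List Tile)) : Board := fun i j => entry T0 (entry [] L i) j

theorem tileAt_eq (L : List (List Tile)) (i j : ℕ) : tileAt L i j = (L.getD i []).getD j T0 := by
  rw [tileAt, entry_eq, entry_eq]

/-- The list of the first `n` rows of a board, cut off after `m` columns. -/
def tabulate (n m : ℕ) (B : Board) : List (List Tile) :=
  (List.range n).map fun i => (List.range m).map fun j => B i j

theorem tileAt_tabulate {n m : ℕ} {B : Board} {i j : ℕ} (hi : i < n) (hj : j < m) :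
    tileAt (tabulate n m B) i j = B i j := by
  simp [tileAt_eq, tabulate, hi, hj]

/-- A kind of moves that can be checked on boards whose tiles are known only up to the map
`forget`. -/
structure MoveSystem where
  forget : Tile → Tile
  forget_left : ∀ t, (forget t).left = t.left
  forget_top : ∀ t, (forget t).top = t.top
  forget_T0 : ∀ t, forget t = T0 ↔ t = T0
  forget_T5 : ∀ t, forget t = T5 ↔ t = T5
  forget_T6 : ∀ t, forget t = T6 ↔ t = T6
  Rel : Mosaic → Mosaic → Prop
  of_planarIsotopic : ∀ {M N}, PlanarIsotopic M N → Rel M N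
  trans : ∀ {M N P}, Rel M N → Rel N P → Rel M P
  check₂ : Block 2 → Block 2 → Bool
  check₃ : Block 3 → Block 3 → Bool
  sound₂ : ∀ {M : Mosaic} {r c : ℕ} {Q : Block 2},
    check₂ (mapBlock forget (block 2 M.board r c)) Q = true →
      ∃ (N : Mosaic) (Q' : Block 2), mapBlock forget Q' = Q ∧ N.board = setBlock M.board r c Q' ∧
        Rel M N
  sound₃ : ∀ {M : Mosaic} {r c : ℕ} {Q : Block 3},
    check₃ (mapBlock forget (block 3 M.board r c)) Q = true →
      ∃ (N : Mosaic) (Q' : Block 3), mapBlock forget Q' = Q ∧ N.board = setBlock M.board r c Q' ∧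
        Rel M N

/-- A rectangular array of tiles. -/
structure Region where
  rows : ℕ
  cols : ℕ
  tiles : List (List Tile)

/-- A change of a rectangular array of tiles: insertion or deletion of a row or column, or
replacement of a square block. -/
inductive Change where
  | insertRow (r : ℕ)
  | insertCol (c : ℕ)
  | deleteRow (r : ℕ)
  | deleteCol (c : ℕ)
  | block₂ (r c : ℕ) (Q : Block 2)
  | block₃ (r c : ℕ) (Q : Block 3)

theorem mapBoard_setBlock {k : ℕ} (φ : Tile → Tile) (B : Board) (r c : ℕ) (Q : Block k) :
    mapBoard φ (setBlock B r c Q) = setBlock (mapBoard φ B) r c (mapBlock φ Q) := by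
  funext i j
  simp only [mapBoard, setBlock, mapBlock]
  split_ifs <;> rfl

namespace MoveSystem

variable (S : MoveSystem)

theorem forget_zero : S.forget T0 = T0 := (S.forget_T0 _).2 rfl
theorem forget_five : S.forget T5 = T5 := (S.forget_T5 _).2 rfl
theorem forget_six : S.forget T6 = T6 := (S.forget_T6 _).2 rfl

theorem mapBoard_insertRow (B : Board) (r : ℕ) :
    mapBoard S.forget (insertRow r B) = insertRow r (mapBoard S.forget B) := by
  funext i j
  simp only [mapBoard, insertRow, S.forget_top]
  split_ifs <;> simp [forget_zero, forget_six]

theorem mapBoard_insertCol (B : Board) (c : ℕ) :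
    mapBoard S.forget (insertCol c B) = insertCol c (mapBoard S.forget B) := by
  funext i j
  simp only [mapBoard, insertCol, S.forget_left]
  split_ifs <;> simp [forget_zero, forget_five]

theorem mapBoard_deleteRow (B : Board) (r : ℕ) :
    mapBoard S.forget (deleteRow r B) = deleteRow r (mapBoard S.forget B) := by
  funext i j
  simp only [mapBoard, deleteRow]
  split_ifs <;> rfl

theorem mapBoard_deleteCol (B : Board) (c : ℕ) :
    mapBoard S.forget (deleteCol c B) = deleteCol c (mapBoard S.forget B) := by
  funext i j
  simp only [mapBoard, deleteCol]
  split_ifs <;> rfl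

/-- The array after a change, provided that this change is a legitimate move. Deletions are
allowed only if `whole` holds, that is, if the array comprises all non-blank tiles. -/
def exec (whole : Bool) (R : Region) : Change → Option Region
  | .insertRow r => if r < R.rows then
      some ⟨R.rows + 1, R.cols, tabulate (R.rows + 1) R.cols (insertRow r (tileAt R.tiles))⟩
    else none
  | .insertCol c => if c < R.cols then
      some ⟨R.rows, R.cols + 1, tabulate R.rows (R.cols + 1) (insertCol c (tileAt R.tiles))⟩
    else none
  | .deleteRow r => if whole && decide (r < R.rows) && (List.range R.cols).all
        (fun j => tileAt R.tiles r j == T0 || tileAt R.tiles r j == T6) then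
      some ⟨R.rows - 1, R.cols, tabulate (R.rows - 1) R.cols (deleteRow r (tileAt R.tiles))⟩
    else none
  | .deleteCol c => if whole && decide (c < R.cols) && (List.range R.rows).all
        (fun i => tileAt R.tiles i c == T0 || tileAt R.tiles i c == T5) then
      some ⟨R.rows, R.cols - 1, tabulate R.rows (R.cols - 1) (deleteCol c (tileAt R.tiles))⟩
    else none
  | .block₂ r c Q => if decide (r + 2 ≤ R.rows) && decide (c + 2 ≤ R.cols) &&
        S.check₂ (block 2 (tileAt R.tiles) r c) Q then
      some ⟨R.rows, R.cols, tabulate R.rows R.cols (setBlock (tileAt R.tiles) r c Q)⟩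
    else none
  | .block₃ r c Q => if decide (r + 3 ≤ R.rows) && decide (c + 3 ≤ R.cols) &&
        S.check₃ (block 3 (tileAt R.tiles) r c) Q then
      some ⟨R.rows, R.cols, tabulate R.rows R.cols (setBlock (tileAt R.tiles) r c Q)⟩
    else none

/-- The array after a sequence of changes. -/
def run (whole : Bool) : Region → List Change → Option Region
  | R, [] => some R
  | R, s :: l => match S.exec whole R s with
    | some R' => run whole R' l
    | none => none

/-- The array `R` occurs on the board `B`, with its top left tile in row `r₀` and column `c₀`. -/
def Occurs (whole : Bool) (R : Region) (r₀ c₀ : ℕ) (B : Board) : Prop :=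
  (∀ i < R.rows, ∀ j < R.cols, S.forget (B (r₀ + i) (c₀ + j)) = tileAt R.tiles i j) ∧
    (whole = true → r₀ = 0 ∧ c₀ = 0 ∧ Fits R.rows R.cols B)

variable {S} {whole : Bool} {R R' : Region} {r₀ c₀ : ℕ} {M : Mosaic}

theorem Occurs.block_eq {k r c : ℕ} (h : S.Occurs whole R r₀ c₀ M.board) (hr : r + k ≤ R.rows)
    (hc : c + k ≤ R.cols) :
    mapBlock S.forget (block k M.board (r₀ + r) (c₀ + c)) = block k (tileAt R.tiles) r c := by
  funext i j
  simp only [mapBlock, block, Nat.add_assoc]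
  exact h.1 _ (by omega) _ (by omega)

theorem Occurs.setBlock {k r c : ℕ} {Q : Block k} (h : S.Occurs whole R r₀ c₀ M.board)
    (hr : r + k ≤ R.rows) (hc : c + k ≤ R.cols) :
    S.Occurs whole ⟨R.rows, R.cols, tabulate R.rows R.cols
      (setBlock (tileAt R.tiles) r c (mapBlock S.forget Q))⟩ r₀ c₀
      (setBlock M.board (r₀ + r) (c₀ + c) Q) := by
  refine ⟨fun i hi j hj => ?_, fun hw => ?_⟩
  · rw [tileAt_tabulate hi hj]
    change mapBoard S.forget (_root_.setBlock M.board (r₀ + r) (c₀ + c) Q) (r₀ + i) (c₀ + j) = _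
    rw [mapBoard_setBlock]
    by_cases hin : r ≤ i ∧ i < r + k ∧ c ≤ j ∧ j < c + k
    · obtain ⟨u, rfl⟩ : ∃ u : Fin k, i = r + u := ⟨⟨i - r, by omega⟩, by simp only; omega⟩
      obtain ⟨v, rfl⟩ : ∃ v : Fin k, j = c + v := ⟨⟨j - c, by omega⟩, by simp only; omega⟩
      rw [← Nat.add_assoc, ← Nat.add_assoc, setBlock_add, setBlock_add]
    · rw [setBlock_of_not hin, setBlock_of_not (by omega)]
      exact h.1 i hi j hj
  · obtain ⟨rfl, rfl, hf⟩ := h.2 hw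
    exact ⟨rfl, rfl, hf.setBlock Q (by simpa using hr) (by simpa using hc)⟩

theorem exec_sound {s : Change} (h : S.Occurs whole R r₀ c₀ M.board)
    (hs : S.exec whole R s = some R') :
    ∃ N : Mosaic, S.Rel M N ∧ S.Occurs whole R' r₀ c₀ N.board := by
  cases s with
  | insertRow r =>
    simp only [exec, Option.ite_none_right_eq_some, Option.some.injEq] at hs
    obtain ⟨hr, rfl⟩ := hs
    obtain ⟨N, hN, hMN⟩ := M.exists_insertRow (r₀ + r)
    refine ⟨N, S.of_planarIsotopic hMN, fun i hi j hj => ?_, fun hw => ?_⟩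
    · rw [tileAt_tabulate hi hj, hN]
      change mapBoard S.forget (_root_.insertRow (r₀ + r) M.board) (r₀ + i) (c₀ + j) = _
      rw [mapBoard_insertRow]
      simp only [_root_.insertRow]
      have hB : mapBoard S.forget M.board (r₀ + r) (c₀ + j) = _ := h.1 r hr j hj
      by_cases h1 : i < r
      · rw [if_pos (by omega), if_pos h1]; exact h.1 i (by omega) j hj
      · rw [if_neg (by omega), if_neg h1]
        simp only [hB]
        by_cases h2 : i = r
        · rw [if_pos (by omega), if_pos h2]
        · rw [if_neg (by omega), if_neg h2, show r₀ + i - 1 = r₀ + (i - 1) by omega]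
          exact h.1 _ (by simp only at hi; omega) j hj
    · obtain ⟨rfl, rfl, hf⟩ := h.2 hw
      exact ⟨rfl, rfl, hN ▸ hf.insertRow _⟩
  | insertCol c =>
    simp only [exec, Option.ite_none_right_eq_some, Option.some.injEq] at hs
    obtain ⟨hr, rfl⟩ := hs
    obtain ⟨N, hN, hMN⟩ := M.exists_insertCol (c₀ + c)
    refine ⟨N, S.of_planarIsotopic hMN, fun i hi j hj => ?_, fun hw => ?_⟩
    · rw [tileAt_tabulate hi hj, hN]
      change mapBoard S.forget (_root_.insertCol (c₀ + c) M.board) (r₀ + i) (c₀ + j) = _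
      rw [mapBoard_insertCol]
      simp only [_root_.insertCol]
      have hB : mapBoard S.forget M.board (r₀ + i) (c₀ + c) = _ := h.1 i hi c hr
      by_cases h1 : j < c
      · rw [if_pos (by omega), if_pos h1]; exact h.1 i hi j (by omega)
      · rw [if_neg (by omega), if_neg h1]
        simp only [hB]
        by_cases h2 : j = c
        · rw [if_pos (by omega), if_pos h2]
        · rw [if_neg (by omega), if_neg h2, show c₀ + j - 1 = c₀ + (j - 1) by omega]
          exact h.1 _ hi _ (by simp only at hj; omega)
    · obtain ⟨rfl, rfl, hf⟩ := h.2 hw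
      exact ⟨rfl, rfl, hN ▸ hf.insertCol _⟩
  | deleteRow r =>
    simp only [exec, Option.ite_none_right_eq_some, Option.some.injEq, Bool.and_eq_true,
      decide_eq_true_eq, List.all_eq_true, Bool.or_eq_true, beq_iff_eq, List.mem_range] at hs
    obtain ⟨⟨⟨hw, hr⟩, hp⟩, rfl⟩ := hs
    obtain ⟨rfl, rfl, hf⟩ := h.2 hw
    have hpure : PureRow r M.board := by
      intro j
      by_cases hj : j < R.cols
      · have := hp j hj
        rw [← h.1 r hr j hj, S.forget_T0, S.forget_T6] at this
        simpa using this
      · exact Or.inl (hf _ _ (by omega))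
    obtain ⟨N, hN, hMN, -⟩ := M.exists_deleteRow hpure
    refine ⟨N, S.of_planarIsotopic hMN, fun i hi j hj => ?_, fun _ =>
      ⟨rfl, rfl, hN ▸ hf.deleteRow hr⟩⟩
    rw [tileAt_tabulate hi hj, hN, Nat.zero_add, Nat.zero_add]
    change mapBoard S.forget (_root_.deleteRow r M.board) i j = _
    rw [mapBoard_deleteRow]
    simp only [_root_.deleteRow, mapBoard]
    have h1 := h.1 i (by simp only at hi; omega) j hj
    have h2 := h.1 (i + 1) (by simp only at hi; omega) j hj
    rw [Nat.zero_add, Nat.zero_add] at h1 h2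
    rw [h1, h2]
  | deleteCol c =>
    simp only [exec, Option.ite_none_right_eq_some, Option.some.injEq, Bool.and_eq_true,
      decide_eq_true_eq, List.all_eq_true, Bool.or_eq_true, beq_iff_eq, List.mem_range] at hs
    obtain ⟨⟨⟨hw, hr⟩, hp⟩, rfl⟩ := hs
    obtain ⟨rfl, rfl, hf⟩ := h.2 hw
    have hpure : PureCol c M.board := by
      intro i
      by_cases hi : i < R.rows
      · have := hp i hi
        rw [← h.1 i hi c hr, S.forget_T0, S.forget_T5] at this
        simpa using this
      · exact Or.inl (hf _ _ (by omega))
    obtain ⟨N, hN, hMN, -⟩ := M.exists_deleteCol hpure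
    refine ⟨N, S.of_planarIsotopic hMN, fun i hi j hj => ?_, fun _ =>
      ⟨rfl, rfl, hN ▸ hf.deleteCol hr⟩⟩
    rw [tileAt_tabulate hi hj, hN, Nat.zero_add, Nat.zero_add]
    change mapBoard S.forget (_root_.deleteCol c M.board) i j = _
    rw [mapBoard_deleteCol]
    simp only [_root_.deleteCol, mapBoard]
    have h1 := h.1 i hi j (by simp only at hj; omega)
    have h2 := h.1 i hi (j + 1) (by simp only at hj; omega)
    rw [Nat.zero_add, Nat.zero_add] at h1 h2
    rw [h1, h2]
  | block₂ r c Q =>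
    simp only [exec, Option.ite_none_right_eq_some, Option.some.injEq, Bool.and_eq_true,
      decide_eq_true_eq] at hs
    obtain ⟨⟨⟨hr, hc⟩, hk⟩, rfl⟩ := hs
    rw [← h.block_eq hr hc] at hk
    obtain ⟨N, Q', rfl, hN, hMN⟩ := S.sound₂ hk
    exact ⟨N, hMN, hN ▸ h.setBlock hr hc⟩
  | block₃ r c Q =>
    simp only [exec, Option.ite_none_right_eq_some, Option.some.injEq, Bool.and_eq_true,
      decide_eq_true_eq] at hs
    obtain ⟨⟨⟨hr, hc⟩, hk⟩, rfl⟩ := hs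
    rw [← h.block_eq hr hc] at hk
    obtain ⟨N, Q', rfl, hN, hMN⟩ := S.sound₃ hk
    exact ⟨N, hMN, hN ▸ h.setBlock hr hc⟩

theorem run_sound {l : List Change} (h : S.Occurs whole R r₀ c₀ M.board)
    (hl : S.run whole R l = some R') :
    ∃ N : Mosaic, S.Rel M N ∧ S.Occurs whole R' r₀ c₀ N.board := by
  induction l generalizing R M with
  | nil =>
    simp only [run, Option.some.injEq] at hl
    exact ⟨M, S.of_planarIsotopic (.refl M), hl ▸ h⟩
  | cons s l ih =>
    simp only [run] at hl
    split at hl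
    · next R₁ hR₁ =>
      obtain ⟨N, hMN, hN⟩ := exec_sound h hR₁
      obtain ⟨P, hNP, hP⟩ := ih hN hl
      exact ⟨P, S.trans hMN hNP, hP⟩
    · cases hl

end MoveSystem

/-- Planar isotopy moves on boards without over/under information. -/
def planarSystem : MoveSystem where
  forget := Tile.flat
  forget_left := Tile.flat_left
  forget_top := Tile.flat_top
  forget_T0 _ := Tile.flat_eq_iff (by decide)
  forget_T5 _ := Tile.flat_eq_iff (by decide)
  forget_T6 _ := Tile.flat_eq_iff (by decide)
  Rel := PlanarIsotopic
  of_planarIsotopic := id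
  trans := .trans
  check₂ := flatCheck
  check₃ _ _ := false
  sound₂ {M _ _ _} h := by
    obtain ⟨N, Q', h1, h2, h3, -⟩ := M.exists_of_flatCheck rfl h
    exact ⟨N, Q', h1, h2, h3⟩
  sound₃ h := by cases h

/-! ### Circles -/

/-- The moves that make a circle around the middle of a two by two window small enough to bound a
disc disjoint from the rest of the diagram: the window is stretched, its corners are pushed towards
the centre, and the four caps that remain are pulled in. -/
def circleChanges (a b c d : Tile) : List Change :=
  [.insertRow 1, .insertRow 1, .insertCol 1, .insertCol 1,
    .block₂ 0 0 !![a.erase2, T2; T2, T4], .block₂ 0 2 !![T1, b.erase1; T3, T1],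
    .block₂ 2 0 !![T3, T1; c.erase3, T3], .block₂ 2 2 !![T2, T4; T4, d.erase4],
    .block₂ 0 1 !![T0, T0; T5, T5], .block₂ 1 0 !![T0, T2; T0, T6],
    .block₂ 1 2 !![T1, T0; T6, T0], .block₂ 2 1 !![T3, T4; T0, T0]]

theorem circleChanges_run : ∀ a ∈ [T2, T8], ∀ b ∈ [T1, T7], ∀ c ∈ [T3, T7], ∀ d ∈ [T4, T8],
    (planarSystem.run false ⟨2, 2, [[a, b], [c, d]]⟩ (circleChanges a b c d)).map
      (fun R => (R.rows, R.cols, R.tiles)) = some (4, 4,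
        [[a.erase2, T0, T0, b.erase1], [T0, T2, T1, T0], [T0, T3, T4, T0],
          [c.erase3, T0, T0, d.erase4]]) := by
  decide +kernel

/-- The tiles around a circle may carry further strands; planar isotopies separate the circle from
them. -/
theorem Mosaic.hasUnknottedUnlinkedComponent_of_circleWindow (M : Mosaic) {r c : ℕ}
    (h : Window circleWindow M.board r c) : HasUnknottedUnlinkedComponent M.linkType := by
  simp only [Window, circleWindow, Bool.and_eq_true] at h
  obtain ⟨⟨⟨ha, hb⟩, hc⟩, hd⟩ := h
  have hrun := circleChanges_run (M.board r c) (by simpa using Tile.has2_cases ha)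
    (M.board r (c + 1)) (by simpa using Tile.has1_cases hb)
    (M.board (r + 1) c) (by simpa using Tile.has3_cases hc)
    (M.board (r + 1) (c + 1)) (by simpa using Tile.has4_cases hd)
  simp only [Option.map_eq_some_iff, Prod.mk.injEq] at hrun
  obtain ⟨R, hR, hrows, hcols, htiles⟩ := hrun
  have hocc : planarSystem.Occurs false ⟨2, 2, [[M.board r c, M.board r (c + 1)],
      [M.board (r + 1) c, M.board (r + 1) (c + 1)]]⟩ r c M.board := by
    have key : ∀ t : Tile, t.has1 = true ∨ t.has2 = true ∨ t.has3 = true ∨ t.has4 = true →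
        planarSystem.forget t = t := by
      intro t
      cases t <;> decide
    refine ⟨fun i hi j hj => ?_, fun h => by cases h⟩
    simp only at hi hj
    interval_cases i <;> interval_cases j
    exacts [key _ (by simp [ha]), key _ (by simp [hb]), key _ (by simp [hc]), key _ (by simp [hd])]
  obtain ⟨N, hMN, hN⟩ := MoveSystem.run_sound hocc hR
  have htile : ∀ i < 4, ∀ j < 4, tileAt R.tiles i j ≠ T9 ∧ tileAt R.tiles i j ≠ T10 →
      N.board (r + i) (c + j) = tileAt R.tiles i j := by
    intro i hi j hj ht
    exact (Tile.flat_eq_iff ht).1 (hN.1 i (by omega) j (by omega))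
  rw [PlanarIsotopic.linkType_eq hMN]
  refine ⟨N, rfl, r + 1, c + 1, ?_⟩
  rw [htiles] at htile
  rw [Matrix.eta_fin_two (block 2 N.board (r + 1) (c + 1))]
  have h1 : N.board (r + 1) (c + 1) = T2 := htile 1 (by simp) 1 (by simp) (by simp [tileAt_eq])
  have h2 : N.board (r + 1) (c + 2) = T1 := htile 1 (by simp) 2 (by simp) (by simp [tileAt_eq])
  have h3 : N.board (r + 2) (c + 1) = T3 := htile 2 (by simp) 1 (by simp) (by simp [tileAt_eq])
  have h4 : N.board (r + 2) (c + 2) = T4 := htile 2 (by simp) 2 (by simp) (by simp [tileAt_eq])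
  rw [← h1, ← h2, ← h3, ← h4]
  rfl

/-! ### Enumeration of the boards without bad windows -/

/-- `f` holds for every tile without over/under information, with prescribed connection points on
its left and top sides. -/
def branch (f : Tile → Bool) : Bool → Bool → Bool
  | false, false => f T0 && f T2
  | true, false => f T1 && f T5
  | false, true => f T3 && f T6
  | true, true => f T4 && (f T7 && (f T8 && f T9))

/-- `f` holds for every tile without over/under information, with prescribed connection points on
its left and top sides, and with none on its bottom side. -/
def branchLast (f : Tile → Bool) : Bool → Bool → Bool
  | false, false => f T0
  | true, false => f T5
  | false, true => f T3
  | true, true => f T4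

/-- `K` applied to the list `l` in reverse order, followed by `l'`. In contrast to
`K (l.reverse ++ l')`, the list is evaluated before `K` is. -/
def reverseThen {α : Type} (K : List α → Bool) : List α → List α → Bool
  | [], l' => K l'
  | a :: l, l' => reverseThen K l (a :: l')

/-- `K` accepts every row that fits below a given row without creating a bad window. The row above
is given by its tile `d` above the tile `l` that was chosen last, and by the list of its tiles
further to the right; `cur` is the list of the tiles chosen so far, in reverse order. -/
def searchRow (br : (Tile → Bool) → Bool → Bool → Bool) (K : List Tile → Bool) :
    List Tile → Tile → Tile → List Tile → Bool
  | [], _, l, cur => match l.right with | true => true | false => reverseThen K cur []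
  | a :: as, d, l, cur =>
    br (fun x => badWindow d a l x || searchRow br K as a x (x :: cur)) l.right a.bottom

/-- `leaf` accepts all completions of a board by `k + 1` rows, below the row `above`, that create
no bad window; the list `acc` of the rows above starts with the lowest one. -/
def search (leaf : List (List Tile) → Bool) : ℕ → List Tile → List (List Tile) → Bool
  | 0, above, acc => searchRow branchLast (fun r => reverseThen leaf (r :: acc) []) above T0 T0 []
  | k + 1, above, acc => searchRow branch (fun r => search leaf k r (r :: acc)) above T0 T0 []

theorem reverseThen_eq {α : Type} (K : List α → Bool) (l l' : List α) :
    reverseThen K l l' = K (l.reverse ++ l') := by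
  induction l generalizing l' with
  | nil => rfl
  | cons a l ih => simp [reverseThen, ih]

theorem branch_sound {f : Tile → Bool} {l t : Bool} (h : branch f l t = true) (x : Tile)
    (hx : x ∈ flatTiles) (hl : x.left = l) (ht : x.top = t) : f x = true := by
  subst hl ht
  cases x <;> simp_all [branch, Tile.left, Tile.top, flatTiles]

theorem branchLast_sound {f : Tile → Bool} {l t : Bool} (h : branchLast f l t = true) (x : Tile)
    (hx : x ∈ flatTiles ∧ x.bottom = false) (hl : x.left = l) (ht : x.top = t) : f x = true := by
  subst hl ht
  cases x <;> simp_all [branchLast, Tile.left, Tile.top, Tile.bottom, flatTiles]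

/-- If the search accepts, then `K` accepts every row `v` below `a` without bad windows: the branch
that chooses the tiles of `v` is never cut off. -/
theorem searchRow_sound {br : (Tile → Bool) → Bool → Bool → Bool} {K : List Tile → Bool}
    {good : Tile → Prop} {a v : ℕ → Tile} {n : ℕ}
    (hbr : ∀ {f l t}, br f l t = true → ∀ x, good x → x.left = l → x.top = t → f x = true)
    (hgood : ∀ j, good (v j)) (hl : ∀ j, (v j).right = (v (j + 1)).left)
    (ht : ∀ j, (a j).bottom = (v j).top) (hend : (v n).right = false)
    (hbad : ∀ j, badWindow (a j) (a (j + 1)) (v j) (v (j + 1)) = false) (m : ℕ) :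
    ∀ (j : ℕ) (cur : List Tile), j + m = n →
      searchRow br K ((List.range' (j + 1) m).map a) (a j) (v j) cur = true →
        K (cur.reverse ++ (List.range' (j + 1) m).map v) = true := by
  induction m with
  | zero =>
    rintro j cur rfl h
    simpa [searchRow, reverseThen_eq, show (v j).right = false from hend] using h
  | succ m ih =>
    intro j cur hj h
    simp only [List.range'_succ, List.map_cons, searchRow] at h
    have := hbr h _ (hgood (j + 1)) (hl j).symm (ht (j + 1)).symm
    rw [hbad, Bool.false_or] at this
    simpa [List.range'_succ] using ih (j + 1) _ (by omega) this

/-- The first `i` rows of a board, without row and column `0`, starting with the lowest row. -/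
def reversedRows (F : Board) (m : ℕ) : ℕ → List (List Tile)
  | 0 => []
  | i + 1 => (List.range' 1 m).map (F (i + 1)) :: reversedRows F m i

/-- A board with tiles without over/under information, whose row and column `0` are blank, and
which has no bad window and fits into `n` rows and `m` columns apart from row and column `0`. -/
structure Framed (n m : ℕ) (F : Board) : Prop where
  flat : ∀ i j, F i j ∈ flatTiles
  row_zero : ∀ j, F 0 j = T0
  col_zero : ∀ i, F i 0 = T0
  right : ∀ i j, (F i j).right = (F i (j + 1)).left
  bottom : ∀ i j, (F i j).bottom = (F (i + 1) j).top
  outside : ∀ i j, n < i ∨ m < j → F i j = T0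
  bad : ∀ i j, badWindow (F i j) (F i (j + 1)) (F (i + 1) j) (F (i + 1) (j + 1)) = false

theorem Framed.right_end {n m : ℕ} {F : Board} (hF : Framed n m F) (i : ℕ) :
    (F i m).right = false := by
  rw [hF.right, hF.outside _ _ (by omega)]; rfl

theorem Framed.bottom_end {n m : ℕ} {F : Board} (hF : Framed n m F) (j : ℕ) :
    (F n j).bottom = false := by
  rw [hF.bottom, hF.outside _ _ (by omega)]; rfl

/-- If the search accepts, then `leaf` accepts every board without bad windows. -/
theorem search_sound {leaf : List (List Tile) → Bool} {F : Board} {n m : ℕ} (hF : Framed n m F)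
    (k : ℕ) : ∀ i, i + k + 1 = n →
      search leaf k ((List.range' 1 m).map (F i)) (reversedRows F m i) = true →
        leaf (reversedRows F m n).reverse = true := by
  induction k with
  | zero =>
    rintro i rfl h
    simp only [search] at h
    have := searchRow_sound (K := fun r => reverseThen leaf (r :: reversedRows F m i) [])
      (good := fun x => x ∈ flatTiles ∧ x.bottom = false) branchLast_sound
      (fun j => ⟨hF.flat _ _, hF.bottom_end j⟩) (hF.right (i + 1)) (hF.bottom i)
      (hF.right_end (i + 1)) (hF.bad i) m 0 [] (by omega)
      (by rw [hF.col_zero, hF.col_zero]; exact h)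
    simpa [reversedRows, reverseThen_eq] using this
  | succ k ih =>
    rintro i hi h
    simp only [search] at h
    have := searchRow_sound
      (K := fun r => search leaf k r (r :: reversedRows F m i))
      (good := fun x => x ∈ flatTiles) branch_sound
      (fun j => hF.flat _ _) (hF.right (i + 1)) (hF.bottom i)
      (hF.right_end (i + 1)) (hF.bad i) m 0 [] (by omega)
      (by rw [hF.col_zero, hF.col_zero]; exact h)
    refine ih (i + 1) (by omega) ?_
    simpa [reversedRows] using this

theorem reversedRows_eq (F : Board) (m n : ℕ) :
    (reversedRows F m n).reverse =
      (List.range n).map fun i => (List.range' 1 m).map (F (i + 1)) := by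
  induction n with
  | zero => rfl
  | succ n ih => simp [reversedRows, List.range_succ, ih]

theorem tileAt_reversedRows (F : Board) {m n i j : ℕ} (hi : i < n) (hj : j < m) :
    tileAt (reversedRows F m n).reverse i j = F (i + 1) (j + 1) := by
  simp [reversedRows_eq, tileAt_eq, hi, hj, Nat.add_comm]

/-- A board without bad windows, bordered by a blank row and a blank column, without over/under
information. -/
theorem Connected.framed {B : Board} (hB : Connected B) {n m : ℕ} (hf : Fits n m B)
    (hbad : ∀ r c, ¬ Window badWindow B r c) :
    Framed n m fun i j => if i = 0 ∨ j = 0 then T0 else (B (i - 1) (j - 1)).flat := by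
  refine ⟨fun i j => ?_, fun j => ?_, fun i => ?_, fun i j => ?_, fun i j => ?_,
    fun i j h => ?_, fun i j => ?_⟩
  · split_ifs
    · decide
    · exact Tile.flat_mem _
  · simp
  · simp
  · obtain _ | i := i
    · simp; rfl
    obtain _ | j := j
    · have := hB.left_edge i
      simpa [this] using show T0.right = false from rfl
    · simpa using hB.right i j
  · obtain _ | j := j
    · simp; rfl
    obtain _ | i := i
    · have := hB.top_edge j
      simpa [this] using show T0.bottom = false from rfl
    · simpa using hB.bottom i j
  · split_ifs
    · rfl
    · rw [hf _ _ (by omega)]; rfl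
  · have h0 : ∀ x y : Tile, x.left = false → y.left = false → badWindow T0 x T0 y = false := by
      intro x y; cases x <;> cases y <;> decide
    have h1 : ∀ x y : Tile, x.top = false → y.top = false → badWindow T0 T0 x y = false := by
      intro x y; cases x <;> cases y <;> decide
    obtain _ | i := i <;> obtain _ | j := j
    · simpa using h0 T0 (B 0 0).flat rfl (by simpa using hB.left_edge 0)
    · simpa using h1 (B 0 j).flat (B 0 (j + 1)).flat (by simpa using hB.top_edge j)
        (by simpa using hB.top_edge (j + 1))
    · simpa using h0 (B i 0).flat (B (i + 1) 0).flat (by simpa using hB.left_edge i)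
        (by simpa using hB.left_edge (i + 1))
    · simpa [badWindow_flat, Window] using hbad i j

/-- A test that all boards found by the search pass holds for every mosaic without bad windows. -/
theorem Mosaic.leaf_of_search {leaf : List (List Tile) → Bool} (M : Mosaic) {n m : ℕ}
    (hs : search leaf n (List.replicate (m + 1) T0) [] = true)
    (hf : Fits (n + 1) (m + 1) M.board) (hbad : ∀ r c, ¬ Window badWindow M.board r c) :
    ∃ L, leaf L = true ∧ planarSystem.Occurs true ⟨n + 1, m + 1, L⟩ 0 0 M.board := by
  have hF := M.connected.framed hf hbad
  refine ⟨_, search_sound (leaf := leaf) hF n 0 (by omega) ?_, fun i hi j hj => ?_, fun _ =>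
    ⟨rfl, rfl, hf⟩⟩
  · simpa [reversedRows, List.map_const'] using hs
  · rw [tileAt_reversedRows _ hi hj]
    simp [planarSystem]

/-! ### Five by five mosaics -/

/-- The number of non-blank tiles of a rectangular array. -/
def Region.count (R : Region) : ℕ :=
  ((Finset.range R.rows ×ˢ Finset.range R.cols).filter fun p => tileAt R.tiles p.1 p.2 ≠ T0).card

theorem MoveSystem.Occurs.tileCount_eq {S : MoveSystem} {R : Region} {M : Mosaic}
    (h : S.Occurs true R 0 0 M.board) : M.tileCount = R.count := by
  rw [Region.count, ← Set.ncard_coe_finset, Mosaic.tileCount]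
  congr 1
  ext ⟨i, j⟩
  have h1 := h.1 i
  have h2 := (h.2 rfl).2.2 i j
  simp only [Nat.zero_add] at h1
  by_cases hij : R.rows ≤ i ∨ R.cols ≤ j
  · have : ¬ (i < R.rows ∧ j < R.cols) := by omega
    simp [h2 hij, this]
  · have hij' : i < R.rows ∧ j < R.cols := by omega
    simp [hij', ← h1 hij'.1 j hij'.2, S.forget_T0]

/-- The tile is not blank. -/
def Tile.nonblank : Tile → Bool | T0 => false | _ => true
/-- The tile is blank or a vertical segment. -/
def Tile.isVertical : Tile → Bool | T0 | T6 => true | _ => false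
/-- The tile is blank or a horizontal segment. -/
def Tile.isHorizontal : Tile → Bool | T0 | T5 => true | _ => false

/-- All tiles in row `r` satisfy `f`. -/
def Region.rowAll (R : Region) (f : Tile → Bool) (r : ℕ) : Bool :=
  (List.range R.cols).all fun j => f (tileAt R.tiles r j)
/-- All tiles in column `c` satisfy `f`. -/
def Region.colAll (R : Region) (f : Tile → Bool) (c : ℕ) : Bool :=
  (List.range R.rows).all fun i => f (tileAt R.tiles i c)

/-- A row of blank tiles and vertical segments, or a column of blank tiles and horizontal
segments, contains a non-blank tile. -/
def pureCheck (R : Region) : Bool :=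
  ((List.range R.rows).any fun r =>
    R.rowAll Tile.isVertical r && !R.rowAll (fun t => !t.nonblank) r) ||
  ((List.range R.cols).any fun c =>
    R.colAll Tile.isHorizontal c && !R.colAll (fun t => !t.nonblank) c)

/-- The first or the last row, and the first or the last column, are blank. -/
def shrinkCheck (R : Region) : Bool :=
  (R.rowAll (fun t => !t.nonblank) (R.rows - 1) || R.rowAll (fun t => !t.nonblank) 0) &&
    (R.colAll (fun t => !t.nonblank) (R.cols - 1) || R.colAll (fun t => !t.nonblank) 0)

/-- Some planar isotopy moves that keep the tile number. -/
def equalMoves (a b c d : Tile) : List (Block 2) :=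
  match a, b, c, d with
  | T0, T6, T5, T4 => [!![T2, T4; T4, T0]]
  | T5, T1, T0, T6 => [!![T1, T0; T3, T1]]
  | T2, T5, T6, T0 => [!![T0, T2; T2, T4]]
  | T6, T0, T3, T5 => [!![T3, T1; T0, T3]]
  | T1, T6, T7, T8 => [!![T5, T4; T1, T2]]
  | T5, T7, T2, T8 => [!![T1, T3; T6, T2]]
  | T8, T7, T6, T3 => [!![T4, T3; T2, T5]]
  | T8, T4, T7, T5 => [!![T4, T6; T1, T3]]
  | T6, T2, T7, T8 => [!![T3, T5; T1, T2]]
  | T3, T7, T5, T8 => [!![T6, T3; T4, T2]]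
  | T8, T7, T4, T6 => [!![T4, T3; T5, T1]]
  | T8, T5, T7, T1 => [!![T4, T2; T1, T6]]
  | T2, T1, T8, T9 => [!![T2, T1; T9, T7]]
  | T2, T9, T3, T7 => [!![T2, T8; T3, T9]]
  | T9, T8, T3, T4 => [!![T7, T9; T3, T4]]
  | T7, T1, T9, T4 => [!![T9, T1; T8, T4]]
  | T2, T1, T9, T7 => [!![T2, T1; T8, T9]]
  | T2, T8, T3, T9 => [!![T2, T9; T3, T7]]
  | T7, T9, T3, T4 => [!![T9, T8; T3, T4]]
  | T9, T1, T8, T4 => [!![T7, T1; T9, T4]]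
  | T2, T8, T9, T4 => [!![T2, T9; T8, T4]]
  | T7, T1, T3, T9 => [!![T9, T1; T3, T7]]
  | T2, T9, T8, T4 => [!![T2, T8; T9, T4]]
  | T9, T1, T3, T7 => [!![T7, T1; T3, T9]]
  | T4, T6, T5, T8 => [!![T8, T4; T4, T2]]
  | T5, T7, T1, T6 => [!![T1, T3; T7, T1]]
  | T8, T5, T6, T2 => [!![T4, T2; T2, T8]]
  | T6, T3, T7, T5 => [!![T3, T7; T1, T3]]
  | _, _, _, _ => []

theorem equalMoves_sound : ∀ a ∈ flatTiles, ∀ b ∈ flatTiles, ∀ c ∈ flatTiles, ∀ d ∈ flatTiles,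
    ∀ Q ∈ equalMoves a b c d, flatCheck !![a, b; c, d] Q = true ∧
      Q.count = Block.count !![a, b; c, d] := by
  decide +kernel

/-- The window is bad, and a planar isotopy simplifies it. -/
def planarBadWindow (a b c d : Tile) : Bool := badWindow a b c d && !loopWindow a b c d

/-- A planar isotopy move that keeps the tile number leads to an array that can be simplified by
another one. -/
def moveCheck (R : Region) : Bool :=
  (List.range (R.rows - 1)).any fun r => (List.range (R.cols - 1)).any fun c =>
    (equalMoves (tileAt R.tiles r c) (tileAt R.tiles r (c + 1)) (tileAt R.tiles (r + 1) c)
      (tileAt R.tiles (r + 1) (c + 1))).any fun Q =>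
        let R' : Region :=
          ⟨R.rows, R.cols, tabulate R.rows R.cols (setBlock (tileAt R.tiles) r c Q)⟩
        pureCheck R' || (List.range (R.rows - 1)).any fun r =>
          (List.range (R.cols - 1)).any fun c =>
          planarBadWindow (tileAt R'.tiles r c) (tileAt R'.tiles r (c + 1))
            (tileAt R'.tiles (r + 1) c) (tileAt R'.tiles (r + 1) (c + 1))

/-- A sequence of planar isotopies of five by five boards, reflected in the horizontal axis if `v`
holds and in the vertical axis if `h` holds: with the help of an additional row, a crossing
is moved diagonally through the board. -/
def cornerChanges (v h : Bool) : List Change :=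
  let w (r c : ℕ) (Q : Block 2) : Change :=
    let Q := if h then Q.reflect else Q
    .block₂ (if v then 4 - r else r) (if h then 3 - c else c)
      (if v then Q.reflect.rotate.rotate else Q)
  let r := if v then 2 else 3
  [.insertRow r, w 2 2 !![T8, T4; T3, T1], w 2 3 !![T8, T4; T7, T1], w 3 3 !![T9, T1; T8, T4],
    w 2 2 !![T8, T9; T3, T7], w 3 2 !![T6, T3; T4, T2], w 3 3 !![T6, T0; T6, T0], .deleteRow r]

/-- The sequence of planar isotopies `cornerChanges` saves tiles. -/
def cornerCheck (R : Region) : Bool :=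
  [(false, false), (false, true), (true, false), (true, true)].any fun p =>
    match planarSystem.run true R (cornerChanges p.1 p.2) with
    | some R' => decide (R'.rows ≤ 5) && decide (R'.cols ≤ 5) && decide (R'.count < R.count)
    | none => false

/-- The rows of the layout. -/
def layoutRows : List (List (Option Tile)) :=
  [[some T0, some T2, some T1, some T0, some T0], [some T2, none, none, some T1, some T0],
    [some T3, none, none, none, some T1], [some T0, some T3, none, none, some T4],
    [some T0, some T0, some T3, some T4, some T0]]

/-- The tile `t` is allowed by an entry of the layout. -/
def layoutTile (t : Tile) : Option Tile → Bool
  | some s => t == s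
  | none => t.left && t.right && t.top && t.bottom

/-- The upper left five by five block of a board has the layout. -/
def layoutCheck (B : Board) : Bool :=
  (List.range 5).all fun i => (List.range 5).all fun j =>
    layoutTile (B i j) (entry none (entry [] layoutRows i) j)

/-- The test of the five by five boards without bad windows. -/
def fiveCheck (R : Region) : Bool :=
  shrinkCheck R || (pureCheck R || (layoutCheck (tileAt R.tiles) ||
    (layoutCheck (fun i j => (tileAt R.tiles i (4 - j)).reflect) ||
      (moveCheck R || cornerCheck R))))

set_option maxRecDepth 10000 in
/-- Every five by five board without bad windows passes the test `fiveCheck`. -/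
theorem search_five : search (fun L => fiveCheck ⟨5, 5, L⟩) 4
    (List.replicate 5 T0) [] = true := by
  decide +kernel

theorem Tile.nonblank_iff {t : Tile} : t.nonblank = true ↔ t ≠ T0 := by
  cases t <;> simp [Tile.nonblank]

theorem Tile.isVertical_iff {t : Tile} : t.isVertical = true ↔ t = T0 ∨ t = T6 := by
  cases t <;> simp [Tile.isVertical]

theorem Tile.isHorizontal_iff {t : Tile} : t.isHorizontal = true ↔ t = T0 ∨ t = T5 := by
  cases t <;> simp [Tile.isHorizontal]

section Sound

variable {R : Region} {M : Mosaic}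

theorem Occurs.flat_eq (h : planarSystem.Occurs true R 0 0 M.board) {i j : ℕ} (hi : i < R.rows)
    (hj : j < R.cols) : (M.board i j).flat = tileAt R.tiles i j := by
  have := h.1 i hi j hj
  rwa [Nat.zero_add, Nat.zero_add] at this

theorem Occurs.rowAll_iff (h : planarSystem.Occurs true R 0 0 M.board) {f : Tile → Bool}
    (hf : ∀ t, f t.flat = f t) (h0 : f T0 = true) {r : ℕ} (hr : r < R.rows) :
    R.rowAll f r = true ↔ ∀ j, f (M.board r j) = true := by
  simp only [Region.rowAll, List.all_eq_true, List.mem_range]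
  have key : ∀ j < R.cols, (M.board r j).flat = tileAt R.tiles r j := fun j hj =>
    Occurs.flat_eq h hr hj
  refine ⟨fun H j => ?_, fun H j hj => ?_⟩
  · by_cases hj : j < R.cols
    · rw [← hf, key j hj]; exact H j hj
    · rw [(h.2 rfl).2.2 _ _ (by omega), h0]
  · rw [← key j hj, hf]; exact H j

theorem Occurs.colAll_iff (h : planarSystem.Occurs true R 0 0 M.board) {f : Tile → Bool}
    (hf : ∀ t, f t.flat = f t) (h0 : f T0 = true) {c : ℕ} (hc : c < R.cols) :
    R.colAll f c = true ↔ ∀ i, f (M.board i c) = true := by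
  simp only [Region.colAll, List.all_eq_true, List.mem_range]
  have key : ∀ i < R.rows, (M.board i c).flat = tileAt R.tiles i c := fun i hi =>
    Occurs.flat_eq h hi hc
  refine ⟨fun H i => ?_, fun H i hi => ?_⟩
  · by_cases hi : i < R.rows
    · rw [← hf, key i hi]; exact H i hi
    · rw [(h.2 rfl).2.2 _ _ (by omega), h0]
  · rw [← key i hi, hf]; exact H i

theorem Tile.flat_nonblank (t : Tile) : t.flat.nonblank = t.nonblank := by cases t <;> rfl
theorem Tile.flat_isVertical (t : Tile) : t.flat.isVertical = t.isVertical := by cases t <;> rfl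
theorem Tile.flat_isHorizontal (t : Tile) : t.flat.isHorizontal = t.isHorizontal := by
  cases t <;> rfl

theorem Occurs.blankRow_iff (h : planarSystem.Occurs true R 0 0 M.board) {r : ℕ}
    (hr : r < R.rows) :
    R.rowAll (fun t => !t.nonblank) r = true ↔ ∀ j, M.board r j = T0 := by
  rw [Occurs.rowAll_iff h (fun t => by rw [Tile.flat_nonblank]) rfl hr]
  simp [← Bool.not_eq_true, Tile.nonblank_iff]

theorem Occurs.blankCol_iff (h : planarSystem.Occurs true R 0 0 M.board) {c : ℕ}
    (hc : c < R.cols) :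
    R.colAll (fun t => !t.nonblank) c = true ↔ ∀ i, M.board i c = T0 := by
  rw [Occurs.colAll_iff h (fun t => by rw [Tile.flat_nonblank]) rfl hc]
  simp [← Bool.not_eq_true, Tile.nonblank_iff]

theorem Occurs.pureCheck_sound (h : planarSystem.Occurs true R 0 0 M.board)
    (hp : pureCheck R = true) :
    ∃ N : Mosaic, PlanarIsotopic M N ∧ N.tileCount < M.tileCount ∧ Fits R.rows R.cols N.board := by
  simp only [pureCheck, Bool.or_eq_true, List.any_eq_true, List.mem_range, Bool.and_eq_true,
    Bool.not_eq_true', ← Bool.not_eq_true] at hp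
  rcases hp with ⟨r, hr, h1, h2⟩ | ⟨c, hc, h1, h2⟩
  · rw [Occurs.rowAll_iff h Tile.flat_isVertical rfl hr] at h1
    rw [Bool.not_eq_true, ← Bool.not_eq_true, Occurs.blankRow_iff h hr, not_forall] at h2
    obtain ⟨N, hN, hMN, -, hlt⟩ := M.exists_deleteRow
      (fun j => Tile.isVertical_iff.1 (h1 j) : PureRow r M.board)
    exact ⟨N, hMN, hlt h2, hN ▸ ((h.2 rfl).2.2.deleteRow hr).mono (by omega) le_rfl⟩
  · rw [Occurs.colAll_iff h Tile.flat_isHorizontal rfl hc] at h1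
    rw [Bool.not_eq_true, ← Bool.not_eq_true, Occurs.blankCol_iff h hc, not_forall] at h2
    obtain ⟨N, hN, hMN, -, hlt⟩ := M.exists_deleteCol
      (fun j => Tile.isHorizontal_iff.1 (h1 j) : PureCol c M.board)
    exact ⟨N, hMN, hlt h2, hN ▸ ((h.2 rfl).2.2.deleteCol hc).mono le_rfl (by omega)⟩

theorem Mosaic.exists_blankRow (M : Mosaic) {n m r : ℕ} (hf : Fits n m M.board) (hr : r < n)
    (h : ∀ j, M.board r j = T0) : ∃ N : Mosaic, PlanarIsotopic M N ∧ N.tileCount ≤ M.tileCount ∧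
      Fits (n - 1) m N.board ∧ ∀ c, (∀ i, M.board i c = T0) → ∀ i, N.board i c = T0 := by
  obtain ⟨N, hN, hMN, hle, -⟩ := M.exists_deleteRow (fun j => Or.inl (h j) : PureRow r M.board)
  refine ⟨N, hMN, hle, hN ▸ hf.deleteRow hr, fun c hc i => ?_⟩
  rw [hN, deleteRow]
  split_ifs <;> exact hc _

theorem Mosaic.exists_blankCol (M : Mosaic) {n m c : ℕ} (hf : Fits n m M.board) (hc : c < m)
    (h : ∀ i, M.board i c = T0) : ∃ N : Mosaic, PlanarIsotopic M N ∧ N.tileCount ≤ M.tileCount ∧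
      Fits n (m - 1) N.board := by
  obtain ⟨N, hN, hMN, hle, -⟩ := M.exists_deleteCol (fun j => Or.inl (h j) : PureCol c M.board)
  exact ⟨N, hMN, hle, hN ▸ hf.deleteCol hc⟩

theorem Occurs.shrinkCheck_sound (h : planarSystem.Occurs true R 0 0 M.board)
    (hrows : 0 < R.rows) (hcols : 0 < R.cols) (hs : shrinkCheck R = true) :
    ∃ N : Mosaic, PlanarIsotopic M N ∧ N.tileCount ≤ M.tileCount ∧
      Fits (R.rows - 1) (R.cols - 1) N.board := by
  simp only [shrinkCheck, Bool.or_eq_true, Bool.and_eq_true] at hs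
  obtain ⟨r, hr, hr'⟩ : ∃ r < R.rows, ∀ j, M.board r j = T0 := by
    rcases hs.1 with h1 | h1
    · exact ⟨_, by omega, (Occurs.blankRow_iff h (by omega)).1 h1⟩
    · exact ⟨_, hrows, (Occurs.blankRow_iff h hrows).1 h1⟩
  obtain ⟨c, hc, hc'⟩ : ∃ c < R.cols, ∀ i, M.board i c = T0 := by
    rcases hs.2 with h1 | h1
    · exact ⟨_, by omega, (Occurs.blankCol_iff h (by omega)).1 h1⟩
    · exact ⟨_, hcols, (Occurs.blankCol_iff h hcols).1 h1⟩
  obtain ⟨N, hMN, hle, hf, hb⟩ := M.exists_blankRow (h.2 rfl).2.2 hr hr'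
  obtain ⟨P, hNP, hle', hf'⟩ := N.exists_blankCol hf hc (hb c hc')
  exact ⟨P, hMN.trans hNP, hle'.trans hle, hf'⟩

/-- A board with a bad window without a loop can be simplified. -/
theorem Mosaic.planarBadWindow_cases (M : Mosaic) {r c : ℕ}
    (h : Window planarBadWindow M.board r c) :
    HasUnknottedUnlinkedComponent M.linkType ∨ ∃ N : Mosaic, PlanarIsotopic M N ∧
      N.tileCount < M.tileCount ∧ ∀ a b, Fits a b M.board → Fits a b N.board := by
  simp only [Window, planarBadWindow, Bool.and_eq_true, Bool.not_eq_true'] at h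
  rcases M.badWindow_cases h.1 with h1 | h1 | h1
  · exact Or.inl (M.hasUnknottedUnlinkedComponent_of_circleWindow h1)
  · rw [Window, h.2] at h1; cases h1
  · exact Or.inr h1

theorem planarBadWindow_flat (a b c d : Tile) :
    planarBadWindow a.flat b.flat c.flat d.flat = planarBadWindow a b c d := by
  simp [planarBadWindow, badWindow_flat, loopWindow_flat]

theorem Occurs.window_iff (h : planarSystem.Occurs true R 0 0 M.board)
    {f : Tile → Tile → Tile → Tile → Bool}
    (hf : ∀ a b c d, f a.flat b.flat c.flat d.flat = f a b c d) {r c : ℕ} (hr : r + 1 < R.rows)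
    (hc : c + 1 < R.cols) : Window f (tileAt R.tiles) r c ↔ Window f M.board r c := by
  have key : ∀ i < R.rows, ∀ j < R.cols, (M.board i j).flat = tileAt R.tiles i j :=
    fun i hi j hj => Occurs.flat_eq h hi hj
  rw [Window, Window, ← hf (M.board r c), key _ (by omega) _ (by omega),
    key _ (by omega) _ (by omega),
    key _ (by omega) _ (by omega), key _ (by omega) _ (by omega)]

theorem Tile.flat_tileAt (h : planarSystem.Occurs true R 0 0 M.board) {r c : ℕ} (hr : r < R.rows)
    (hc : c < R.cols) : tileAt R.tiles r c ∈ flatTiles := by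
  rw [← h.1 r hr c hc]; exact Tile.flat_mem _

theorem Occurs.moveCheck_sound (h : planarSystem.Occurs true R 0 0 M.board)
    (hm : moveCheck R = true) :
    HasUnknottedUnlinkedComponent M.linkType ∨
    ∃ N : Mosaic, PlanarIsotopic M N ∧ N.tileCount < M.tileCount ∧ Fits R.rows R.cols N.board := by
  simp only [moveCheck, List.any_eq_true, List.mem_range, Bool.or_eq_true] at hm
  obtain ⟨r, hr, c, hc, Q, hQ, hm⟩ := hm
  obtain ⟨hf, hcount⟩ := equalMoves_sound _ (Tile.flat_tileAt h (by omega) (by omega)) _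
    (Tile.flat_tileAt h (by omega) (by omega)) _ (Tile.flat_tileAt h (by omega) (by omega)) _
    (Tile.flat_tileAt h (by omega) (by omega)) Q hQ
  have hP : (block 2 M.board r c).flat = !![tileAt R.tiles r c, tileAt R.tiles r (c + 1);
      tileAt R.tiles (r + 1) c, tileAt R.tiles (r + 1) (c + 1)] := by
    have := h.block_eq (k := 2) (r := r) (c := c) (by omega) (by omega)
    rw [Nat.zero_add, Nat.zero_add] at this
    exact this.trans (Matrix.eta_fin_two _)
  obtain ⟨N, Q', rfl, hN, hMN, ht⟩ := M.exists_of_flatCheck hP hf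
  have ht' : N.tileCount = M.tileCount := by
    rw [hcount] at ht; exact Nat.add_right_cancel ht
  have hocc := h.setBlock (Q := Q') (r := r) (c := c) (by omega) (by omega)
  rw [Nat.zero_add, Nat.zero_add, ← hN] at hocc
  have hfit : Fits R.rows R.cols N.board := (hocc.2 rfl).2.2
  rw [hMN.linkType_eq, ← ht']
  suffices H : HasUnknottedUnlinkedComponent N.linkType ∨ ∃ P : Mosaic, PlanarIsotopic N P ∧
      P.tileCount < N.tileCount ∧ Fits R.rows R.cols P.board from
    H.imp id fun ⟨P, h1, h2, h3⟩ => ⟨P, hMN.trans h1, h2, h3⟩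
  rcases hm with hm | ⟨r', hr', c', hc', hm⟩
  · have := Occurs.pureCheck_sound hocc hm
    exact Or.inr this
  · have hw := (Occurs.window_iff (R := ⟨R.rows, R.cols, _⟩) hocc planarBadWindow_flat
      (by simp only; omega)
      (by simp only; omega)).1 hm
    exact (N.planarBadWindow_cases hw).imp id fun ⟨P, h1, h2, h3⟩ => ⟨P, h1, h2, h3 _ _ hfit⟩

theorem Occurs.cornerCheck_sound (h : planarSystem.Occurs true R 0 0 M.board)
    (hm : cornerCheck R = true) :
    ∃ N : Mosaic, PlanarIsotopic M N ∧ N.tileCount < M.tileCount ∧ Fits 5 5 N.board := by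
  simp only [cornerCheck, List.any_eq_true] at hm
  obtain ⟨p, -, hm⟩ := hm
  split at hm
  · next R' hR' =>
    simp only [Bool.and_eq_true, decide_eq_true_eq] at hm
    obtain ⟨N, hMN, hN⟩ := MoveSystem.run_sound h hR'
    exact ⟨N, hMN, by rw [h.tileCount_eq, hN.tileCount_eq]; exact hm.2,
      (hN.2 rfl).2.2.mono hm.1.1 hm.1.2⟩
  · cases hm

theorem layoutTile_flat (t : Tile) (i j : Fin 5) :
    layoutTile t.flat (layout i j) = layoutTile t (layout i j) := by
  have key : ∀ p : Fin 5 × Fin 5, layout p.1 p.2 ≠ some T9 ∧ layout p.1 p.2 ≠ some T10 := by decide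
  have := key (i, j)
  rcases hs : layout i j with _ | s
  · simp [layoutTile]
  · simp only [layoutTile]
    rw [Bool.eq_iff_iff, beq_iff_eq, beq_iff_eq, Tile.flat_eq_iff (by simpa [hs] using this)]

theorem layoutCheck_sound {B B' : Board} (h : layoutCheck B = true)
    (hB : ∀ i < 5, ∀ j < 5, B i j = (B' i j).flat) : FitsLayout (block 5 B' 0 0) := by
  intro i j
  simp only [layoutCheck, List.all_eq_true, List.mem_range] at h
  have h1 := h i i.2 j j.2
  have h2 : ∀ p : Fin 5 × Fin 5, entry none (entry [] layoutRows p.1) p.2 = layout p.1 p.2 := by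
    decide
  rw [h2 (i, j), hB _ i.2 _ j.2, layoutTile_flat] at h1
  simp only [block, Nat.zero_add]
  revert h1
  rcases layout i j with _ | s
  · simp [layoutTile, and_assoc]
  · simp [layoutTile]

theorem Tile.flat_reflect (t : Tile) : t.flat.reflect = t.reflect.flat := by cases t <;> rfl

/-- The possible shapes of a five by five mosaic, up to planar isotopies. -/
theorem Mosaic.five_cases (M : Mosaic) (hM : Fits 5 5 M.board) :
    (∃ N : Mosaic, PlanarIsotopic M N ∧ Fits 4 4 N.board) ∨
    (∃ N : Mosaic, PlanarIsotopic M N ∧ N.tileCount < M.tileCount ∧ Fits 5 5 N.board) ∨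
    HasUnknottedUnlinkedComponent M.linkType ∨ (∃ r c, Window loopWindow M.board r c) ∨
    HasLayout M := by
  by_cases hbad : ∃ r c, Window badWindow M.board r c
  · obtain ⟨r, c, h⟩ := hbad
    rcases M.badWindow_cases h with h | h | ⟨N, h1, h2, h3⟩
    · exact Or.inr (Or.inr (Or.inl (M.hasUnknottedUnlinkedComponent_of_circleWindow h)))
    · exact Or.inr (Or.inr (Or.inr (Or.inl ⟨r, c, h⟩)))
    · exact Or.inr (Or.inl ⟨N, h1, h2, h3 _ _ hM⟩)
  push Not at hbad
  obtain ⟨L, hL, hocc⟩ := M.leaf_of_search search_five hM hbad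
  simp only [fiveCheck, Bool.or_eq_true] at hL
  have key : ∀ i < 5, ∀ j < 5, (M.board i j).flat = tileAt L i j :=
    fun i hi j hj => Occurs.flat_eq hocc hi hj
  rcases hL with h | h | h | h | h | h
  · obtain ⟨N, h1, -, h2⟩ := Occurs.shrinkCheck_sound hocc (by simp) (by simp) h
    exact Or.inl ⟨N, h1, h2⟩
  · exact Or.inr (Or.inl (Occurs.pureCheck_sound hocc h))
  · exact Or.inr (Or.inr (Or.inr (Or.inr (Or.inl
      (layoutCheck_sound h fun i hi j hj => (key i hi j hj).symm)))))
  · refine Or.inr (Or.inr (Or.inr (Or.inr (Or.inr ?_))))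
    have := layoutCheck_sound (B' := fun i j => (M.board i (4 - j)).reflect) h fun i hi j hj => by
      rw [← key i hi _ (by omega), Tile.flat_reflect]
    convert this using 1
    funext i j
    simp only [Block.reflect, block, Nat.zero_add, Fin.val_rev]
    congr 2
    omega
  · rcases Occurs.moveCheck_sound hocc h with h | h
    · exact Or.inr (Or.inr (Or.inl h))
    · exact Or.inr (Or.inl h)
  · exact Or.inr (Or.inl (Occurs.cornerCheck_sound hocc h))

end Sound

/-! ### Counting tiles by rows and columns -/

/-- The contribution of a tile to the tile number. -/
def Tile.weight : Tile → ℕ | T0 => 0 | _ => 1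

theorem Tile.weight_eq_ite (t : Tile) : t.weight = if t ≠ T0 then 1 else 0 := by
  cases t <;> simp [Tile.weight]

theorem Tile.weight_le_of {t : Tile} (h : t.top = true ∨ t.bottom = true ∨ t.left = true ∨
    t.right = true) : t.weight = 1 := by
  cases t <;> simp_all [Tile.weight, Tile.top, Tile.bottom, Tile.left, Tile.right]

theorem Mosaic.tileCount_eq_sum (M : Mosaic) {a b : ℕ} (h : Fits a b M.board) :
    M.tileCount = ∑ i ∈ Finset.range a, ∑ j ∈ Finset.range b, (M.board i j).weight := by
  have : {p : ℕ × ℕ | M.board p.1 p.2 ≠ T0} =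
      ((Finset.range a ×ˢ Finset.range b).filter fun p => M.board p.1 p.2 ≠ T0 :
        Finset (ℕ × ℕ)) := by
    ext ⟨i, j⟩
    have := h i j
    by_cases hij : a ≤ i ∨ b ≤ j
    · have : ¬ (i < a ∧ j < b) := by omega
      simp [h i j hij, this]
    · have : i < a ∧ j < b := by omega
      simp [this]
  rw [Mosaic.tileCount, this, Set.ncard_coe_finset, Finset.card_filter, Finset.sum_product]
  simp only [Tile.weight_eq_ite]

theorem FitsLayout.eq_zero_iff {B : Board} (h : FitsLayout (block 5 B 0 0)) (i j : Fin 5) :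
    B i j = T0 ↔ layout i j = some T0 := by
  have := h i j
  rcases hs : layout i j with _ | s
  · rw [hs] at this
    simp only [block, Nat.zero_add] at this
    refine ⟨fun h0 => ?_, fun h => by cases h⟩
    rw [h0] at this
    exact absurd this.1 (by decide)
  · rw [hs] at this
    simp only [block, Nat.zero_add] at this
    rw [this, Option.some.injEq]

theorem sum_layout {B : Board} (h : FitsLayout (block 5 B 0 0)) :
    ∑ i ∈ Finset.range 5, ∑ j ∈ Finset.range 5, (B i j).weight = 17 := by
  simp only [Finset.sum_range, Tile.weight_eq_ite, ne_eq, h.eq_zero_iff]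
  decide

theorem Mosaic.tileCount_of_hasLayout (M : Mosaic) (hM : Fits 5 5 M.board) (h : HasLayout M) :
    M.tileCount = 17 := by
  rw [M.tileCount_eq_sum hM]
  rcases h with h | h
  · exact sum_layout h
  · let B : Board := fun i j => (M.board i (4 - j)).reflect
    have hB : FitsLayout (block 5 B 0 0) := by
      convert h using 1
      funext i j
      simp only [B, Block.reflect, block, Nat.zero_add, Fin.val_rev]
      congr 2
      omega
    rw [← sum_layout hB]
    refine Finset.sum_congr rfl fun i _ => ?_
    rw [← Finset.sum_range_reflect]
    refine Finset.sum_congr rfl fun j _ => ?_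
    simp only [B]
    have hr : ∀ t : Tile, t.reflect.weight = t.weight := by intro t; cases t <;> rfl
    rw [hr]

/-! ### The outermost two rows -/

/-- A strand of the second row that could be pushed into the first row. -/
def cornerWindow (a b c d : Tile) : Bool :=
  match a, b, c, d with
  | T0, T2, T5, T4 | T0, T2, T2, T4 | T1, T0, T3, T5 | T1, T0, T3, T1 => true
  | _, _, _, _ => false

/-- The state of a scan of the first two rows, from left to right, as long as fewer than four
connection points have been found on the lower side of the second row: the current tiles of both
rows, the number of connection points found so far, whether the first row contains a non-blank tile,
and whether the second row contains a tile that is neither blank nor a vertical segment. -/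
abbrev ScanState := Tile × Tile × ℕ × Bool × Bool

/-- The states that can occur. -/
def scanStates : List ScanState :=
  let f := false; let t := true
  [(T0, T0, 0, f, f), (T0, T0, 2, f, t), (T0, T0, 2, t, f), (T0, T1, 2, f, t), (T0, T2, 1, f, t),
   (T0, T2, 3, f, t), (T0, T2, 3, t, t), (T0, T5, 1, f, t), (T0, T5, 3, f, t), (T0, T5, 3, t, t),
   (T1, T3, 1, t, t), (T1, T3, 3, t, t), (T1, T6, 2, t, f), (T1, T7, 3, t, t), (T1, T9, 3, t, t),
   (T2, T3, 0, t, t), (T2, T3, 2, t, t), (T2, T4, 3, t, t), (T2, T6, 1, t, f), (T2, T6, 3, t, f),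
   (T2, T6, 3, t, t), (T2, T7, 2, t, t), (T2, T8, 2, t, t), (T2, T9, 2, t, t), (T5, T0, 1, t, f),
   (T5, T0, 3, t, f), (T5, T0, 3, t, t), (T5, T1, 3, t, t), (T5, T2, 2, t, t), (T5, T5, 2, t, t)]

/-- The next state of a scan, if the next tiles in the two rows are `u` and `v`. -/
def ScanState.next (s : ScanState) (u v : Tile) : ScanState :=
  (u, v, s.2.2.1 + (if v.bottom then 1 else 0), s.2.2.2.1 || u.nonblank,
    s.2.2.2.2 || !v.isVertical)

/-- The tiles of the window fit together and admit no simplification; no strand of the second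
row can be pushed into the first row. -/
def scanWindow (a b c d : Tile) : Bool :=
  joinedWindow a b c d && !badWindow a b c d && !cornerWindow a b c d && !b.top

/-- `scanStates` is closed under the steps of a scan, until four connection points are found. -/
theorem scanStates_next : ∀ s ∈ scanStates, ∀ u ∈ flatTiles, ∀ v ∈ flatTiles,
    scanWindow s.1 u s.2.1 v = true → 4 ≤ (s.next u v).2.2.1 ∨ s.next u v ∈ scanStates := by
  decide +kernel

/-- The state of the scan of two rows up to column `j`. -/
def scan (u v : ℕ → Tile) : ℕ → ScanState
  | 0 => (T0, T0, 0, false, false)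
  | j + 1 => (scan u v j).next (u (j + 1)) (v (j + 1))

theorem scan_fst {u v : ℕ → Tile} (hu : u 0 = T0) (j : ℕ) : (scan u v j).1 = u j := by
  cases j
  · exact hu.symm
  · rfl

theorem scan_snd {u v : ℕ → Tile} (hv : v 0 = T0) (j : ℕ) : (scan u v j).2.1 = v j := by
  cases j
  · exact hv.symm
  · rfl

theorem scan_count {u v : ℕ → Tile} (j : ℕ) : (scan u v j).2.2.1 =
    ∑ i ∈ Finset.range j, if (v (i + 1)).bottom then 1 else 0 := by
  induction j with
  | zero => rfl
  | succ j ih => rw [Finset.sum_range_succ, ← ih]; rfl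

theorem scan_mem {u v : ℕ → Tile} (hu0 : u 0 = T0) (hv0 : v 0 = T0) (hu : ∀ j, u j ∈ flatTiles)
    (hv : ∀ j, v j ∈ flatTiles) (h : ∀ j, scanWindow (u j) (u (j + 1)) (v j) (v (j + 1)) = true)
    (j : ℕ) : 4 ≤ (scan u v j).2.2.1 ∨ scan u v j ∈ scanStates := by
  induction j with
  | zero => exact Or.inr (show ((T0, T0, 0, false, false) : ScanState) ∈ scanStates by decide)
  | succ j ih =>
    rcases ih with ih | ih
    · left
      exact ih.trans (Nat.le_add_right _ _)
    · refine scanStates_next _ ih _ (hu (j + 1)) _ (hv (j + 1)) ?_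
      rw [scan_fst hu0, scan_snd hv0]
      exact h j

/-- The scan up to column `j` has registered the tiles in all columns `i ≤ j`. -/
theorem scan_visited {u v : ℕ → Tile} {i j : ℕ} (hi : 0 < i) (hij : i ≤ j) :
    ((u i).nonblank = true → (scan u v j).2.2.2.1 = true) ∧
      ((v i).isVertical = false → (scan u v j).2.2.2.2 = true) := by
  induction j with
  | zero => omega
  | succ j ih =>
    rcases Nat.lt_or_eq_of_le hij with h | rfl
    · exact ⟨fun hu => Bool.or_eq_true_iff.2 (Or.inl ((ih (by omega)).1 hu)),
        fun hv => Bool.or_eq_true_iff.2 (Or.inl ((ih (by omega)).2 hv))⟩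
    · exact ⟨fun hu => Bool.or_eq_true_iff.2 (Or.inr hu),
        fun hv => Bool.or_eq_true_iff.2 (Or.inr (by rw [hv]; rfl))⟩

/-- Two adjacent rows at the upper edge that admit no simplification have at least four connection
points on their common lower side. -/
theorem four_le_bottom {u v : ℕ → Tile} {m : ℕ} (hu0 : u 0 = T0) (hv0 : v 0 = T0)
    (hu : ∀ j, u j ∈ flatTiles) (hv : ∀ j, v j ∈ flatTiles)
    (h : ∀ j, scanWindow (u j) (u (j + 1)) (v j) (v (j + 1)) = true)
    (hum : u (m + 1) = T0) (hvm : v (m + 1) = T0) (hu1 : ∃ j, 0 < j ∧ j ≤ m ∧ u j ≠ T0)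
    (hv1 : ∃ j, 0 < j ∧ j ≤ m ∧ ¬ (v j = T0 ∨ v j = T6)) :
    4 ≤ ∑ j ∈ Finset.range m, if (v (j + 1)).bottom then 1 else 0 := by
  have hend : ∀ s ∈ scanStates, s.1 = T0 → s.2.1 = T0 → s.2.2.2.1 = true →
      s.2.2.2.2 = false := by decide
  have hcount : (scan u v (m + 1)).2.2.1 =
      ∑ j ∈ Finset.range m, if (v (j + 1)).bottom then 1 else 0 := by
    rw [scan_count, Finset.sum_range_succ, hvm]; rfl
  rw [← hcount]
  refine (scan_mem hu0 hv0 hu hv h (m + 1)).resolve_right fun hs => ?_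
  obtain ⟨i, hi, him, hui⟩ := hu1
  obtain ⟨j, hj, hjm, hvj⟩ := hv1
  have h1 := (scan_visited (u := u) (v := v) hi (show i ≤ m + 1 by omega)).1
    (Tile.nonblank_iff.2 hui)
  have h2 := (scan_visited (u := u) (v := v) hj (show j ≤ m + 1 by omega)).2
    (by rwa [← Tile.isVertical_iff, Bool.not_eq_true] at hvj)
  rw [hend _ hs ((scan_fst hu0 _).trans hum) ((scan_snd hv0 _).trans hvm) h1] at h2
  cases h2

/-! ### Lower bound for the tile number of large mosaics -/

/-- The tile reflected in its horizontal axis. -/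
def Tile.flip : Tile → Tile
  | T1 => T4 | T4 => T1 | T2 => T3 | T3 => T2 | T7 => T8 | T8 => T7 | t => t

/-- The tile reflected in its diagonal from the top left to the bottom right. Both crossings are
fixed, although the reflection exchanges them; it is applied only to tiles without over/under
information. -/
def Tile.transpose : Tile → Tile
  | T1 => T3 | T3 => T1 | T5 => T6 | T6 => T5 | t => t

/-- Bad windows are preserved by the reflection in the horizontal axis. -/
theorem badWindow_flip : ∀ a ∈ flatTiles, ∀ b ∈ flatTiles, ∀ c ∈ flatTiles, ∀ d ∈ flatTiles,
    joinedWindow a b c d = true →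
      badWindow c.flip d.flip a.flip b.flip = badWindow a b c d := by decide +kernel

/-- Bad windows are preserved by the reflection in the diagonal. -/
theorem badWindow_transpose : ∀ a ∈ flatTiles, ∀ b ∈ flatTiles, ∀ c ∈ flatTiles, ∀ d ∈ flatTiles,
    badWindow a.transpose c.transpose b.transpose d.transpose = badWindow a b c d := by
  decide +kernel

/-- The board reflected in its horizontal axis, apart from row `0`. -/
def flipBoard (n : ℕ) (F : Board) : Board := fun i j => (F (n + 1 - i) j).flip

/-- The transposed board. -/
def transposeBoard (F : Board) : Board := fun i j => (F j i).transpose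

namespace Framed

variable {n m : ℕ} {F : Board}

theorem flip (hF : Framed n m F) : Framed n m (flipBoard n F) := by
  have hz : ∀ i j, n < i → F (n + 1 - i) j = T0 := fun i j h => by
    rw [show n + 1 - i = 0 by omega, hF.row_zero]
  refine ⟨fun i j => ?_, fun j => ?_, fun i => ?_, fun i j => ?_, fun i j => ?_,
    fun i j h => ?_, fun i j => ?_⟩
  · have := hF.flat (n + 1 - i) j
    rw [flipBoard]; revert this; generalize F (n + 1 - i) j = t; cases t <;> decide
  · rw [flipBoard, Nat.sub_zero, hF.outside _ _ (by omega)]; rfl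
  · rw [flipBoard, hF.col_zero]; rfl
  · have h1 : ∀ t : Tile, t.flip.right = t.right := by intro t; cases t <;> rfl
    have h2 : ∀ t : Tile, t.flip.left = t.left := by intro t; cases t <;> rfl
    rw [flipBoard, flipBoard, h1, h2, hF.right]
  · have h1 : ∀ t : Tile, t.flip.bottom = t.top := by intro t; cases t <;> rfl
    have h2 : ∀ t : Tile, t.flip.top = t.bottom := by intro t; cases t <;> rfl
    rw [flipBoard, flipBoard, h1, h2]
    by_cases h : n < i
    · rw [hz _ _ h, hz _ _ (by omega)]; rfl
    · rw [hF.bottom, show n + 1 - (i + 1) + 1 = n + 1 - i by omega]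
  · rw [flipBoard]
    rcases h with h | h
    · rw [hz _ _ h]; rfl
    · rw [hF.outside _ _ (Or.inr h)]; rfl
  · simp only [flipBoard]
    by_cases h : n < i
    · rw [hz _ _ h, hz _ _ h, hz _ _ (by omega), hz _ _ (by omega)]; rfl
    · rw [show n + 1 - i = n + 1 - (i + 1) + 1 by omega,
        badWindow_flip _ (hF.flat _ _) _ (hF.flat _ _) _ (hF.flat _ _) _ (hF.flat _ _)
          (by simp [joinedWindow, hF.right, hF.bottom])]
      exact hF.bad _ _

theorem transpose (hF : Framed n m F) : Framed m n (transposeBoard F) := by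
  refine ⟨fun i j => ?_, fun j => ?_, fun i => ?_, fun i j => ?_, fun i j => ?_,
    fun i j h => ?_, fun i j => ?_⟩
  · have := hF.flat j i
    rw [transposeBoard]; revert this; generalize F j i = t; cases t <;> decide
  · rw [transposeBoard, hF.col_zero]; rfl
  · rw [transposeBoard, hF.row_zero]; rfl
  · have h1 : ∀ t : Tile, t.transpose.right = t.bottom := by intro t; cases t <;> rfl
    have h2 : ∀ t : Tile, t.transpose.left = t.top := by intro t; cases t <;> rfl
    rw [transposeBoard, transposeBoard, h1, h2, hF.bottom]
  · have h1 : ∀ t : Tile, t.transpose.bottom = t.right := by intro t; cases t <;> rfl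
    have h2 : ∀ t : Tile, t.transpose.top = t.left := by intro t; cases t <;> rfl
    rw [transposeBoard, transposeBoard, h1, h2, hF.right]
  · rw [transposeBoard, hF.outside _ _ h.symm]; rfl
  · simp only [transposeBoard]
    rw [badWindow_transpose _ (hF.flat _ _) _ (hF.flat _ _) _ (hF.flat _ _) _ (hF.flat _ _)]
    exact hF.bad _ _

/-- The second row of a board without simplifications has at least four connection points on its
lower side. -/
theorem four_le_bottom (hF : Framed n m F)
    (hcorner : ∀ j, cornerWindow (F 1 j) (F 1 (j + 1)) (F 2 j) (F 2 (j + 1)) = false)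
    (h1 : ∃ j, 0 < j ∧ j ≤ m ∧ ¬ (F 1 j = T0 ∨ F 1 j = T6))
    (h2 : ∃ j, 0 < j ∧ j ≤ m ∧ ¬ (F 2 j = T0 ∨ F 2 j = T6)) :
    4 ≤ ∑ j ∈ Finset.range m, if (F 2 (j + 1)).bottom then 1 else 0 := by
  refine _root_.four_le_bottom (hF.col_zero 1) (hF.col_zero 2) (hF.flat 1) (hF.flat 2)
    (fun j => ?_) (hF.outside _ _ (by omega)) (hF.outside _ _ (by omega)) ?_ h2
  · have ht : (F 1 (j + 1)).top = false := by
      rw [← hF.bottom 0, hF.row_zero]; rfl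
    simp only [scanWindow, joinedWindow, hF.right, hF.bottom, hF.bad, hcorner, ht]
    simp
  · exact h1.imp fun j h => ⟨h.1, h.2.1, fun h0 => h.2.2 (Or.inl h0)⟩

/-- A connection point between the second and the third row belongs to non-blank tiles in both. -/
theorem le_sum_weight (h : 4 ≤ ∑ j ∈ Finset.range m, if (F 2 (j + 1)).bottom then 1 else 0)
    (hF : Framed n m F) :
    4 ≤ ∑ j ∈ Finset.range m, (F 2 (j + 1)).weight ∧
      4 ≤ ∑ j ∈ Finset.range m, (F 3 (j + 1)).weight := by
  constructor
  · refine h.trans (Finset.sum_le_sum fun j _ => ?_)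
    split_ifs with hb
    · rw [Tile.weight_le_of (Or.inr (Or.inl hb))]
    · exact Nat.zero_le _
  · refine h.trans (Finset.sum_le_sum fun j _ => ?_)
    split_ifs with hb
    · rw [hF.bottom] at hb
      rw [Tile.weight_le_of (Or.inl hb)]
    · exact Nat.zero_le _

/-- A board with at least six rows that admits no simplification has at least 17 non-blank
tiles. -/
theorem seventeen_le (hF : Framed n m F) (hn : 6 ≤ n)
    (htop : ∀ j, cornerWindow (F 1 j) (F 1 (j + 1)) (F 2 j) (F 2 (j + 1)) = false)
    (hbot : ∀ j, cornerWindow (F n j).flip (F n (j + 1)).flip (F (n - 1) j).flip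
      (F (n - 1) (j + 1)).flip = false)
    (hpure : ∀ i, 0 < i → i ≤ n → ∃ j, 0 < j ∧ j ≤ m ∧ ¬ (F i j = T0 ∨ F i j = T6)) :
    17 ≤ ∑ i ∈ Finset.range n, ∑ j ∈ Finset.range m, (F (i + 1) (j + 1)).weight := by
  have hw : ∀ t : Tile, t.flip.weight = t.weight := by intro t; cases t <;> rfl
  have h05 : ∀ t : Tile, ¬ (t = T0 ∨ t = T6) → ¬ (t.flip = T0 ∨ t.flip = T6) := by
    intro t; cases t <;> decide
  obtain ⟨h2, h3⟩ := le_sum_weight (hF.four_le_bottom htop (hpure 1 (by omega) (by omega))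
    (hpure 2 (by omega) (by omega))) hF
  obtain ⟨h4, h5⟩ := le_sum_weight (hF.flip.four_le_bottom (by
      intro j
      simp only [flipBoard]
      rw [show n + 1 - 1 = n by omega, show n + 1 - 2 = n - 1 by omega]
      exact hbot j)
    ((hpure (n + 1 - 1) (by omega) (by omega)).imp fun j h => ⟨h.1, h.2.1, h05 _ h.2.2⟩)
    ((hpure (n + 1 - 2) (by omega) (by omega)).imp fun j h => ⟨h.1, h.2.1, h05 _ h.2.2⟩)) hF.flip
  simp only [flipBoard, hw] at h4 h5
  have h1 : 1 ≤ ∑ j ∈ Finset.range m, (F 1 (j + 1)).weight := by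
    obtain ⟨j, hj, hjm, hne⟩ := hpure 1 (by omega) (by omega)
    obtain ⟨j, rfl⟩ : ∃ k, j = k + 1 := ⟨j - 1, by omega⟩
    have : 1 ≤ (F 1 (j + 1)).weight := by
      rw [Tile.weight_eq_ite, if_pos fun h0 => hne (Or.inl h0)]
    refine this.trans ?_
    exact Finset.single_le_sum (f := fun j => (F 1 (j + 1)).weight) (fun _ _ => Nat.zero_le _)
      (Finset.mem_range.2 hjm)
  -- As `n` is at least six, these five rows are distinct. They contribute one tile and four times
  -- four tiles.
  let s : Finset ℕ := {0, 1, 2, n - 3, n - 2}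
  have hs : s ⊆ Finset.range n := by
    intro x hx
    simp only [s, Finset.mem_insert, Finset.mem_singleton] at hx
    rw [Finset.mem_range]; omega
  refine le_trans ?_ (Finset.sum_le_sum_of_subset (f := fun i =>
    ∑ j ∈ Finset.range m, (F (i + 1) (j + 1)).weight) hs)
  rw [Finset.sum_insert, Finset.sum_insert, Finset.sum_insert, Finset.sum_insert,
    Finset.sum_singleton]
  · rw [show n + 1 - 2 = n - 2 + 1 by omega] at h4
    rw [show n + 1 - 3 = n - 3 + 1 by omega] at h5
    simp only [Nat.zero_add, Nat.reduceAdd]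
    omega
  all_goals simp only [Finset.mem_insert, Finset.mem_singleton]; omega

end Framed

/-- The results of pushing strands into the first or last row or column. -/
def pushes : List (Block 2) :=
  let l : List (Block 2) := [!![T2, T5; T4, T0], !![T2, T5; T6, T0], !![T5, T1; T0, T3],
    !![T5, T1; T0, T6]]
  let flip (Q : Block 2) : Block 2 := fun i j => (Q i.rev j).flip
  let transpose (Q : Block 2) : Block 2 := fun i j => (Q j i).transpose
  l ++ l.map flip ++ l.map transpose ++ (l.map flip).map transpose

/-- A planar isotopy move from `P` to `Q` keeps the number of non-blank tiles, but lowers their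
number in those positions where `inner` holds. -/
def pushCheck (inner : Fin 2 → Fin 2 → Bool) (P Q : Block 2) : Bool :=
  let l : List (Fin 2 × Fin 2) := [(0, 0), (0, 1), (1, 0), (1, 1)]
  flatCheck P Q && decide (Q.count = P.count) &&
    (l.all fun p => !inner p.1 p.2 || !(Q p.1 p.2).nonblank || (P p.1 p.2).nonblank) &&
    (l.any fun p => inner p.1 p.2 && !(Q p.1 p.2).nonblank && (P p.1 p.2).nonblank)

/-- A strand next to one of the four sides of the rectangle that could be pushed towards it can be
pushed there by a planar isotopy move. -/
theorem exists_pushCheck : ∀ a ∈ flatTiles, ∀ b ∈ flatTiles, ∀ c ∈ flatTiles, ∀ d ∈ flatTiles,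
    (cornerWindow a b c d = true →
      ∃ Q ∈ pushes, pushCheck (fun i _ => i == 1) !![a, b; c, d] Q = true) ∧
    (cornerWindow c.flip d.flip a.flip b.flip = true →
      ∃ Q ∈ pushes, pushCheck (fun i _ => i == 0) !![a, b; c, d] Q = true) ∧
    (cornerWindow a.transpose c.transpose b.transpose d.transpose = true →
      ∃ Q ∈ pushes, pushCheck (fun _ j => j == 1) !![a, b; c, d] Q = true) ∧
    (cornerWindow b.transpose.flip d.transpose.flip a.transpose.flip c.transpose.flip = true →
      ∃ Q ∈ pushes, pushCheck (fun _ j => j == 0) !![a, b; c, d] Q = true) := by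
  decide +kernel

/-- The number of non-blank tiles in positions that belong to `S`. -/
noncomputable def Mosaic.countIn (M : Mosaic) (S : Set (ℕ × ℕ)) : ℕ :=
  ({p : ℕ × ℕ | M.board p.1 p.2 ≠ T0} ∩ S).ncard

/-- Pushing a strand towards the edge keeps the tile number and lowers the number of tiles off the
edge. -/
theorem Mosaic.exists_push (M : Mosaic) {r c : ℕ} {Q : Block 2} {inner : Fin 2 → Fin 2 → Bool}
    {S : Set (ℕ × ℕ)} (h : pushCheck inner (block 2 M.board r c).flat Q = true)
    (hS : ∀ i j : Fin 2, (r + (i : ℕ), c + (j : ℕ)) ∈ S ↔ inner i j = true) :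
    ∃ N : Mosaic, PlanarIsotopic M N ∧ N.tileCount = M.tileCount ∧
      (∀ a b, r + 2 ≤ a → c + 2 ≤ b → Fits a b M.board → Fits a b N.board) ∧
      N.countIn S < M.countIn S := by
  simp only [pushCheck, Bool.and_eq_true, decide_eq_true_eq] at h
  obtain ⟨⟨⟨hf, hcount⟩, hall⟩, hany⟩ := h
  obtain ⟨N, Q', hQ, hN, hMN, ht⟩ := M.exists_of_flatCheck rfl hf
  have hnb : ∀ i j, (Q i j).nonblank = (N.board (r + i) (c + j)).nonblank := fun i j => by
    rw [hN, setBlock_add, ← hQ]; exact Tile.flat_nonblank _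
  have hnb' : ∀ i j, ((block 2 M.board r c).flat i j).nonblank =
      (M.board (r + i) (c + j)).nonblank := fun i j => Tile.flat_nonblank _
  have hall' : ∀ i j : Fin 2, inner i j = true → (N.board (r + i) (c + j)).nonblank = true →
      (M.board (r + i) (c + j)).nonblank = true := by
    intro i j hi hn
    simp only [List.all_eq_true, Bool.or_eq_true, Bool.not_eq_true'] at hall
    have := hall (i, j) (by fin_cases i <;> fin_cases j <;> simp)
    rw [hnb, hnb', hi, hn] at this
    simpa using this
  refine ⟨N, hMN, by rw [hcount] at ht; exact Nat.add_right_cancel ht, fun a b ha hb hab =>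
    hN ▸ hab.setBlock Q' ha hb, Set.ncard_lt_ncard ⟨fun p hp => ⟨?_, hp.2⟩, fun hsub => ?_⟩
      (M.support_finite.inter_of_left _)⟩
  · have hp1 : N.board p.1 p.2 ≠ T0 := hp.1
    by_cases hin : r ≤ p.1 ∧ p.1 < r + 2 ∧ c ≤ p.2 ∧ p.2 < c + 2
    · obtain ⟨i, hi⟩ : ∃ i : Fin 2, p.1 = r + i := ⟨⟨p.1 - r, by omega⟩, by simp only; omega⟩
      obtain ⟨j, hj⟩ : ∃ j : Fin 2, p.2 = c + j := ⟨⟨p.2 - c, by omega⟩, by simp only; omega⟩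
      have hpS : (r + (i : ℕ), c + (j : ℕ)) ∈ S := by rw [← hi, ← hj]; exact hp.2
      rw [hi, hj] at hp1
      rw [Set.mem_ofPred_eq, hi, hj]
      exact Tile.nonblank_iff.1 (hall' i j ((hS i j).1 hpS) (Tile.nonblank_iff.2 hp1))
    · rw [hN, setBlock_of_not hin] at hp1
      exact hp1
  · simp only [List.any_eq_true, Bool.and_eq_true, Bool.not_eq_true'] at hany
    obtain ⟨⟨i, j⟩, -, ⟨h1, h2⟩, h3⟩ := hany
    rw [hnb] at h2
    rw [hnb'] at h3
    have : (r + (i : ℕ), c + (j : ℕ)) ∈ {p : ℕ × ℕ | N.board p.1 p.2 ≠ T0} ∩ S :=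
      hsub ⟨Tile.nonblank_iff.1 h3, (hS i j).2 h1⟩
    rw [Tile.nonblank_iff.2 this.1] at h2
    cases h2

/-- The positions strictly between the first and the last row or, if there are at most five rows,
strictly between the first and the last column. -/
def innerSet (a b : ℕ) : Set (ℕ × ℕ) :=
  if 6 ≤ a then {p | 0 < p.1 ∧ p.1 + 1 < a} else {p | 0 < p.2 ∧ p.2 + 1 < b}

/-- A mosaic of `K` in an `a × b` rectangle that is minimal, in lexicographic order, with respect
to the tile number, the size of the rectangle, the number of tiles off two opposite sides of the
rectangle, and the number of crossings. -/
structure IsMinimalMosaic (K : LinkType) (M : Mosaic) (a b : ℕ) : Prop where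
  linkType : M.linkType = K
  fits : Fits a b M.board
  tileCount_le : ∀ N : Mosaic, N.linkType = K → M.tileCount ≤ N.tileCount
  size_le : ∀ (N : Mosaic) (a' b' : ℕ), N.linkType = K → Fits a' b' N.board →
    N.tileCount = M.tileCount → a + b ≤ a' + b'
  inner_le : ∀ N : Mosaic, N.linkType = K → Fits a b N.board → N.tileCount = M.tileCount →
    M.countIn (innerSet a b) ≤ N.countIn (innerSet a b)
  crossing_le : ∀ N : Mosaic, N.linkType = K → (∀ i j, N.board i j = T0 ↔ M.board i j = T0) →
    M.crossingCount ≤ N.crossingCount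

theorem exists_isMinimalMosaic (M₀ : Mosaic) : ∃ M a b, IsMinimalMosaic M₀.linkType M a b := by
  let S : Set (Mosaic × ℕ × ℕ) := {x | x.1.linkType = M₀.linkType ∧ Fits x.2.1 x.2.2 x.1.board}
  let f : Mosaic × ℕ × ℕ → ℕ ×ₗ ℕ ×ₗ ℕ ×ₗ ℕ := fun x => toLex (x.1.tileCount,
    toLex (x.2.1 + x.2.2, toLex (x.1.countIn (innerSet x.2.1 x.2.2), x.1.crossingCount)))
  obtain ⟨n₀, hn₀⟩ := M₀.exists_fits
  obtain ⟨⟨M, a, b⟩, ⟨hM, hf⟩, hmin⟩ := (InvImage.wf f wellFounded_lt).has_min S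
    ⟨(M₀, n₀, n₀), rfl, hn₀⟩
  have key : ∀ (N : Mosaic) (a' b' : ℕ), N.linkType = M₀.linkType → Fits a' b' N.board →
      ¬ (N.tileCount < M.tileCount ∨ N.tileCount = M.tileCount ∧ (a' + b' < a + b ∨
        a' + b' = a + b ∧ (N.countIn (innerSet a' b') < M.countIn (innerSet a b) ∨
          N.countIn (innerSet a' b') = M.countIn (innerSet a b) ∧
            N.crossingCount < M.crossingCount))) := by
    intro N a' b' hN hf' h
    refine hmin (N, a', b') ⟨hN, hf'⟩ ?_
    simpa only [InvImage, f, Prod.Lex.toLex_lt_toLex] using h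
  refine ⟨M, a, b, hM, hf, fun N hN => ?_, fun N a' b' hN hf' ht => ?_, fun N hN hf' ht => ?_,
    fun N hN hz => ?_⟩
  · obtain ⟨n, hn⟩ := N.exists_fits
    have := key N n n hN hn
    omega
  · have := key N a' b' hN hf'
    omega
  · have := key N a b hN hf'
    omega
  · have hs : {p : ℕ × ℕ | N.board p.1 p.2 ≠ T0} = {p : ℕ × ℕ | M.board p.1 p.2 ≠ T0} := by
      ext p; exact not_congr (hz _ _)
    have h1 : N.tileCount = M.tileCount := by rw [Mosaic.tileCount, hs]; rfl
    have h2 : N.countIn (innerSet a b) = M.countIn (innerSet a b) := by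
      rw [Mosaic.countIn, hs]; rfl
    have := key N a b hN fun i j hij => (hz i j).2 (hf i j hij)
    omega

namespace IsMinimalMosaic

variable {K : LinkType} {M : Mosaic} {a b : ℕ}

theorem not_loopWindow (h : IsMinimalMosaic K M a b) (r c : ℕ) :
    ¬ Window loopWindow M.board r c := fun hw => by
  obtain ⟨N, h1, h2, h3⟩ := M.exists_of_loopWindow hw
  exact absurd (h.crossing_le N (h1.trans h.linkType) h2) (by omega)

theorem not_badWindow (h : IsMinimalMosaic K M a b) (hK : ¬ HasUnknottedUnlinkedComponent K)
    (r c : ℕ) : ¬ Window badWindow M.board r c := fun hw => by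
  rcases M.badWindow_cases hw with h1 | h1 | ⟨N, h1, h2, -⟩
  · exact hK (h.linkType ▸ M.hasUnknottedUnlinkedComponent_of_circleWindow h1)
  · exact h.not_loopWindow r c h1
  · exact absurd (h.tileCount_le N (h1.linkType_eq ▸ h.linkType)) (by omega)

theorem not_pureRow (h : IsMinimalMosaic K M a b) {r : ℕ} (hr : r < a) :
    ¬ PureRow r M.board := fun hp => by
  obtain ⟨N, hN, hMN, hle, -⟩ := M.exists_deleteRow hp
  have hNK : N.linkType = K := hMN.linkType_eq ▸ h.linkType
  have := h.size_le N (a - 1) b hNK (hN ▸ h.fits.deleteRow hr)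
    (le_antisymm hle (h.tileCount_le N hNK))
  omega

theorem not_pureCol (h : IsMinimalMosaic K M a b) {c : ℕ} (hc : c < b) :
    ¬ PureCol c M.board := fun hp => by
  obtain ⟨N, hN, hMN, hle, -⟩ := M.exists_deleteCol hp
  have hNK : N.linkType = K := hMN.linkType_eq ▸ h.linkType
  have := h.size_le N a (b - 1) hNK (hN ▸ h.fits.deleteCol hc)
    (le_antisymm hle (h.tileCount_le N hNK))
  omega

theorem not_pushCheck (h : IsMinimalMosaic K M a b) {r c : ℕ} {inner : Fin 2 → Fin 2 → Bool}
    (hr : r + 2 ≤ a) (hc : c + 2 ≤ b)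
    (hS : ∀ i j : Fin 2, (r + (i : ℕ), c + (j : ℕ)) ∈ innerSet a b ↔ inner i j = true)
    (Q : Block 2) : ¬ pushCheck inner !![(M.board r c).flat, (M.board r (c + 1)).flat;
      (M.board (r + 1) c).flat, (M.board (r + 1) (c + 1)).flat] Q = true := fun hp => by
  rw [← block_two_flat] at hp
  obtain ⟨N, h1, h2, h3, h4⟩ := M.exists_push hp hS
  exact absurd (h.inner_le N (h1.linkType_eq ▸ h.linkType) (h3 _ _ hr hc h.fits) h2) (by omega)

end IsMinimalMosaic

theorem cornerWindow_cases {a b c d : Tile} (h : cornerWindow a b c d = true) :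
    b ≠ T0 ∨ d ≠ T0 := by
  unfold cornerWindow at h
  split at h <;> first | decide | cases h

theorem cornerWindow_zero (b d : Tile) : cornerWindow T0 b T0 d = false := by
  cases b <;> cases d <;> rfl

namespace IsMinimalMosaic

variable {K : LinkType} {M : Mosaic} {a b : ℕ}

/-- The board of a minimal mosaic with a blank row and a blank column added. -/
abbrev frame (M : Mosaic) : Board :=
  fun i j => if i = 0 ∨ j = 0 then T0 else (M.board (i - 1) (j - 1)).flat

theorem frame_succ (i j : ℕ) : frame M (i + 1) (j + 1) = (M.board i j).flat := by simp [frame]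

theorem framed (h : IsMinimalMosaic K M a b) (hK : ¬ HasUnknottedUnlinkedComponent K) :
    Framed a b (frame M) := M.connected.framed h.fits (h.not_badWindow hK)

theorem tileCount_eq_frame (h : IsMinimalMosaic K M a b) : M.tileCount =
    ∑ i ∈ Finset.range a, ∑ j ∈ Finset.range b, (frame M (i + 1) (j + 1)).weight := by
  have hw : ∀ t : Tile, t.flat.weight = t.weight := by intro t; cases t <;> rfl
  simp only [M.tileCount_eq_sum h.fits, frame_succ, hw]

theorem lt_of_ne (h : IsMinimalMosaic K M a b) {i j : ℕ} (hne : (M.board i j).flat ≠ T0) :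
    i < a ∧ j < b := by
  by_contra hij
  exact hne (Tile.flat_eq_zero.2 (h.fits i j (by omega)))

theorem seventeen_le_of_rows (h : IsMinimalMosaic K M a b)
    (hK : ¬ HasUnknottedUnlinkedComponent K) (ha : 6 ≤ a) : 17 ≤ M.tileCount := by
  have hF := h.framed hK
  rw [h.tileCount_eq_frame]
  refine hF.seventeen_le ha (fun j => ?_) (fun j => ?_) fun i hi hia => ?_
  · obtain _ | j := j
    · rw [hF.col_zero, hF.col_zero, cornerWindow_zero]
    · rw [← Bool.not_eq_true, frame_succ 0, frame_succ 0, frame_succ 1, frame_succ 1]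
      intro hc
      have hj : j + 1 < b := (cornerWindow_cases hc).elim (fun h' => (h.lt_of_ne h').2)
        fun h' => (h.lt_of_ne h').2
      obtain ⟨Q, -, hQ⟩ := (exists_pushCheck _ (Tile.flat_mem _) _ (Tile.flat_mem _) _
        (Tile.flat_mem _) _ (Tile.flat_mem _)).1 hc
      refine h.not_pushCheck (r := 0) (c := j) (by omega) (by omega) (fun i j => ?_) Q hQ
      rw [innerSet, if_pos ha]
      fin_cases i <;> simp <;> omega
  · obtain _ | j := j
    · rw [hF.col_zero, hF.col_zero]; exact cornerWindow_zero _ _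
    · obtain ⟨r, rfl⟩ : ∃ r, a = r + 2 := ⟨a - 2, by omega⟩
      rw [← Bool.not_eq_true, show r + 2 - 1 = r + 1 by omega, frame_succ, frame_succ, frame_succ,
        frame_succ]
      intro hc
      have hff : ∀ t : Tile, t.flip ≠ T0 → t ≠ T0 := by intro t; cases t <;> decide
      have hj : j + 1 < b := (cornerWindow_cases hc).elim (fun h' => (h.lt_of_ne (hff _ h')).2)
        fun h' => (h.lt_of_ne (hff _ h')).2
      obtain ⟨Q, -, hQ⟩ := (exists_pushCheck _ (Tile.flat_mem _) _ (Tile.flat_mem _) _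
        (Tile.flat_mem _) _ (Tile.flat_mem _)).2.1 hc
      refine h.not_pushCheck (r := r) (c := j) (by omega) (by omega) (fun i j => ?_) Q hQ
      rw [innerSet, if_pos ha]
      fin_cases i <;> simp
      omega
  · obtain ⟨r, rfl⟩ : ∃ r, i = r + 1 := ⟨i - 1, by omega⟩
    have := h.not_pureRow (show r < a by omega)
    simp only [PureRow, not_forall] at this
    obtain ⟨j, hj⟩ := this
    have hjb : j < b := by
      by_contra hjb
      exact hj (Or.inl (h.fits _ _ (by omega)))
    refine ⟨j + 1, by omega, by omega, ?_⟩
    rwa [frame_succ, Tile.flat_eq_zero, Tile.flat_eq_iff (by decide)]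

theorem seventeen_le_of_cols (h : IsMinimalMosaic K M a b)
    (hK : ¬ HasUnknottedUnlinkedComponent K) (ha : ¬ 6 ≤ a) (hb : 6 ≤ b) : 17 ≤ M.tileCount := by
  have hF := (h.framed hK).transpose
  have hw : ∀ t : Tile, t.transpose.weight = t.weight := by intro t; cases t <;> rfl
  have hT : ∀ i j, transposeBoard (frame M) (i + 1) (j + 1) = (M.board j i).flat.transpose :=
    fun i j => by rw [transposeBoard, frame_succ]
  have hcount : M.tileCount = ∑ i ∈ Finset.range b, ∑ j ∈ Finset.range a,
      (transposeBoard (frame M) (i + 1) (j + 1)).weight := by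
    rw [h.tileCount_eq_frame, Finset.sum_comm]
    simp only [transposeBoard, hw]
  rw [hcount]
  have htt : ∀ t : Tile, t.transpose ≠ T0 → t ≠ T0 := by intro t; cases t <;> decide
  refine hF.seventeen_le hb (fun j => ?_) (fun j => ?_) fun i hi hia => ?_
  · obtain _ | j := j
    · rw [hF.col_zero, hF.col_zero, cornerWindow_zero]
    · rw [← Bool.not_eq_true, hT 0, hT 0, hT 1, hT 1]
      intro hc
      have hj : j + 1 < a := (cornerWindow_cases hc).elim (fun h' => (h.lt_of_ne (htt _ h')).1)
        fun h' => (h.lt_of_ne (htt _ h')).1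
      obtain ⟨Q, -, hQ⟩ := (exists_pushCheck _ (Tile.flat_mem _) _ (Tile.flat_mem _) _
        (Tile.flat_mem _) _ (Tile.flat_mem _)).2.2.1 hc
      refine h.not_pushCheck (r := j) (c := 0) (by omega) (by omega) (fun i j => ?_) Q hQ
      rw [innerSet, if_neg ha]
      fin_cases j <;> simp <;> omega
  · obtain _ | j := j
    · rw [hF.col_zero, hF.col_zero]; exact cornerWindow_zero _ _
    · obtain ⟨c, rfl⟩ : ∃ c, b = c + 2 := ⟨b - 2, by omega⟩
      rw [← Bool.not_eq_true, show c + 2 - 1 = c + 1 by omega, hT, hT, hT, hT]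
      intro hc
      have hff : ∀ t : Tile, t.flip ≠ T0 → t ≠ T0 := by intro t; cases t <;> decide
      have hj : j + 1 < a := (cornerWindow_cases hc).elim
        (fun h' => (h.lt_of_ne (htt _ (hff _ h'))).1) fun h' => (h.lt_of_ne (htt _ (hff _ h'))).1
      obtain ⟨Q, -, hQ⟩ := (exists_pushCheck _ (Tile.flat_mem _) _ (Tile.flat_mem _) _
        (Tile.flat_mem _) _ (Tile.flat_mem _)).2.2.2 hc
      refine h.not_pushCheck (r := j) (c := c) (by omega) (by omega) (fun i j => ?_) Q hQ
      rw [innerSet, if_neg ha]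
      fin_cases j <;> simp
      omega
  · obtain ⟨c, rfl⟩ : ∃ c, i = c + 1 := ⟨i - 1, by omega⟩
    have := h.not_pureCol (show c < b by omega)
    simp only [PureCol, not_forall] at this
    obtain ⟨j, hj⟩ := this
    have hja : j < a := by
      by_contra hja
      exact hj (Or.inl (h.fits _ _ (by omega)))
    refine ⟨j + 1, by omega, by omega, ?_⟩
    have h06 : ∀ t : Tile, t.transpose = T0 ∨ t.transpose = T6 → t = T0 ∨ t = T5 := by
      intro t; cases t <;> decide
    rw [hT]
    intro h0
    have := h06 _ h0
    rw [Tile.flat_eq_zero, Tile.flat_eq_iff (by decide)] at this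
    exact hj this

end IsMinimalMosaic

/-! ### Mosaic number five -/

theorem mosaicNumber_le {K : LinkType} {n : ℕ} {M : Mosaic} (hM : Fits n n M.board)
    (hK : M.linkType = K) : mosaicNumber K ≤ n :=
  Nat.sInf_le ⟨M, isKnotMosaic_iff.2 ⟨M.connected, hM⟩, hK⟩

/-- A five by five mosaic of a link with mosaic number five that is not reducible by planar
isotopies and has no loop has the layout. -/
theorem Mosaic.hasLayout {K : LinkType} (hK : mosaicNumber K = 5)
    (hc : ¬ HasUnknottedUnlinkedComponent K) {M : Mosaic} (hM : M.linkType = K)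
    (hf : Fits 5 5 M.board) (hloop : ∀ r c, ¬ Window loopWindow M.board r c)
    (hmin : ∀ N : Mosaic, PlanarIsotopic M N → Fits 5 5 N.board → M.tileCount ≤ N.tileCount) :
    HasLayout M := by
  rcases M.five_cases hf with ⟨N, h1, h2⟩ | ⟨N, h1, h2, h3⟩ | h | ⟨r, c, h⟩ | h
  · have := mosaicNumber_le h2 (h1.linkType_eq ▸ hM)
    omega
  · exact absurd (hmin N h1 h3) (by omega)
  · exact absurd (hM ▸ h) hc
  · exact absurd h (hloop r c)
  · exact h

/-- The tile number of a link with mosaic number five is at least 17. -/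
theorem Mosaic.seventeen_le {K : LinkType} (hK : mosaicNumber K = 5)
    (hc : ¬ HasUnknottedUnlinkedComponent K) {M₀ : Mosaic} (hM₀ : M₀.linkType = K) :
    17 ≤ M₀.tileCount := by
  subst hM₀
  obtain ⟨M, a, b, h⟩ := exists_isMinimalMosaic M₀
  refine le_trans ?_ (h.tileCount_le M₀ rfl)
  by_cases ha : 6 ≤ a
  · exact h.seventeen_le_of_rows hc ha
  by_cases hb : 6 ≤ b
  · exact h.seventeen_le_of_cols hc ha hb
  have hf : Fits 5 5 M.board := h.fits.mono (by omega) (by omega)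
  refine (M.tileCount_of_hasLayout hf (Mosaic.hasLayout hK hc h.linkType hf h.not_loopWindow
    fun N hN _ => h.tileCount_le N (hN.linkType_eq ▸ h.linkType))).ge

/-- Among the five by five mosaics of a link with mosaic number five, one with the least tile number
and then the fewest crossings has no loop, hence the layout. -/
theorem Mosaic.exists_tileCount_eq {K : LinkType} (hK : mosaicNumber K = 5)
    (hc : ¬ HasUnknottedUnlinkedComponent K) :
    ∃ M : Mosaic, Fits 5 5 M.board ∧ M.linkType = K ∧ M.tileCount = 17 := by
  let S : Set Mosaic := {M | Fits 5 5 M.board ∧ M.linkType = K}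
  have hne : S.Nonempty := by
    have h5 : {n | ∃ M : Mosaic, IsKnotMosaic n M.board ∧ M.linkType = K}.Nonempty := by
      by_contra h
      rw [Set.not_nonempty_iff_eq_empty] at h
      rw [mosaicNumber, h, Nat.sInf_empty] at hK
      cases hK
    have := Nat.sInf_mem h5
    change mosaicNumber K ∈ _ at this
    rw [hK] at this
    obtain ⟨M, h1, h2⟩ := this
    exact ⟨M, (isKnotMosaic_iff.1 h1).2, h2⟩
  let f : Mosaic → ℕ ×ₗ ℕ := fun M => toLex (M.tileCount, M.crossingCount)
  obtain ⟨M, ⟨hf, hM⟩, hmin⟩ := (InvImage.wf f wellFounded_lt).has_min S hne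
  have key : ∀ N : Mosaic, Fits 5 5 N.board → N.linkType = K →
      ¬ (N.tileCount < M.tileCount ∨ N.tileCount = M.tileCount ∧
        N.crossingCount < M.crossingCount) := by
    intro N h1 h2 h
    refine hmin N ⟨h1, h2⟩ ?_
    simpa only [InvImage, f, Prod.Lex.toLex_lt_toLex] using h
  refine ⟨M, hf, hM, M.tileCount_of_hasLayout hf (Mosaic.hasLayout hK hc hM hf (fun r c hw => ?_)
    fun N hN hfN => ?_)⟩
  · obtain ⟨N, h1, h2, h3⟩ := M.exists_of_loopWindow hw
    have hs : {p : ℕ × ℕ | N.board p.1 p.2 ≠ T0} = {p : ℕ × ℕ | M.board p.1 p.2 ≠ T0} := by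
      ext p; exact not_congr (h2 _ _)
    refine key N (fun i j hij => (h2 i j).2 (hf i j hij)) (h1.trans hM) (Or.inr ⟨?_, h3⟩)
    rw [Mosaic.tileCount, hs]; rfl
  · have := key N hfN (hN.linkType_eq ▸ hM)
    omega

theorem tileNumber_eq {K : LinkType} (hK : mosaicNumber K = 5)
    (hc : ¬ HasUnknottedUnlinkedComponent K) :
    tileNumber K = 17 ∧ minimalMosaicTileNumber K = 17 := by
  obtain ⟨M, hf, hM, ht⟩ := Mosaic.exists_tileCount_eq hK hc
  have hM5 : IsKnotMosaic (mosaicNumber K) M.board := hK ▸ isKnotMosaic_iff.2 ⟨M.connected, hf⟩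
  constructor
  · refine le_antisymm (Nat.sInf_le ⟨M, hM, ht⟩) (le_csInf ⟨17, M, hM, ht⟩ ?_)
    rintro _ ⟨N, hN, rfl⟩
    exact Mosaic.seventeen_le hK hc hN
  · refine le_antisymm (Nat.sInf_le ⟨M, hM5, hM, ht⟩) (le_csInf ⟨17, M, hM5, hM, ht⟩ ?_)
    rintro _ ⟨N, -, hN, rfl⟩
    exact Mosaic.seventeen_le hK hc hN

theorem IsSpaceEfficient.hasLayout {K : LinkType} (hK : mosaicNumber K = 5)
    (hc : ¬ HasUnknottedUnlinkedComponent K) {M : Mosaic} (hM : M.linkType = K)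
    (h : IsSpaceEfficient 5 M) : HasLayout M :=
  Mosaic.hasLayout hK hc hM (isKnotMosaic_iff.1 h.1).2
    (fun _ _ hw => M.not_isReduced_of_loopWindow hw h.2.1)
    fun N hN hf => h.2.2 N (isKnotMosaic_iff.2 ⟨N.connected, hf⟩) hN

/-! ### Fox colourings -/

section Coloring

variable {R : Type*} [CommRing R]

/-- The condition on the colours of the left, right, top and bottom sides of a tile: the colour is
constant along an arc or over-strand, the over-strand at a crossing has the mean colour
of the two parts of the under-strand, and sides that are not met by the diagram have colour `0`. -/
def TileColoring : Tile → R → R → R → R → Prop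
  | T0, l, r, u, d => l = 0 ∧ r = 0 ∧ u = 0 ∧ d = 0
  | T1, l, r, u, d => l = d ∧ r = 0 ∧ u = 0
  | T2, l, r, u, d => d = r ∧ l = 0 ∧ u = 0
  | T3, l, r, u, d => r = u ∧ l = 0 ∧ d = 0
  | T4, l, r, u, d => u = l ∧ r = 0 ∧ d = 0
  | T5, l, r, u, d => l = r ∧ u = 0 ∧ d = 0
  | T6, l, r, u, d => u = d ∧ l = 0 ∧ r = 0
  | T7, l, r, u, d => l = d ∧ r = u
  | T8, l, r, u, d => u = l ∧ d = r
  | T9, l, r, u, d => l = r ∧ u + d = 2 * l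
  | T10, l, r, u, d => u = d ∧ l + r = 2 * u

instance [DecidableEq R] (t : Tile) (l r u d : R) : Decidable (TileColoring t l r u d) := by
  cases t <;> unfold TileColoring <;> infer_instance

/-- A Fox colouring of a board: `x i j` is the colour of the left side of the tile in row `i` and
column `j`, and `y i j` is the colour of its top side. -/
def IsColoring (B : Board) (x y : ℕ → ℕ → R) : Prop :=
  ∀ i j, TileColoring (B i j) (x i j) (x i (j + 1)) (y i j) (y (i + 1) j)

/-- The constant colouring with colour `1`, on the left sides of the tiles. -/
def unitX (R : Type*) [CommRing R] (B : Board) (i j : ℕ) : R := if (B i j).left then 1 else 0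

/-- The constant colouring with colour `1`, on the top sides of the tiles. -/
def unitY (R : Type*) [CommRing R] (B : Board) (i j : ℕ) : R := if (B i j).top then 1 else 0

/-- The colouring multiplied by `m` is constant with colour `k`. -/
def IsConstant (B : Board) (x y : ℕ → ℕ → R) (m k : R) : Prop :=
  ∀ i j, m * x i j = k * unitX R B i j ∧ m * y i j = k * unitY R B i j

/-- To every colouring of `B` corresponds one of `B'` that is not closer to being constant. -/
def Transfer (R : Type*) [CommRing R] (B B' : Board) : Prop :=
  ∀ x y : ℕ → ℕ → R, IsColoring B x y → ∃ x' y', IsColoring B' x' y' ∧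
    ∀ m k, IsConstant B' x' y' m k → IsConstant B x y m k

theorem Transfer.refl (B : Board) : Transfer R B B := fun x y h => ⟨x, y, h, fun _ _ => id⟩

theorem Transfer.trans {B B' B'' : Board} (h : Transfer R B B') (h' : Transfer R B' B'') :
    Transfer R B B'' := fun x y hxy => by
  obtain ⟨x', y', h1, h2⟩ := h x y hxy
  obtain ⟨x'', y'', h3, h4⟩ := h' x' y' h1
  exact ⟨x'', y'', h3, fun m k h => h2 m k (h4 m k h)⟩

/-- The colourings of a tile form a module. -/
theorem TileColoring.sub {t : Tile} {l r u d l' r' u' d' : R} (m k : R)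
    (h : TileColoring t l r u d) (h' : TileColoring t l' r' u' d') :
    TileColoring t (m * l - k * l') (m * r - k * r') (m * u - k * u') (m * d - k * d') := by
  cases t <;> simp only [TileColoring] at h h' ⊢ <;> grind

theorem TileColoring.left_eq_zero {t : Tile} {l r u d : R} (h : TileColoring t l r u d)
    (ht : t.left = false) : l = 0 := by
  cases t <;> simp_all [TileColoring, Tile.left]

theorem TileColoring.top_eq_zero {t : Tile} {l r u d : R} (h : TileColoring t l r u d)
    (ht : t.top = false) : u = 0 := by
  cases t <;> simp_all [TileColoring, Tile.top]

theorem Connected.isColoring_unit {B : Board} (hB : Connected B) :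
    IsColoring B (unitX R B) (unitY R B) := by
  intro i j
  simp only [unitX, unitY, ← hB.right, ← hB.bottom]
  cases B i j <;> simp [TileColoring, Tile.left, Tile.right, Tile.top, Tile.bottom] <;> norm_num

/-! ### Colourings of blocks -/

section Block

variable {k : ℕ}

/-- A colouring of a block. -/
def IsBlockColoring (P : Block k) (x y : ℕ → ℕ → R) : Prop :=
  ∀ i j : Fin k, TileColoring (P i j) (x i j) (x i (j + 1)) (y i j) (y (i + 1) j)

/-- Two colourings of `k × k` blocks agree on the boundary. -/
def BoundaryEq (k : ℕ) (x y x' y' : ℕ → ℕ → R) : Prop :=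
  ∀ i < k, x i 0 = x' i 0 ∧ x i k = x' i k ∧ y 0 i = y' 0 i ∧ y k i = y' k i

/-- Every colouring of `P` can be changed inside to a colouring of `Q`, and is determined by
the colours on the boundary. -/
def BlockTransfer (R : Type*) [CommRing R] (P Q : Block k) : Prop :=
  (∀ x y : ℕ → ℕ → R, IsBlockColoring P x y →
    ∃ x' y', IsBlockColoring Q x' y' ∧ BoundaryEq k x' y' x y) ∧
  ∀ x y : ℕ → ℕ → R, IsBlockColoring P x y → BoundaryEq k x y 0 0 →
    ∀ i < k, ∀ j < k, x i j = 0 ∧ y i j = 0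

/-- A change of a block that transfers colourings of the block transfers colourings of the board.
Outside of the block nothing changes. If the new colouring multiplied by `m` is constant with colour
`q`, then the difference between `m` times the old one and the constant colouring vanishes on the
boundary of the block, hence inside. -/
theorem BlockTransfer.transfer {B B' : Board} {r c : ℕ} (hB : Connected B) (hB' : Connected B')
    (h : BlockTransfer R (block k B r c) (block k B' r c))
    (hout : ∀ i j, ¬ (r ≤ i ∧ i < r + k ∧ c ≤ j ∧ j < c + k) → B' i j = B i j) :
    Transfer R B B' := by
  intro x y hxy
  have hblock : ∀ x y : ℕ → ℕ → R, IsColoring B x y →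
      IsBlockColoring (block k B r c) (fun i j => x (r + i) (c + j))
        (fun i j => y (r + i) (c + j)) := fun x y h i j => h _ _
  obtain ⟨xs, ys, hQ, hb⟩ := h.1 _ _ (hblock x y hxy)
  let x' : ℕ → ℕ → R := fun i j =>
    if r ≤ i ∧ i < r + k ∧ c < j ∧ j < c + k then xs (i - r) (j - c) else x i j
  let y' : ℕ → ℕ → R := fun i j =>
    if r < i ∧ i < r + k ∧ c ≤ j ∧ j < c + k then ys (i - r) (j - c) else y i j
  have hx' : ∀ i < k, ∀ j ≤ k, x' (r + i) (c + j) = xs i j := by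
    intro i hi j hj
    simp only [x']
    split_ifs with hin
    · simp
    · have := hb i hi
      obtain rfl | rfl : j = 0 ∨ j = k := by omega
      · exact this.1.symm
      · exact this.2.1.symm
  have hy' : ∀ i ≤ k, ∀ j < k, y' (r + i) (c + j) = ys i j := by
    intro i hi j hj
    simp only [y']
    split_ifs with hin
    · simp
    · have := hb j hj
      obtain rfl | rfl : i = 0 ∨ i = k := by omega
      · exact this.2.2.1.symm
      · exact this.2.2.2.symm
  refine ⟨x', y', fun i j => ?_, fun m q hc => ?_⟩
  · by_cases hin : r ≤ i ∧ i < r + k ∧ c ≤ j ∧ j < c + k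
    · obtain ⟨i, rfl⟩ : ∃ u : Fin k, i = r + u := ⟨⟨i - r, by omega⟩, by simp only; omega⟩
      obtain ⟨j, rfl⟩ : ∃ v : Fin k, j = c + v := ⟨⟨j - c, by omega⟩, by simp only; omega⟩
      rw [add_assoc, add_assoc, hx' _ i.2 _ j.2.le, hx' _ i.2 _ j.2, hy' _ i.2.le _ j.2,
        hy' _ i.2 _ j.2]
      exact hQ i j
    · rw [hout i j hin]
      simp only [x', y']
      rw [if_neg (by omega), if_neg (by omega), if_neg (by omega), if_neg (by omega)]
      exact hxy i j
  · have hz : IsColoring B (fun i j => m * x i j - q * unitX R B i j)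
        (fun i j => m * y i j - q * unitY R B i j) := fun i j =>
      (hxy i j).sub m q (hB.isColoring_unit i j)
    have hux : ∀ i j, ¬ (r ≤ i ∧ i < r + k ∧ c < j ∧ j < c + k) →
        m * x i j - q * unitX R B i j = 0 := by
      intro i j hin
      have h1 := (hc i j).1
      simp only [x', if_neg hin] at h1
      rw [h1, sub_eq_zero]
      congr 1
      simp only [unitX]
      by_cases hb : r ≤ i ∧ i < r + k ∧ j = c
      · obtain ⟨-, -, rfl⟩ := hb
        obtain _ | j := j
        · rw [hB.left_edge, hB'.left_edge]
        · rw [← hB.right, ← hB'.right, hout _ _ (by omega)]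
      · rw [hout _ _ (by omega)]
    have huy : ∀ i j, ¬ (r < i ∧ i < r + k ∧ c ≤ j ∧ j < c + k) →
        m * y i j - q * unitY R B i j = 0 := by
      intro i j hin
      have h1 := (hc i j).2
      simp only [y', if_neg hin] at h1
      rw [h1, sub_eq_zero]
      congr 1
      simp only [unitY]
      by_cases hb : i = r ∧ c ≤ j ∧ j < c + k
      · obtain ⟨rfl, -, -⟩ := hb
        obtain _ | i := i
        · rw [hB.top_edge, hB'.top_edge]
        · rw [← hB.bottom, ← hB'.bottom, hout _ _ (by omega)]
      · rw [hout _ _ (by omega)]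
    have hin := h.2 _ _ (hblock _ _ hz) fun i hi => ⟨hux _ _ (by omega), hux _ _ (by omega),
      huy _ _ (by omega), huy _ _ (by omega)⟩
    intro i j
    rw [← sub_eq_zero, ← sub_eq_zero (a := m * y i j)]
    constructor
    · by_cases hij : r ≤ i ∧ i < r + k ∧ c < j ∧ j < c + k
      · have := (hin (i - r) (by omega) (j - c) (by omega)).1
        rwa [show r + (i - r) = i by omega, show c + (j - c) = j by omega] at this
      · exact hux i j hij
    · by_cases hij : r < i ∧ i < r + k ∧ c ≤ j ∧ j < c + k
      · have := (hin (i - r) (by omega) (j - c) (by omega)).2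
        rwa [show r + (i - r) = i by omega, show c + (j - c) = j by omega] at this
      · exact huy i j hij

theorem TileColoring.rotate_iff {t : Tile} {l r u d : R} :
    TileColoring t.rotate l r u d ↔ TileColoring t d u l r := by
  cases t <;> simp only [TileColoring, Tile.rotate] <;> grind

theorem TileColoring.reflect_iff {t : Tile} {l r u d : R} :
    TileColoring t.reflect l r u d ↔ TileColoring t r l u d := by
  cases t <;> simp only [TileColoring, Tile.reflect] <;> grind

theorem isBlockColoring_rotate {P : Block k} {x y : ℕ → ℕ → R} :
    IsBlockColoring P.rotate x y ↔
      IsBlockColoring P (fun i j => y (k - j) i) (fun i j => x (k - 1 - j) i) := by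
  have key : ∀ i j : Fin k, TileColoring (P.rotate i j) (x i j) (x i (j + 1)) (y i j)
      (y (i + 1) j) ↔
      TileColoring (P j i.rev) (y (k - i.rev) j) (y (k - (i.rev + 1)) j)
        (x (k - 1 - i.rev) j) (x (k - 1 - i.rev) (j + 1)) := by
    intro i j
    rw [Block.rotate, TileColoring.rotate_iff, Fin.val_rev,
      show k - (k - (i + 1)) = (i : ℕ) + 1 by omega,
      show k - (k - ((i : ℕ) + 1) + 1) = i by omega, show k - 1 - (k - ((i : ℕ) + 1)) = i by omega]
  constructor
  · intro h i j
    have := (key j.rev i).1 (h _ _)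
    rwa [Fin.rev_rev] at this
  · intro h i j
    exact (key i j).2 (h j i.rev)

theorem isBlockColoring_reflect {P : Block k} {x y : ℕ → ℕ → R} :
    IsBlockColoring P.reflect x y ↔
      IsBlockColoring P (fun i j => x i (k - j)) (fun i j => y i (k - 1 - j)) := by
  have key : ∀ i j : Fin k, TileColoring (P.reflect i j) (x i j) (x i (j + 1)) (y i j)
      (y (i + 1) j) ↔
      TileColoring (P i j.rev) (x i (k - j.rev)) (x i (k - (j.rev + 1)))
        (y i (k - 1 - j.rev)) (y (i + 1) (k - 1 - j.rev)) := by
    intro i j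
    rw [Block.reflect, TileColoring.reflect_iff, Fin.val_rev,
      show k - (k - (j + 1)) = (j : ℕ) + 1 by omega,
      show k - (k - ((j : ℕ) + 1) + 1) = j by omega, show k - 1 - (k - ((j : ℕ) + 1)) = j by omega]
  constructor
  · intro h i j
    have := (key i j.rev).1 (h _ _)
    rwa [Fin.rev_rev] at this
  · intro h i j
    exact (key i j).2 (h i j.rev)

theorem BlockTransfer.rotate {P Q : Block k} (h : BlockTransfer R P Q) :
    BlockTransfer R P.rotate Q.rotate := by
  constructor
  · intro x y hxy
    rw [isBlockColoring_rotate] at hxy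
    obtain ⟨x', y', h1, h2⟩ := h.1 _ _ hxy
    refine ⟨fun i j => y' j (k - 1 - i), fun i j => x' j (k - i), ?_, fun i hi => ?_⟩
    · rw [isBlockColoring_rotate]
      intro i j
      dsimp only
      have := h1 i j
      rwa [show k - (k - (j : ℕ)) = j by omega, show k - (k - ((j : ℕ) + 1)) = j + 1 by omega,
        show k - 1 - (k - 1 - (j : ℕ)) = j by omega]
    · have h3 := h2 i hi
      have h4 := h2 (k - 1 - i) (by omega)
      dsimp only at h3 h4
      rw [show k - 1 - (k - 1 - i) = i by omega] at h4
      simp only [Nat.sub_zero, Nat.sub_self] at h3 ⊢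
      exact ⟨h4.2.2.1, h4.2.2.2, h3.2.1, h3.1⟩
  · intro x y hxy hb i hi j hj
    rw [isBlockColoring_rotate] at hxy
    have hb' : BoundaryEq k (fun i j => y (k - j) i) (fun i j => x (k - 1 - j) i) 0 0 := by
      intro i hi
      have h3 := hb i hi
      have h4 := hb (k - 1 - i) (by omega)
      dsimp only [Pi.zero_apply] at h3 h4 ⊢
      simp only [Nat.sub_zero, Nat.sub_self]
      exact ⟨h3.2.2.2, h3.2.2.1, h4.1, h4.2.1⟩
    have h5 := h.2 _ _ hxy hb'
    constructor
    · have := (h5 j hj (k - 1 - i) (by omega)).2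
      rwa [show k - 1 - (k - 1 - i) = i by omega] at this
    · obtain _ | i := i
      · exact (hb j hj).2.2.1
      · have := (h5 j hj (k - 1 - i) (by omega)).1
        rwa [show k - (k - 1 - i) = i + 1 by omega] at this

theorem BlockTransfer.reflect {P Q : Block k} (h : BlockTransfer R P Q) :
    BlockTransfer R P.reflect Q.reflect := by
  constructor
  · intro x y hxy
    rw [isBlockColoring_reflect] at hxy
    obtain ⟨x', y', h1, h2⟩ := h.1 _ _ hxy
    refine ⟨fun i j => x' i (k - j), fun i j => y' i (k - 1 - j), ?_, fun i hi => ?_⟩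
    · rw [isBlockColoring_reflect]
      intro i j
      dsimp only
      have := h1 i j
      rwa [show k - (k - (j : ℕ)) = j by omega, show k - (k - ((j : ℕ) + 1)) = j + 1 by omega,
        show k - 1 - (k - 1 - (j : ℕ)) = j by omega]
    · have h3 := h2 i hi
      have h4 := h2 (k - 1 - i) (by omega)
      dsimp only at h3 h4
      rw [show k - 1 - (k - 1 - i) = i by omega] at h4
      simp only [Nat.sub_zero, Nat.sub_self] at h3 ⊢
      exact ⟨h3.2.1, h3.1, h4.2.2.1, h4.2.2.2⟩
  · intro x y hxy hb i hi j hj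
    rw [isBlockColoring_reflect] at hxy
    have hb' : BoundaryEq k (fun i j => x i (k - j)) (fun i j => y i (k - 1 - j)) 0 0 := by
      intro i hi
      have h3 := hb i hi
      have h4 := hb (k - 1 - i) (by omega)
      dsimp only [Pi.zero_apply] at h3 h4 ⊢
      simp only [Nat.sub_zero, Nat.sub_self]
      exact ⟨h3.2.1, h3.1, h4.2.2.1, h4.2.2.2⟩
    have h5 := h.2 _ _ hxy hb'
    constructor
    · obtain _ | j := j
      · exact (hb i hi).1
      · have := (h5 i hi (k - 1 - j) (by omega)).1
        rwa [show k - (k - 1 - j) = j + 1 by omega] at this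
    · have := (h5 i hi (k - 1 - j) (by omega)).2
      rwa [show k - 1 - (k - 1 - j) = j by omega] at this

/-- Colourings of `P` and `Q`, and of the blocks with all crossings changed, correspond to each
other. -/
def BlockEquiv (R : Type*) [CommRing R] (P Q : Block k) : Prop :=
  (BlockTransfer R P Q ∧ BlockTransfer R Q P) ∧
    BlockTransfer R P.switch Q.switch ∧ BlockTransfer R Q.switch P.switch

theorem Block.rotate_switch (P : Block k) : P.rotate.switch = P.switch.rotate := by
  funext i j
  simp only [Block.rotate, Block.switch]
  cases P j i.rev <;> rfl

theorem Block.reflect_switch (P : Block k) : P.reflect.switch = P.switch.reflect := by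
  funext i j
  simp only [Block.reflect, Block.switch]
  cases P i j.rev <;> rfl

theorem BlockEquiv.of_upToSymmetry {S : Block k → Block k → Prop}
    (hS : ∀ P Q, S P Q → BlockEquiv R P Q) {P Q : Block k} (h : UpToSymmetry S P Q) :
    BlockEquiv R P Q := by
  induction h with
  | base h => exact hS _ _ h
  | rotate _ ih =>
    rw [BlockEquiv, Block.rotate_switch, Block.rotate_switch]
    exact ⟨⟨ih.1.1.rotate, ih.1.2.rotate⟩, ih.2.1.rotate, ih.2.2.rotate⟩
  | reflect _ ih =>
    rw [BlockEquiv, Block.reflect_switch, Block.reflect_switch]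
    exact ⟨⟨ih.1.1.reflect, ih.1.2.reflect⟩, ih.2.1.reflect, ih.2.2.reflect⟩
  | switch _ ih =>
    rw [BlockEquiv, Block.switch_switch, Block.switch_switch]
    exact ⟨ih.2, ih.1⟩

end Block

end Coloring

/-! ### Colourings under the local moves -/

section Coloring

variable {R : Type*} [CommRing R]

theorem isBlockColoring_two {a b c d : Tile} {x y : ℕ → ℕ → R} :
    IsBlockColoring !![a, b; c, d] x y ↔
      (TileColoring a (x 0 0) (x 0 1) (y 0 0) (y 1 0) ∧
        TileColoring b (x 0 1) (x 0 2) (y 0 1) (y 1 1)) ∧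
      TileColoring c (x 1 0) (x 1 1) (y 1 0) (y 2 0) ∧
        TileColoring d (x 1 1) (x 1 2) (y 1 1) (y 2 1) := by
  simp [IsBlockColoring, Fin.forall_fin_two]

theorem BlockTransfer.two {a b c d a' b' c' d' : Tile}
    (h : ∀ l₀ l₁ r₀ r₁ u₀ u₁ d₀ d₁ m₀ m₁ n₀ n₁ : R, TileColoring a l₀ m₀ u₀ n₀ →
      TileColoring b m₀ r₀ u₁ n₁ → TileColoring c l₁ m₁ n₀ d₀ → TileColoring d m₁ r₁ n₁ d₁ →
      (∃ m₀ m₁ n₀ n₁ : R, TileColoring a' l₀ m₀ u₀ n₀ ∧ TileColoring b' m₀ r₀ u₁ n₁ ∧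
        TileColoring c' l₁ m₁ n₀ d₀ ∧ TileColoring d' m₁ r₁ n₁ d₁) ∧
      (l₀ = 0 → l₁ = 0 → r₀ = 0 → r₁ = 0 → u₀ = 0 → u₁ = 0 → d₀ = 0 → d₁ = 0 →
        m₀ = 0 ∧ m₁ = 0 ∧ n₀ = 0 ∧ n₁ = 0)) :
    BlockTransfer R !![a, b; c, d] !![a', b'; c', d'] := by
  constructor
  · intro x y hxy
    rw [isBlockColoring_two] at hxy
    obtain ⟨m₀, m₁, n₀, n₁, h1, h2, h3, h4⟩ :=
      (h _ _ _ _ _ _ _ _ _ _ _ _ hxy.1.1 hxy.1.2 hxy.2.1 hxy.2.2).1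
    refine ⟨fun i j => if j = 1 then (if i = 0 then m₀ else m₁) else x i j,
      fun i j => if i = 1 then (if j = 0 then n₀ else n₁) else y i j, ?_, fun i hi => ?_⟩
    · rw [isBlockColoring_two]
      simpa using ⟨⟨h1, h2⟩, h3, h4⟩
    · simp
  · intro x y hxy hb
    rw [isBlockColoring_two] at hxy
    have b0 := hb 0 (by norm_num)
    have b1 := hb 1 (by norm_num)
    have := (h _ _ _ _ _ _ _ _ _ _ _ _ hxy.1.1 hxy.1.2 hxy.2.1 hxy.2.2).2 b0.1 b1.1 b0.2.1
      b1.2.1 b0.2.2.1 b1.2.2.1 b0.2.2.2 b1.2.2.2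
    intro i hi j hj
    interval_cases i <;> interval_cases j
    · exact ⟨b0.1, b0.2.2.1⟩
    · exact ⟨this.1, b1.2.2.1⟩
    · exact ⟨b1.1, this.2.2.1⟩
    · exact ⟨this.2.1, this.2.2.2⟩

set_option maxHeartbeats 4000000 in
/-- The inner sides of the new block inherit the colours of the strands on which they lie. -/
theorem PlanarMove.blockTransfer {P Q : Block 2} (h : PlanarMove P Q) :
    BlockTransfer R P Q ∧ BlockTransfer R Q P := by
  cases h with
  | push_two ha hd hb hc =>
    constructor <;> refine .two fun l₀ l₁ r₀ r₁ u₀ u₁ d₀ d₁ m₀ m₁ n₀ n₁ h1 h2 h3 h4 => ?_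
    · refine ⟨⟨0, m₀, 0, m₀, ?_⟩, ?_⟩ <;> cases ha <;> cases hd <;>
        rcases hb with ⟨rfl, rfl⟩ | ⟨rfl, rfl⟩ <;> rcases hc with ⟨rfl, rfl⟩ | ⟨rfl, rfl⟩ <;>
        simp only [TileColoring] at h1 h2 h3 h4 ⊢ <;> grind
    · refine ⟨⟨m₁, 0, m₁, 0, ?_⟩, ?_⟩ <;> cases ha <;> cases hd <;>
        rcases hb with ⟨rfl, rfl⟩ | ⟨rfl, rfl⟩ <;> rcases hc with ⟨rfl, rfl⟩ | ⟨rfl, rfl⟩ <;>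
        simp only [TileColoring] at h1 h2 h3 h4 ⊢ <;> grind
  | push_three ha hb hc hd =>
    constructor <;> refine .two fun l₀ l₁ r₀ r₁ u₀ u₁ d₀ d₁ m₀ m₁ n₀ n₁ h1 h2 h3 h4 => ?_
    · refine ⟨⟨0, m₀, m₀, m₀, ?_⟩, ?_⟩ <;> cases hc <;> cases hd <;>
        rcases ha with ⟨rfl, rfl⟩ | ⟨rfl, rfl⟩ <;> rcases hb with ⟨rfl, rfl⟩ | ⟨rfl, rfl⟩ <;>
        simp only [TileColoring] at h1 h2 h3 h4 ⊢ <;> grind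
    · refine ⟨⟨m₁, 0, 0, 0, ?_⟩, ?_⟩ <;> cases hc <;> cases hd <;>
        rcases ha with ⟨rfl, rfl⟩ | ⟨rfl, rfl⟩ <;> rcases hb with ⟨rfl, rfl⟩ | ⟨rfl, rfl⟩ <;>
        simp only [TileColoring] at h1 h2 h3 h4 ⊢ <;> grind
  | push_four hb hc hd =>
    constructor <;> refine .two fun l₀ l₁ r₀ r₁ u₀ u₁ d₀ d₁ m₀ m₁ n₀ n₁ h1 h2 h3 h4 => ?_
    · refine ⟨⟨l₀, l₀, l₀, l₀, ?_⟩, ?_⟩ <;> cases hb <;> cases hc <;> cases hd <;>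
        simp only [TileColoring] at h1 h2 h3 h4 ⊢ <;> grind
    · refine ⟨⟨0, 0, 0, 0, ?_⟩, ?_⟩ <;> cases hb <;> cases hc <;> cases hd <;>
        simp only [TileColoring] at h1 h2 h3 h4 ⊢ <;> grind
  | slide_adjacent h ha hb =>
    obtain ⟨p, ha⟩ := ha
    obtain ⟨q, hb⟩ := hb
    constructor <;> refine .two fun l₀ l₁ r₀ r₁ u₀ u₁ d₀ d₁ m₀ m₁ n₀ n₁ h1 h2 h3 h4 => ?_
    · refine ⟨⟨r₁, d₁, r₁, r₁, ?_⟩, ?_⟩ <;> cases ha <;> cases hb <;> cases h <;>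
        simp only [TileColoring, cross, Bool.not_true, Bool.not_false] at h1 h2 h3 h4 ⊢ <;> grind
    · refine ⟨⟨l₁, d₀, l₁, l₁, ?_⟩, ?_⟩ <;> cases ha <;> cases hb <;> cases h <;>
        simp only [TileColoring, cross, Bool.not_true, Bool.not_false] at h1 h2 h3 h4 ⊢ <;> grind
  | slide_diagonal h ha hd =>
    obtain ⟨p, ha⟩ := ha
    obtain ⟨q, hd⟩ := hd
    constructor <;> refine .two fun l₀ l₁ r₀ r₁ u₀ u₁ d₀ d₁ m₀ m₁ n₀ n₁ h1 h2 h3 h4 => ?_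
    · refine ⟨⟨l₁, d₀, l₁, d₀, ?_⟩, ?_⟩ <;> cases ha <;> cases hd <;> cases h <;>
        simp only [TileColoring, cross] at h1 h2 h3 h4 ⊢ <;> grind
    · refine ⟨⟨u₁, r₀, u₁, r₀, ?_⟩, ?_⟩ <;> cases ha <;> cases hd <;> cases h <;>
        simp only [TileColoring, cross] at h1 h2 h3 h4 ⊢ <;> grind

set_option maxHeartbeats 4000000 in
/-- Where a strand of colour `q` newly passes under a strand of colour `p`, the piece behind it gets
the colour `2 * p - q`. -/
theorem ReidemeisterMove₂.blockTransfer {P Q : Block 2} (h : ReidemeisterMove₂ P Q) :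
    BlockTransfer R P Q ∧ BlockTransfer R Q P := by
  cases h with
  | one h ha hb hc =>
    obtain ⟨p, ha⟩ := ha
    obtain ⟨q, hb⟩ := hb
    obtain ⟨s, hc⟩ := hc
    constructor <;> refine .two fun l₀ l₁ r₀ r₁ u₀ u₁ d₀ d₁ m₀ m₁ n₀ n₁ h1 h2 h3 h4 => ?_ <;>
      refine ⟨⟨r₁, r₁, r₁, r₁, ?_⟩, ?_⟩ <;> cases ha <;> cases hb <;> cases hc <;> cases h <;>
        simp only [TileColoring, cross] at h1 h2 h3 h4 ⊢ <;> grind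
  | two_adjacent h ha hb =>
    obtain ⟨p, ha⟩ := ha
    obtain ⟨q, hb⟩ := hb
    constructor <;> refine .two fun l₀ l₁ r₀ r₁ u₀ u₁ d₀ d₁ m₀ m₁ n₀ n₁ h1 h2 h3 h4 => ?_
    · refine ⟨?_, ?_⟩
      · cases h
        · refine ⟨d₀, 2 * d₀ - l₁, d₀, d₀, ?_⟩
          cases ha <;> cases hb <;> simp only [TileColoring, cross] at h1 h2 h3 h4 ⊢ <;> grind
        · refine ⟨2 * l₁ - d₀, l₁, 2 * l₁ - d₀, 2 * l₁ - d₀, ?_⟩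
          cases ha <;> cases hb <;> simp only [TileColoring, cross] at h1 h2 h3 h4 ⊢ <;> grind
      · cases ha <;> cases hb <;> simp only [TileColoring] at h1 h2 h3 h4 ⊢ <;> grind
    · refine ⟨⟨l₁, d₀, l₁, l₁, ?_⟩, ?_⟩ <;> cases ha <;> cases hb <;> cases h <;>
        simp only [TileColoring, cross] at h1 h2 h3 h4 ⊢ <;> grind
  | two_diagonal h ha hd =>
    obtain ⟨p, ha⟩ := ha
    obtain ⟨q, hd⟩ := hd
    constructor <;> refine .two fun l₀ l₁ r₀ r₁ u₀ u₁ d₀ d₁ m₀ m₁ n₀ n₁ h1 h2 h3 h4 => ?_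
    · refine ⟨?_, ?_⟩
      · cases h
        · refine ⟨2 * u₁ - r₀, u₁, 2 * u₁ - r₀, u₁, ?_⟩
          cases ha <;> cases hd <;>
            simp only [TileColoring, cross, Bool.not_false] at h1 h2 h3 h4 ⊢ <;> grind
        · refine ⟨r₀, 2 * r₀ - u₁, r₀, 2 * r₀ - u₁, ?_⟩
          cases ha <;> cases hd <;>
            simp only [TileColoring, cross, Bool.not_true] at h1 h2 h3 h4 ⊢ <;> grind
      · cases ha <;> cases hd <;> simp only [TileColoring] at h1 h2 h3 h4 ⊢ <;> grind
    · refine ⟨⟨u₁, r₀, u₁, r₀, ?_⟩, ?_⟩ <;> cases ha <;> cases hd <;> cases h <;>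
        simp only [TileColoring, cross, Bool.not_true, Bool.not_false] at h1 h2 h3 h4 ⊢ <;> grind

end Coloring

section Coloring

variable {R : Type*} [CommRing R]

theorem isBlockColoring_three {a b c d e f g h s : Tile} {x y : ℕ → ℕ → R} :
    IsBlockColoring !![a, b, c; d, e, f; g, h, s] x y ↔
      (TileColoring a (x 0 0) (x 0 1) (y 0 0) (y 1 0) ∧
        TileColoring b (x 0 1) (x 0 2) (y 0 1) (y 1 1) ∧
        TileColoring c (x 0 2) (x 0 3) (y 0 2) (y 1 2)) ∧
      (TileColoring d (x 1 0) (x 1 1) (y 1 0) (y 2 0) ∧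
        TileColoring e (x 1 1) (x 1 2) (y 1 1) (y 2 1) ∧
        TileColoring f (x 1 2) (x 1 3) (y 1 2) (y 2 2)) ∧
      TileColoring g (x 2 0) (x 2 1) (y 2 0) (y 3 0) ∧
        TileColoring h (x 2 1) (x 2 2) (y 2 1) (y 3 1) ∧
        TileColoring s (x 2 2) (x 2 3) (y 2 2) (y 3 2) := by
  simp [IsBlockColoring, Fin.forall_fin_succ]

theorem BlockTransfer.three {P Q : Block 3}
    (h : ∀ x y : ℕ → ℕ → R, IsBlockColoring P x y →
      (∃ a b c d e f a' b' c' d' e' f' : R, IsBlockColoring Q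
        (fun i j => if j = 1 then (if i = 0 then a else if i = 1 then b else c) else
          if j = 2 then (if i = 0 then d else if i = 1 then e else f) else x i j)
        (fun i j => if i = 1 then (if j = 0 then a' else if j = 1 then b' else c') else
          if i = 2 then (if j = 0 then d' else if j = 1 then e' else f') else y i j)) ∧
      (BoundaryEq 3 x y 0 0 → (x 0 1 = 0 ∧ x 1 1 = 0 ∧ x 2 1 = 0) ∧
        (x 0 2 = 0 ∧ x 1 2 = 0 ∧ x 2 2 = 0) ∧ (y 1 0 = 0 ∧ y 1 1 = 0 ∧ y 1 2 = 0) ∧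
        y 2 0 = 0 ∧ y 2 1 = 0 ∧ y 2 2 = 0)) :
    BlockTransfer R P Q := by
  constructor
  · intro x y hxy
    obtain ⟨a, b, c, d, e, f, a', b', c', d', e', f', h'⟩ := (h x y hxy).1
    exact ⟨_, _, h', fun i hi => by simp⟩
  · intro x y hxy hb
    have h1 := (h x y hxy).2 hb
    have b0 := hb 0 (by norm_num)
    have b1 := hb 1 (by norm_num)
    have b2 := hb 2 (by norm_num)
    simp only [Pi.zero_apply] at b0 b1 b2
    intro i hi j hj
    interval_cases i <;> interval_cases j <;> simp only [h1, b0, b1, b2, and_self]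

set_option maxHeartbeats 4000000 in
/-- The colours of the inner sides are read off from the boundary, with the colour `2 * p - q`
wherever a strand of colour `q` passes under one of colour `p`. -/
theorem ReidemeisterMove₃.blockTransfer {P Q : Block 3} (h : ReidemeisterMove₃ P Q) :
    BlockTransfer R P Q ∧ BlockTransfer R Q P := by
  obtain ⟨ab, ac, bc, h1, h2⟩ := h
  constructor <;> refine .three fun x y h => ?_ <;> rw [isBlockColoring_three] at h
  · refine ⟨?_, fun hb => ?_⟩
    · refine ⟨0, x 1 0, y 3 0, 0, if ac then x 1 3 else 2 * x 0 3 - x 1 3,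
        if ac then 2 * x 1 3 - x 0 3 else x 0 3, 0, y 0 1, x 0 3, 0,
        if bc then y 3 1 else 2 * y 3 0 - y 3 1, if ac then 2 * x 1 3 - x 0 3 else x 0 3, ?_⟩
      rw [isBlockColoring_three]
      cases ab <;> cases ac <;> cases bc <;> simp [TileColoring, cross] at h h1 h2 ⊢ <;> grind
    · have b0 := hb 0 (by norm_num)
      have b1 := hb 1 (by norm_num)
      have b2 := hb 2 (by norm_num)
      simp only [Pi.zero_apply, b0, b1, b2] at h
      cases ab <;> cases ac <;> cases bc <;> simp [TileColoring, cross] at h h1 h2 ⊢ <;> grind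
  · refine ⟨?_, fun hb => ?_⟩
    · refine ⟨if ac then 2 * x 1 0 - y 3 0 else y 3 0, if ac then x 1 0 else 2 * y 3 0 - x 1 0, 0,
        x 0 3, x 1 3, 0, if ac then 2 * x 1 0 - y 3 0 else y 3 0,
        if bc then y 0 1 else 2 * x 0 3 - y 0 1, 0, y 3 0, y 3 1, 0, ?_⟩
      rw [isBlockColoring_three]
      cases ab <;> cases ac <;> cases bc <;> simp [TileColoring, cross] at h h1 h2 ⊢ <;> grind
    · have b0 := hb 0 (by norm_num)
      have b1 := hb 1 (by norm_num)
      have b2 := hb 2 (by norm_num)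
      simp only [Pi.zero_apply, b0, b1, b2] at h
      cases ab <;> cases ac <;> cases bc <;> simp [TileColoring, cross] at h h1 h2 ⊢ <;> grind

end Coloring

theorem AddArc.switch_eq {t p q : Tile} (h : AddArc t p q) : p.switch = p ∧ q.switch = q := by
  cases h <;> exact ⟨rfl, rfl⟩

theorem HasArc.switch_eq {t q : Tile} (h : HasArc t q) : q.switch = q := by
  obtain ⟨p, h⟩ := h
  exact h.switch_eq.2

theorem Block.switch_two (a b c d : Tile) :
    Block.switch !![a, b; c, d] = !![a.switch, b.switch; c.switch, d.switch] := by
  funext i j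
  fin_cases i <;> fin_cases j <;> rfl

theorem PlanarMove.switch {P Q : Block 2} (h : PlanarMove P Q) :
    PlanarMove P.switch Q.switch := by
  cases h with
  | push_two ha hd hb hc =>
    simp only [Block.switch_two, ha.switch_eq, hd.switch_eq]
    refine .push_two ha hd ?_ ?_
    · rcases hb with ⟨rfl, rfl⟩ | ⟨rfl, rfl⟩ <;> simp [Tile.switch]
    · rcases hc with ⟨rfl, rfl⟩ | ⟨rfl, rfl⟩ <;> simp [Tile.switch]
  | push_three ha hb hc hd =>
    simp only [Block.switch_two, hc.switch_eq, hd.switch_eq]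
    refine .push_three ?_ ?_ hc hd
    · rcases ha with ⟨rfl, rfl⟩ | ⟨rfl, rfl⟩ <;> simp [Tile.switch]
    · rcases hb with ⟨rfl, rfl⟩ | ⟨rfl, rfl⟩ <;> simp [Tile.switch]
  | push_four hb hc hd =>
    simp only [Block.switch_two, hb.switch_eq, hc.switch_eq, hd.switch_eq]
    exact .push_four hb hc hd
  | slide_adjacent h ha hb =>
    simp only [Block.switch_two, ha.switch_eq, hb.switch_eq]
    cases h
    · exact .slide_adjacent true ha hb
    · exact .slide_adjacent false ha hb
  | slide_diagonal h ha hd =>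
    simp only [Block.switch_two, ha.switch_eq, hd.switch_eq]
    cases h
    · exact .slide_diagonal true ha hd
    · exact .slide_diagonal false ha hd

theorem ReidemeisterMove₂.switch {P Q : Block 2} (h : ReidemeisterMove₂ P Q) :
    ReidemeisterMove₂ P.switch Q.switch := by
  cases h with
  | one h ha hb hc =>
    simp only [Block.switch_two, ha.switch_eq, hb.switch_eq, hc.switch_eq]
    cases h
    · exact .one true ha hb hc
    · exact .one false ha hb hc
  | two_adjacent h ha hb =>
    simp only [Block.switch_two, ha.switch_eq, hb.switch_eq]
    cases h
    · exact .two_adjacent true ha hb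
    · exact .two_adjacent false ha hb
  | two_diagonal h ha hd =>
    simp only [Block.switch_two, ha.switch_eq, hd.switch_eq]
    cases h
    · exact .two_diagonal true ha hd
    · exact .two_diagonal false ha hd

theorem ReidemeisterMove₃.switch {P Q : Block 3} (h : ReidemeisterMove₃ P Q) :
    ReidemeisterMove₃ P.switch Q.switch := by
  obtain ⟨ab, ac, bc, h1, h2⟩ := h
  have hc : ∀ b, (cross b).switch = cross (!b) := by decide
  convert ReidemeisterMove₃.three (!ab) (!ac) (!bc) ?_ ?_ using 1
  · funext i j
    fin_cases i <;> fin_cases j <;> simp [Block.switch, hc] <;> rfl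
  · funext i j
    fin_cases i <;> fin_cases j <;> simp [Block.switch, hc] <;> rfl
  · simpa using h2
  · simpa using h1

section Coloring

variable {R : Type*} [CommRing R]

theorem PlanarMove.blockEquiv {P Q : Block 2} (h : PlanarMove P Q) : BlockEquiv R P Q :=
  ⟨h.blockTransfer, h.switch.blockTransfer⟩

theorem ReidemeisterMove₂.blockEquiv {P Q : Block 2} (h : ReidemeisterMove₂ P Q) :
    BlockEquiv R P Q :=
  ⟨h.blockTransfer, h.switch.blockTransfer⟩

theorem ReidemeisterMove₃.blockEquiv {P Q : Block 3} (h : ReidemeisterMove₃ P Q) :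
    BlockEquiv R P Q :=
  ⟨h.blockTransfer, h.switch.blockTransfer⟩

/-! ### Colourings under stretching -/

theorem Transfer.insertRow (r : ℕ) (B : Board) : Transfer R B (insertRow r B) := by
  intro x y h
  refine ⟨fun i j => if i < r then x i j else if i = r then 0 else x (i - 1) j,
    fun i j => if i ≤ r then y i j else y (i - 1) j, fun i j => ?_, fun m k hc i j => ?_⟩
  · rcases lt_trichotomy i r with hi | rfl | hi
    · simpa [_root_.insertRow, hi, hi.le, Nat.succ_le_of_lt hi] using h i j
    · rcases ht : (B i j).top
      · simpa [_root_.insertRow, ht, TileColoring] using (h i j).top_eq_zero ht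
      · simp [_root_.insertRow, ht, TileColoring]
    · obtain ⟨i, rfl⟩ : ∃ v, i = v + 1 := ⟨i - 1, by omega⟩
      simpa [_root_.insertRow, hi.not_gt, hi.ne', hi.not_ge, show ¬ i + 1 < r by omega,
        show ¬ i + 1 + 1 ≤ r by omega, show i + 1 + 1 ≠ r by omega, show ¬ i + 1 + 1 < r by omega]
        using h i j
  · by_cases hi : i < r
    · have := hc i j
      simpa [unitX, unitY, _root_.insertRow, hi, hi.le] using this
    · have := hc (i + 1) j
      simpa [unitX, unitY, _root_.insertRow, show ¬ i + 1 < r by omega,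
        show i + 1 ≠ r by omega, show ¬ i + 1 ≤ r by omega] using this

/-- The new row identifies the colours of the sides above and below it. -/
theorem Transfer.of_insertRow (r : ℕ) (B : Board) : Transfer R (_root_.insertRow r B) B := by
  intro x y h
  have hr : ∀ j, x r j = 0 ∧ y (r + 1) j = y r j := by
    intro j
    have := h r j
    rcases ht : (B r j).top <;> simp [_root_.insertRow, ht, TileColoring] at this
    · exact ⟨this.1, by rw [this.2.2.2, this.2.2.1]⟩
    · exact ⟨this.2.1, this.1.symm⟩
  refine ⟨fun i j => if i < r then x i j else x (i + 1) j,
    fun i j => if i < r then y i j else y (i + 1) j, fun i j => ?_, fun m k hc i j => ?_⟩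
  · by_cases hi : i < r
    · have := h i j
      simp only [_root_.insertRow, if_pos hi] at this
      by_cases hi' : i + 1 < r
      · simpa [hi, hi'] using this
      · obtain rfl : i + 1 = r := by omega
        simpa [hi, (hr j).2] using this
    · have := h (i + 1) j
      simpa [_root_.insertRow, show ¬ i + 1 < r by omega, show i + 1 ≠ r by omega, hi] using this
  · rcases lt_trichotomy i r with hi | rfl | hi
    · have := hc i j
      simpa [unitX, unitY, _root_.insertRow, hi] using this
    · have := (hc i j).2
      simp only [lt_irrefl, if_false, (hr j).2] at this
      rw [this, (hr j).1]
      rcases ht : (B i j).top <;> simp [unitX, unitY, _root_.insertRow, ht] <;>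
        simp [Tile.left, Tile.top]
    · obtain ⟨i, rfl⟩ : ∃ v, i = v + 1 := ⟨i - 1, by omega⟩
      have := hc i j
      simpa [unitX, unitY, _root_.insertRow, show ¬ i < r by omega, show ¬ i + 1 < r by omega,
        show i + 1 ≠ r by omega] using this

theorem Transfer.insertCol (c : ℕ) (B : Board) : Transfer R B (insertCol c B) := by
  intro x y h
  refine ⟨fun i j => if j ≤ c then x i j else x i (j - 1),
    fun i j => if j < c then y i j else if j = c then 0 else y i (j - 1),
    fun i j => ?_, fun m k hc i j => ?_⟩
  · rcases lt_trichotomy j c with hj | rfl | hj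
    · simpa [_root_.insertCol, hj, hj.le, Nat.succ_le_of_lt hj] using h i j
    · rcases ht : (B i j).left
      · simpa [_root_.insertCol, ht, TileColoring] using (h i j).left_eq_zero ht
      · simp [_root_.insertCol, ht, TileColoring]
    · obtain ⟨j, rfl⟩ : ∃ v, j = v + 1 := ⟨j - 1, by omega⟩
      simpa [_root_.insertCol, hj.not_gt, hj.ne', hj.not_ge, show ¬ j + 1 < c by omega,
        show ¬ j + 1 + 1 ≤ c by omega, show j + 1 + 1 ≠ c by omega, show ¬ j + 1 + 1 < c by omega]
        using h i j
  · by_cases hj : j < c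
    · have := hc i j
      simpa [unitX, unitY, _root_.insertCol, hj, hj.le] using this
    · have := hc i (j + 1)
      simpa [unitX, unitY, _root_.insertCol, show ¬ j + 1 < c by omega,
        show j + 1 ≠ c by omega, show ¬ j + 1 ≤ c by omega] using this

theorem Transfer.of_insertCol (c : ℕ) (B : Board) : Transfer R (_root_.insertCol c B) B := by
  intro x y h
  have hr : ∀ i, y i c = 0 ∧ x i (c + 1) = x i c := by
    intro i
    have := h i c
    rcases ht : (B i c).left <;> simp [_root_.insertCol, ht, TileColoring] at this
    · exact ⟨this.2.2.1, by rw [this.1, this.2.1]⟩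
    · exact ⟨this.2.1, this.1.symm⟩
  refine ⟨fun i j => if j < c then x i j else x i (j + 1),
    fun i j => if j < c then y i j else y i (j + 1), fun i j => ?_, fun m k hc i j => ?_⟩
  · by_cases hj : j < c
    · have := h i j
      simp only [_root_.insertCol, if_pos hj] at this
      by_cases hj' : j + 1 < c
      · simpa [hj, hj'] using this
      · obtain rfl : j + 1 = c := by omega
        simpa [hj, (hr i).2] using this
    · have := h i (j + 1)
      simpa [_root_.insertCol, show ¬ j + 1 < c by omega, show j + 1 ≠ c by omega, hj] using this
  · rcases lt_trichotomy j c with hj | rfl | hj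
    · have := hc i j
      simpa [unitX, unitY, _root_.insertCol, hj] using this
    · have := (hc i j).1
      simp only [lt_irrefl, if_false, (hr i).2] at this
      rw [this, (hr i).1]
      rcases ht : (B i j).left <;> simp [unitX, unitY, _root_.insertCol, ht] <;>
        simp [Tile.left, Tile.top]
    · obtain ⟨j, rfl⟩ : ∃ v, j = v + 1 := ⟨j - 1, by omega⟩
      have := hc i j
      simpa [unitX, unitY, _root_.insertCol, show ¬ j < c by omega, show ¬ j + 1 < c by omega,
        show j + 1 ≠ c by omega] using this

theorem ReplaceBlock.transfer {k : ℕ} {S : Block k → Block k → Prop}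
    (hS : ∀ P Q, S P Q → BlockEquiv R P Q) {M N : Mosaic}
    (h : ReplaceBlock S M.board N.board) :
    Transfer R M.board N.board ∧ Transfer R N.board M.board := by
  obtain ⟨r, c, h, hout⟩ := h
  have := (BlockEquiv.of_upToSymmetry hS h).1
  exact ⟨this.1.transfer M.connected N.connected hout,
    this.2.transfer N.connected M.connected fun i j hij => (hout i j hij).symm⟩

theorem LinkStep.transfer {M N : Mosaic} (h : LinkStep M N) :
    Transfer R M.board N.board ∧ Transfer R N.board M.board := by
  rcases h with (h | ⟨r, h⟩ | ⟨c, h⟩) | h | h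
  · exact h.transfer fun _ _ => PlanarMove.blockEquiv
  · rw [h]
    exact ⟨.insertRow r _, .of_insertRow r _⟩
  · rw [h]
    exact ⟨.insertCol c _, .of_insertCol c _⟩
  · exact h.transfer fun _ _ => ReidemeisterMove₂.blockEquiv
  · exact h.transfer fun _ _ => ReidemeisterMove₃.blockEquiv

/-- Colourings are invariants of the link. -/
theorem Mosaic.transfer_of_linkType_eq {M N : Mosaic} (h : M.linkType = N.linkType) :
    Transfer R M.board N.board := by
  replace h := Quot.eqvGen_exact h
  suffices Transfer R M.board N.board ∧ Transfer R N.board M.board from this.1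
  induction h with
  | rel _ _ h => exact h.transfer
  | refl M => exact ⟨.refl _, .refl _⟩
  | symm _ _ _ ih => exact ih.symm
  | trans _ _ _ _ _ h1 h2 => exact ⟨h1.1.trans h2.1, h2.2.trans h1.2⟩

end Coloring

section Coloring

variable {R : Type*} [CommRing R]

/-- All colourings with two colours are constant, that is, the diagram is blank or depicts a
knot. -/
def TwoConstant (B : Board) : Prop :=
  ∀ x y : ℕ → ℕ → ZMod 2, IsColoring B x y → ∃ k, IsConstant B x y 1 k

/-- Some colouring over `R` stays non-constant after multiplication by `3`. -/
def HasColoring (R : Type*) [CommRing R] (B : Board) : Prop :=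
  ∃ x y : ℕ → ℕ → R, IsColoring B x y ∧ ∀ k, ¬ IsConstant B x y 3 k

theorem TwoConstant.of_linkType_eq {M N : Mosaic} (h : M.linkType = N.linkType)
    (hM : TwoConstant M.board) : TwoConstant N.board := by
  intro x y hxy
  obtain ⟨x', y', h1, h2⟩ := Mosaic.transfer_of_linkType_eq h.symm x y hxy
  obtain ⟨k, hk⟩ := hM x' y' h1
  exact ⟨k, h2 _ _ hk⟩

theorem HasColoring.of_linkType_eq {M N : Mosaic} (h : M.linkType = N.linkType)
    (hM : HasColoring R M.board) : HasColoring R N.board := by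
  obtain ⟨x, y, hxy, hk⟩ := hM
  obtain ⟨x', y', h1, h2⟩ := Mosaic.transfer_of_linkType_eq h x y hxy
  exact ⟨x', y', h1, fun k h => hk k (h2 _ _ h)⟩

/-- If a diagram with a small circle depicts a knot, then it consists of the circle only, and
its colourings are constant. -/
theorem not_hasUnknottedUnlinkedComponent {K : LinkType} {M : Mosaic} (hM : M.linkType = K)
    (h2 : TwoConstant M.board) (hR : HasColoring R M.board) :
    ¬ HasUnknottedUnlinkedComponent K := by
  rintro ⟨N, hN, r, c, hc⟩
  obtain ⟨x, y, hxy, hk⟩ := hR.of_linkType_eq (hM.trans hN.symm)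
  have hB := N.connected
  have ha : N.board r c = T2 := congrFun (congrFun hc 0) 0
  have hb : N.board r (c + 1) = T1 := congrFun (congrFun hc 0) 1
  have hc' : N.board (r + 1) c = T3 := congrFun (congrFun hc 1) 0
  have hd : N.board (r + 1) (c + 1) = T4 := congrFun (congrFun hc 1) 1
  -- The colouring with two colours that gives the colour `1` to the circle only is constant, so
  -- that nothing but the circle is there.
  obtain ⟨k, hk2⟩ := h2.of_linkType_eq (hM.trans hN.symm)
    (fun i j => if (i = r ∨ i = r + 1) ∧ j = c + 1 then 1 else 0)
    (fun i j => if i = r + 1 ∧ (j = c ∨ j = c + 1) then 1 else 0) (by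
      intro i j
      by_cases h : (i = r ∨ i = r + 1) ∧ (j = c ∨ j = c + 1)
      · rcases h with ⟨rfl | rfl, rfl | rfl⟩ <;> simp [ha, hb, hc', hd, TileColoring]
      · dsimp only
        rw [if_neg (by omega), if_neg (by omega), if_neg (by omega), if_neg (by omega)]
        cases N.board i j <;> simp [TileColoring])
  have hk1 : k = 1 := by
    have := (hk2 r (c + 1)).1
    simpa [unitX, hb, Tile.left] using this.symm
  subst hk1
  have hl : ∀ i j, ¬ ((i = r ∨ i = r + 1) ∧ j = c + 1) → (N.board i j).left = false := by
    intro i j h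
    have := (hk2 i j).1
    simp only [if_neg h] at this
    simpa [unitX] using this
  have ht : ∀ i j, ¬ (i = r + 1 ∧ (j = c ∨ j = c + 1)) → (N.board i j).top = false := by
    intro i j h
    have := (hk2 i j).2
    simp only [if_neg h] at this
    simpa [unitY] using this
  have h1 := hxy r c
  have h2 := hxy r (c + 1)
  have h3 := hxy (r + 1) c
  rw [ha, TileColoring] at h1
  rw [hb, TileColoring] at h2
  rw [hc', TileColoring] at h3
  refine hk (3 * x r (c + 1)) fun i j => ⟨?_, ?_⟩
  · by_cases h : (i = r ∨ i = r + 1) ∧ j = c + 1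
    · rcases h with ⟨rfl | rfl, rfl⟩
      · simp [unitX, hb, Tile.left]
      · simp [unitX, hd, Tile.left, h3.1, h1.1]
    · simp [unitX, hl i j h, (hxy i j).left_eq_zero (hl i j h)]
  · by_cases h : i = r + 1 ∧ (j = c ∨ j = c + 1)
    · rcases h with ⟨rfl, rfl | rfl⟩
      · simp [unitY, hc', Tile.top, h1.1]
      · simp [unitY, hd, Tile.top, h2.1]
    · simp [unitY, ht i j h, (hxy i j).top_eq_zero (ht i j h)]

/-! ### Tables of colours -/

/-- The entry in row `i` and column `j` of a list of rows, `0` outside of the list. -/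
def table {n : ℕ} (X : List (List (ZMod n))) (i j : ℕ) : ZMod n := entry 0 (entry [] X i) j

/-- The table has at most `m` rows and columns. -/
def tableSize {n : ℕ} (m : ℕ) (X : List (List (ZMod n))) : Bool :=
  Nat.ble X.length m && X.all fun l => Nat.ble l.length m

theorem table_eq_zero {n m : ℕ} {X : List (List (ZMod n))} (h : tableSize m X = true) {i j : ℕ}
    (hij : m ≤ i ∨ m ≤ j) : table X i j = 0 := by
  simp only [tableSize, Bool.and_eq_true, Nat.ble_eq, List.all_eq_true] at h
  rw [table, entry_eq, entry_eq]
  by_cases hi : i < X.length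
  · have h1 : X.getD i [] = X[i] := by simp [hi]
    have h2 := h.2 X[i] (List.getElem_mem hi)
    rw [h1, List.getD_eq_default _ _ (by omega)]
  · rw [List.getD_eq_default X _ (by omega)]
    rfl

/-- The tables `X`, `Y` describe a colouring of the first `m` rows and columns of the board. -/
def tableCheck {n : ℕ} (m : ℕ) (B : Board) (X Y : List (List (ZMod n))) : Bool :=
  tableSize m X && tableSize m Y && (List.range m).all fun i => (List.range m).all fun j =>
    decide (TileColoring (B i j) (table X i j) (table X i (j + 1)) (table Y i j)
      (table Y (i + 1) j))

theorem isColoring_table {n m : ℕ} {B : Board} {X Y : List (List (ZMod n))}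
    (h : tableCheck m B X Y = true) (hB : Fits m m B) : IsColoring B (table X) (table Y) := by
  simp only [tableCheck, Bool.and_eq_true, List.all_eq_true, List.mem_range,
    decide_eq_true_eq] at h
  obtain ⟨⟨hX, hY⟩, h⟩ := h
  intro i j
  by_cases hij : i < m ∧ j < m
  · exact h i hij.1 j hij.2
  · rw [hB _ _ (by omega), table_eq_zero hX (by omega), table_eq_zero hX (by omega),
      table_eq_zero hY (by omega), table_eq_zero hY (by omega)]
    simp [TileColoring]

end Coloring

section Coloring

variable {R : Type*} [CommRing R]

/-- The table of colours is not constant, even after multiplication by `q`: it differs from the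
constant table that agrees with it on the top side of the tile in row `1` and column `1`. -/
def nonconstantCheck {n : ℕ} (m : ℕ) (B : Board) (X Y : List (List (ZMod n))) (q : ZMod n) : Bool :=
  (B 1 1).top && (List.range m).any fun i => (List.range m).any fun j =>
    ((B i j).left && decide (q * table X i j ≠ q * table Y 1 1)) ||
      ((B i j).top && decide (q * table Y i j ≠ q * table Y 1 1))

theorem not_isConstant_table {n m : ℕ} {B : Board} {X Y : List (List (ZMod n))} {q : ZMod n}
    (h : nonconstantCheck m B X Y q = true) (k : ZMod n) :
    ¬ IsConstant B (table X) (table Y) q k := by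
  intro hc
  simp only [nonconstantCheck, Bool.and_eq_true, List.any_eq_true, List.mem_range,
    Bool.or_eq_true, decide_eq_true_eq] at h
  obtain ⟨h0, i, -, j, -, h⟩ := h
  have h1 := (hc 1 1).2
  rw [unitY, if_pos h0, mul_one] at h1
  rcases h with ⟨h, hne⟩ | ⟨h, hne⟩
  · have := (hc i j).1
    rw [unitX, if_pos h, mul_one] at this
    exact hne (this.trans h1.symm)
  · have := (hc i j).2
    rw [unitY, if_pos h, mul_one] at this
    exact hne (this.trans h1.symm)

/-! ### Diagrams of knots -/

/-- The direction in which a strand runs. -/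
inductive Direction where
  | right | left | down | up
  deriving DecidableEq

/-- The direction in which a strand leaves a tile that it entered in direction `d`. -/
def Tile.turn : Tile → Direction → Direction
  | T1, .right => .down | T1, .up => .left
  | T2, .left => .down | T2, .up => .right
  | T3, .left => .up | T3, .down => .right
  | T4, .right => .up | T4, .down => .left
  | T7, .right => .down | T7, .up => .left | T7, .left => .up | T7, .down => .right
  | T8, .left => .down | T8, .up => .right | T8, .right => .up | T8, .down => .left
  | _, d => d

/-- The tiles on a strand, starting in row `i` and column `j`, with the directions in which the
strand enters them. -/
def strand (B : Board) : ℕ → ℕ → ℕ → Direction → List (ℕ × ℕ × Direction)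
  | 0, _, _, _ => []
  | n + 1, i, j, d => (i, j, d) ::
    match (B i j).turn d with
    | .right => strand B n i (j + 1) .right
    | .left => match j with | 0 => [] | j + 1 => strand B n i j .left
    | .down => strand B n (i + 1) j .down
    | .up => match i with | 0 => [] | i + 1 => strand B n i j .up

/-- The side of a tile with left, right, top and bottom sides `l`, `r`, `u`, `d` that a strand
passes when it leaves the tile in the given direction. -/
def exitSide {α : Type*} (l r u d : α) : Direction → α
  | .right => r | .left => l | .down => d | .up => u

/-- The side of a tile with left, right, top and bottom sides `l`, `r`, `u`, `d` that a strand
passes when it enters the tile in the given direction. -/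
def entrySide {α : Type*} (l r u d : α) : Direction → α
  | .right => l | .left => r | .down => u | .up => d

theorem TileColoring.turn_eq {t : Tile} {l r u d : ZMod 2} (h : TileColoring t l r u d)
    (e : Direction) (he : entrySide t.left t.right t.top t.bottom e = true) :
    exitSide l r u d (t.turn e) = entrySide l r u d e := by
  have h2 : ∀ a b c : ZMod 2, a + b = 2 * c → a = b := by decide
  cases t <;> cases e <;>
    simp only [TileColoring, entrySide, exitSide, Tile.turn, Tile.left, Tile.right, Tile.top,
      Tile.bottom, reduceCtorEq] at h he ⊢ <;>
    first
    | exact h.1 | exact h.1.symm | exact h.2 | exact h.2.symm | exact h2 _ _ _ h.2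
    | exact (h2 _ _ _ h.2).symm

theorem Tile.turn_open (t : Tile) (e : Direction)
    (he : entrySide t.left t.right t.top t.bottom e = true) :
    exitSide t.left t.right t.top t.bottom (t.turn e) = true := by
  cases t <;> cases e <;> first | rfl | cases he

/-- With two colours, a strand keeps its colour, since it does so even where it passes under another
strand. -/
theorem Connected.color_strand {B : Board} (hB : Connected B) {x y : ℕ → ℕ → ZMod 2}
    (hxy : IsColoring B x y) (n : ℕ) : ∀ (i j : ℕ) (e : Direction),
      entrySide (B i j).left (B i j).right (B i j).top (B i j).bottom e = true →
      ∀ p ∈ strand B n i j e, entrySide (x p.1 p.2.1) (x p.1 (p.2.1 + 1)) (y p.1 p.2.1)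
        (y (p.1 + 1) p.2.1) p.2.2 = entrySide (x i j) (x i (j + 1)) (y i j) (y (i + 1) j) e := by
  induction n with
  | zero => intro i j e he p hp; cases hp
  | succ n ih =>
    intro i j e he p hp
    rw [strand.eq_def] at hp
    replace hp := List.mem_cons.1 hp
    rcases hp with rfl | hp
    · rfl
    have h1 := (hxy i j).turn_eq e he
    have h2 := (B i j).turn_open e he
    rw [← h1]
    revert hp h2
    rcases (B i j).turn e with _ | _ | _ | _ <;> dsimp only [exitSide] <;> intro hp h2
    · exact ih i (j + 1) .right (by rwa [hB.right] at h2) p hp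
    · obtain _ | j := j
      · cases hp
      · exact ih i j .left (by rwa [← hB.right] at h2) p hp
    · exact ih (i + 1) j .down (by rwa [hB.bottom] at h2) p hp
    · obtain _ | i := i
      · cases hp
      · exact ih i j .up (by rwa [← hB.bottom] at h2) p hp

/-- The strand that enters the tile in row `1` and column `1` from above meets the left and top
sides of all tiles that are met by the diagram. -/
def knotCheck (m : ℕ) (B : Board) : Bool :=
  let l := strand B (4 * m * m) 1 1 .down
  (B 1 1).top && (List.range m).all fun i => (List.range m).all fun j =>
    (!(B i j).left || l.any fun p => p == (i, j, .right) || p == (i, j - 1, .left)) &&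
    (!(B i j).top || l.any fun p => p == (i, j, .down) || p == (i - 1, j, .up))

theorem Mosaic.twoConstant_of_knotCheck (M : Mosaic) {m : ℕ} (hf : Fits m m M.board)
    (h : knotCheck m M.board = true) : TwoConstant M.board := by
  intro x y hxy
  have hB := M.connected
  simp only [knotCheck, Bool.and_eq_true, List.all_eq_true, List.mem_range, Bool.or_eq_true,
    Bool.not_eq_true', List.any_eq_true, beq_iff_eq] at h
  have key := hB.color_strand hxy (4 * m * m) 1 1 .down h.1
  refine ⟨y 1 1, fun i j => ?_⟩
  by_cases hij : i < m ∧ j < m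
  · obtain ⟨hl, ht⟩ := h.2 i hij.1 j hij.2
    rw [one_mul, one_mul]
    constructor
    · rw [unitX]
      split_ifs with hc
      · rw [mul_one]
        rcases hl with hl | ⟨p, hp, rfl | rfl⟩
        · rw [hl] at hc; cases hc
        · exact key _ hp
        · obtain _ | j := j
          · rw [hB.left_edge] at hc; cases hc
          · exact key _ hp
      · rw [mul_zero, (hxy i j).left_eq_zero (Bool.not_eq_true _ ▸ hc)]
    · rw [unitY]
      split_ifs with hc
      · rw [mul_one]
        rcases ht with ht | ⟨p, hp, rfl | rfl⟩
        · rw [ht] at hc; cases hc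
        · exact key _ hp
        · obtain _ | i := i
          · rw [hB.top_edge] at hc; cases hc
          · exact key _ hp
      · rw [mul_zero, (hxy i j).top_eq_zero (Bool.not_eq_true _ ▸ hc)]
  · have h0 := hf i j (by omega)
    have := hxy i j
    rw [h0, TileColoring] at this
    simp [unitX, unitY, h0, Tile.left, Tile.top, this]

end Coloring

/-! ### Four by four mosaics -/

/-- The board with four tiles `p`, `q`, `s`, `t` in the middle, surrounded by four arcs. -/
def ring (p q s t : Tile) : List (List Tile) :=
  [[T0, T2, T1, T0], [T2, p, q, T1], [T3, s, t, T4], [T0, T3, T4, T0]]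

/-- The tiles in the middle of the boards `ring p q s t` with three crossings. -/
def knotRings : List (Tile × Tile × Tile × Tile) :=
  [(T8, T9, T9, T9), (T9, T7, T9, T9), (T9, T9, T7, T9), (T9, T9, T9, T8)]

/-- The tiles in the middle of the boards `ring p q s t` with two or four crossings, and tables for
the left and top sides of the tiles that give the colour `1` to one of the components. -/
def linkRings : List ((Tile × Tile × Tile × Tile) × List (List (ZMod 2)) × List (List (ZMod 2))) :=
  let X (a b c d e f : ZMod 2) := [[0, 0, a], [0, b, e, c], [0, b, f, c], [0, 0, d]]
  let Y (a b c d e f : ZMod 2) := [[], [0, a, a], [b, e, f, c], [0, d, d]]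
  [((T8, T7, T9, T9), X 1 1 1 0 0 1, Y 1 1 1 0 0 0),
    ((T8, T9, T7, T9), X 1 1 0 1 0 0, Y 1 1 0 1 0 1),
    ((T8, T9, T9, T8), X 1 1 0 0 0 1, Y 1 1 0 0 0 1),
    ((T9, T7, T7, T9), X 1 0 1 0 0 1, Y 1 0 1 0 1 0),
    ((T9, T7, T9, T8), X 1 0 1 1 0 0, Y 1 0 1 1 1 0),
    ((T9, T9, T7, T8), X 1 0 0 0 0 1, Y 1 0 0 0 1 1),
    ((T9, T9, T9, T9), X 1 0 0 1 0 0, Y 1 0 0 1 1 1)]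

/-- The test of the four by four boards without bad windows. -/
def fourCheck (R : Region) : Bool :=
  pureCheck R || (moveCheck R || (R.count == 0 ||
    (knotRings.any (fun r => R.tiles == ring r.1 r.2.1 r.2.2.1 r.2.2.2) ||
      linkRings.any fun r => R.tiles == ring r.1.1 r.1.2.1 r.1.2.2.1 r.1.2.2.2)))

/-- Every four by four board without bad windows passes the test `fourCheck`. -/
theorem search_four : search (fun L => fourCheck ⟨4, 4, L⟩) 3 (List.replicate 4 T0) [] = true := by
  decide +kernel

/-- The tables of `linkRings` are colourings that are not constant. -/
theorem linkRings_check : ∀ r ∈ linkRings,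
    tableCheck 4 (tileAt (ring r.1.1 r.1.2.1 r.1.2.2.1 r.1.2.2.2)) r.2.1 r.2.2 = true ∧
    nonconstantCheck 4 (tileAt (ring r.1.1 r.1.2.1 r.1.2.2.1 r.1.2.2.2)) r.2.1 r.2.2 1 = true := by
  decide +kernel

/-- With two colours, over- and under-strands play the same role, as `2 = 0`. -/
theorem TileColoring.of_flat {t : Tile} {l r u d : ZMod 2} (h : TileColoring t.flat l r u d) :
    TileColoring t l r u d := by
  have key : ∀ l r u d : ZMod 2, TileColoring T9 l r u d → TileColoring T10 l r u d := by decide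
  cases t
  case T10 => exact key _ _ _ _ h
  all_goals exact h

section Sound

variable {R : Type*} [CommRing R]

theorem not_twoConstant_of_linkRings {M : Mosaic} {r} (hr : r ∈ linkRings)
    (h : planarSystem.Occurs true ⟨4, 4, ring r.1.1 r.1.2.1 r.1.2.2.1 r.1.2.2.2⟩ 0 0 M.board) :
    ¬ TwoConstant M.board := by
  intro h2
  obtain ⟨hc, hn⟩ := linkRings_check r hr
  have hB : ∀ i j, (M.board i j).flat = tileAt (ring r.1.1 r.1.2.1 r.1.2.2.1 r.1.2.2.2) i j := by
    intro i j
    by_cases hij : i < 4 ∧ j < 4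
    · exact Occurs.flat_eq h hij.1 hij.2
    · rw [(h.2 rfl).2.2 i j (by simp only; omega), tileAt_eq]
      obtain hi | ⟨hi, hj⟩ : 4 ≤ i ∨ i < 4 ∧ 4 ≤ j := by omega
      · rw [List.getD_eq_default (ring _ _ _ _) _ (by simpa [ring] using hi)]; rfl
      · interval_cases i <;> exact (List.getD_eq_default _ _ (by simpa [ring] using hj)).symm
  have hf : Fits 4 4 (tileAt (ring r.1.1 r.1.2.1 r.1.2.2.1 r.1.2.2.2)) := by
    intro i j hij
    rw [← hB, (h.2 rfl).2.2 i j hij]; rfl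
  have hcol := isColoring_table hc hf
  obtain ⟨k, hk⟩ := h2 (table r.2.1) (table r.2.2) fun i j => by
    have := hcol i j
    rw [← hB] at this
    exact this.of_flat
  refine not_isConstant_table hn k fun i j => ?_
  have := hk i j
  simpa only [unitX, unitY, ← hB, Tile.flat_left, Tile.flat_top] using this

/-- The equations for the colours of a board `ring p q s t` with three crossings. -/
theorem three_mul_eq {p q s t : Tile} (h : (p.flat, q.flat, s.flat, t.flat) ∈ knotRings)
    {a b c d e e' f f' : R} (hp : TileColoring p b e a f) (hq : TileColoring q e c a f')
    (hs : TileColoring s b e' f d) (ht : TileColoring t e' c f' d) :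
    (3 * b = 3 * a ∧ 3 * c = 3 * a ∧ 3 * d = 3 * a) ∧ (3 * e = 3 * a ∧ 3 * e' = 3 * a) ∧
      3 * f = 3 * a ∧ 3 * f' = 3 * a := by
  simp only [knotRings, List.mem_cons, Prod.mk.injEq, List.not_mem_nil, or_false] at h
  have h9 : ∀ {t : Tile}, t.flat = T9 → t = T9 ∨ t = T10 := fun h => Tile.flat_eq_T9_iff.1 h
  have h7 : ∀ {t : Tile}, t.flat = T7 → t = T7 := fun h => (Tile.flat_eq_iff (by decide)).1 h
  have h8 : ∀ {t : Tile}, t.flat = T8 → t = T8 := fun h => (Tile.flat_eq_iff (by decide)).1 h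
  rcases h with ⟨h1, h2, h3, h4⟩ | ⟨h1, h2, h3, h4⟩ | ⟨h1, h2, h3, h4⟩ | ⟨h1, h2, h3, h4⟩
  · obtain rfl := h8 h1
    rcases h9 h2 with rfl | rfl <;> rcases h9 h3 with rfl | rfl <;> rcases h9 h4 with rfl | rfl <;>
      simp only [TileColoring] at hp hq hs ht <;> grind
  · obtain rfl := h7 h2
    rcases h9 h1 with rfl | rfl <;> rcases h9 h3 with rfl | rfl <;> rcases h9 h4 with rfl | rfl <;>
      simp only [TileColoring] at hp hq hs ht <;> grind
  · obtain rfl := h7 h3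
    rcases h9 h1 with rfl | rfl <;> rcases h9 h2 with rfl | rfl <;> rcases h9 h4 with rfl | rfl <;>
      simp only [TileColoring] at hp hq hs ht <;> grind
  · obtain rfl := h8 h4
    rcases h9 h1 with rfl | rfl <;> rcases h9 h2 with rfl | rfl <;> rcases h9 h3 with rfl | rfl <;>
      simp only [TileColoring] at hp hq hs ht <;> grind

end Sound

section Coloring

variable {R : Type*} [CommRing R]

/-- All sides met by the diagram are joined, along the ring of arcs, to sides of the four tiles in
the middle, whose colours multiplied by `3` agree. -/
theorem isConstant_of_knotRings {M : Mosaic} {r} (hr : r ∈ knotRings)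
    (h : planarSystem.Occurs true ⟨4, 4, ring r.1 r.2.1 r.2.2.1 r.2.2.2⟩ 0 0 M.board)
    {x y : ℕ → ℕ → R} (hxy : IsColoring M.board x y) : IsConstant M.board x y 3 (3 * y 1 1) := by
  have hB : ∀ i < 4, ∀ j < 4, (M.board i j).flat = tileAt (ring r.1 r.2.1 r.2.2.1 r.2.2.2) i j :=
    fun i hi j hj => Occurs.flat_eq h hi hj
  have ht : ∀ {i j : ℕ} {t : Tile}, tileAt (ring r.1 r.2.1 r.2.2.1 r.2.2.2) i j = t → i < 4 →
      j < 4 → t ≠ T9 ∧ t ≠ T10 → M.board i j = t := fun h hi hj hne =>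
    (Tile.flat_eq_iff hne).1 ((hB _ hi _ hj).trans h)
  have t01 := ht (t := T2) (i := 0) (j := 1) rfl (by decide) (by decide) (by decide)
  have t02 := ht (t := T1) (i := 0) (j := 2) rfl (by decide) (by decide) (by decide)
  have t10 := ht (t := T2) (i := 1) (j := 0) rfl (by decide) (by decide) (by decide)
  have t13 := ht (t := T1) (i := 1) (j := 3) rfl (by decide) (by decide) (by decide)
  have t20 := ht (t := T3) (i := 2) (j := 0) rfl (by decide) (by decide) (by decide)
  have t23 := ht (t := T4) (i := 2) (j := 3) rfl (by decide) (by decide) (by decide)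
  have t31 := ht (t := T3) (i := 3) (j := 1) rfl (by decide) (by decide) (by decide)
  have t32 := ht (t := T4) (i := 3) (j := 2) rfl (by decide) (by decide) (by decide)
  have hr' : ((M.board 1 1).flat, (M.board 1 2).flat, (M.board 2 1).flat, (M.board 2 2).flat) ∈
      knotRings := by
    rw [hB 1 (by decide) 1 (by decide), hB 1 (by decide) 2 (by decide),
      hB 2 (by decide) 1 (by decide), hB 2 (by decide) 2 (by decide)]
    exact hr
  have c01 := hxy 0 1
  have c02 := hxy 0 2
  have c10 := hxy 1 0
  have c20 := hxy 2 0
  have c13 := hxy 1 3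
  have c23 := hxy 2 3
  have c31 := hxy 3 1
  have c32 := hxy 3 2
  rw [t01] at c01
  rw [t02] at c02
  rw [t10] at c10
  rw [t20] at c20
  rw [t13] at c13
  rw [t23] at c23
  rw [t31] at c31
  rw [t32] at c32
  simp only [TileColoring, Nat.reduceAdd] at c01 c02 c10 c20 c13 c23 c31 c32
  have e1 : y 1 2 = y 1 1 := by rw [← c02.1, ← c01.1]
  have e2 : x 2 1 = x 1 1 := by rw [c20.1, ← c10.1]
  have e3 : x 2 3 = x 1 3 := by rw [c13.1, c23.1]
  have e4 : y 3 2 = y 3 1 := by rw [← c31.1, c32.1]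
  obtain ⟨⟨h1, h2, h3⟩, ⟨h4, h5⟩, h6, h7⟩ := three_mul_eq hr' (hxy 1 1) (e1 ▸ hxy 1 2)
    (e2 ▸ hxy 2 1) (e3 ▸ e4 ▸ hxy 2 2)
  have hl : ∀ i < 4, ∀ j < 4, (M.board i j).left =
      (tileAt (ring r.1 r.2.1 r.2.2.1 r.2.2.2) i j).left := fun i hi j hj => by
    rw [← hB i hi j hj, Tile.flat_left]
  have htop : ∀ i < 4, ∀ j < 4, (M.board i j).top =
      (tileAt (ring r.1 r.2.1 r.2.2.1 r.2.2.2) i j).top := fun i hi j hj => by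
    rw [← hB i hi j hj, Tile.flat_top]
  have key : ∀ i j, ((M.board i j).left = true → 3 * x i j = 3 * y 1 1) ∧
      ((M.board i j).top = true → 3 * y i j = 3 * y 1 1) := by
    intro i j
    by_cases hij : i < 4 ∧ j < 4
    · obtain ⟨hi, hj⟩ := hij
      rw [hl i hi j hj, htop i hi j hj]
      interval_cases i <;> interval_cases j
      · exact ⟨nofun, nofun⟩
      · exact ⟨nofun, nofun⟩
      · exact ⟨fun _ => by rw [← c01.1], nofun⟩
      · exact ⟨nofun, nofun⟩
      · exact ⟨nofun, nofun⟩
      · exact ⟨fun _ => h1, fun _ => rfl⟩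
      · exact ⟨fun _ => h4, fun _ => by rw [e1]⟩
      · exact ⟨fun _ => h2, nofun⟩
      · exact ⟨nofun, fun _ => by rw [c10.1, h1]⟩
      · exact ⟨fun _ => by rw [e2, h1], fun _ => h6⟩
      · exact ⟨fun _ => h5, fun _ => h7⟩
      · exact ⟨fun _ => by rw [e3, h2], fun _ => by rw [← c13.1, h2]⟩
      · exact ⟨nofun, nofun⟩
      · exact ⟨nofun, fun _ => h3⟩
      · exact ⟨fun _ => by rw [c31.1, h3], fun _ => by rw [e4, h3]⟩
      · exact ⟨nofun, nofun⟩
    · rw [(h.2 rfl).2.2 i j (by simp only; omega)]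
      exact ⟨nofun, nofun⟩
  refine fun i j => ⟨?_, ?_⟩
  · rw [unitX]
    split_ifs with hc
    · rw [mul_one]; exact (key i j).1 hc
    · rw [(hxy i j).left_eq_zero (Bool.not_eq_true _ ▸ hc), mul_zero, mul_zero]
  · rw [unitY]
    split_ifs with hc
    · rw [mul_one]; exact (key i j).2 hc
    · rw [(hxy i j).top_eq_zero (Bool.not_eq_true _ ▸ hc), mul_zero, mul_zero]

/-- If a knot has a four by four mosaic, then it has one that is blank, or has three crossings
surrounded by a ring of arcs. The triple of each of its colourings is constant. -/
theorem Mosaic.not_hasColoring_of_fits {K : LinkType} (M : Mosaic) (hK : M.linkType = K)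
    (hf : Fits 4 4 M.board) (h2 : TwoConstant M.board) (hc : ¬ HasUnknottedUnlinkedComponent K) :
    ¬ HasColoring R M.board := by
  let S : Set Mosaic := {N | N.linkType = K ∧ Fits 4 4 N.board}
  let f : Mosaic → ℕ ×ₗ ℕ := fun N => toLex (N.tileCount, N.crossingCount)
  obtain ⟨N, ⟨hN, hfN⟩, hmin⟩ := (InvImage.wf f wellFounded_lt).has_min S ⟨M, hK, hf⟩
  have hlt : ∀ P : Mosaic, P.linkType = K → Fits 4 4 P.board → ¬ (P.tileCount < N.tileCount ∨
      P.tileCount = N.tileCount ∧ P.crossingCount < N.crossingCount) := by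
    intro P hP hfP h
    refine hmin P ⟨hP, hfP⟩ ?_
    simpa only [InvImage, f, Prod.Lex.toLex_lt_toLex] using h
  have hsmaller : ¬ ∃ P : Mosaic, PlanarIsotopic N P ∧ P.tileCount < N.tileCount ∧
      Fits 4 4 P.board := by
    rintro ⟨P, h1, h3, h4⟩
    exact hlt P (h1.linkType_eq ▸ hN) h4 (Or.inl h3)
  have hbad : ∀ r c, ¬ Window badWindow N.board r c := by
    intro r c hw
    rcases N.badWindow_cases hw with h | h | ⟨P, h1, h3, h4⟩
    · exact hc (hN ▸ N.hasUnknottedUnlinkedComponent_of_circleWindow h)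
    · obtain ⟨P, h1, h3, h4⟩ := N.exists_of_loopWindow h
      refine hlt P (h1.trans hN) (fun i j hij => (h3 i j).2 (hfN i j hij)) (Or.inr ⟨?_, h4⟩)
      simp only [Mosaic.tileCount, ne_eq, h3]
    · exact hsmaller ⟨P, h1, h3, h4 _ _ hfN⟩
  obtain ⟨L, hL, hocc⟩ := N.leaf_of_search search_four hfN hbad
  intro hcol
  replace h2 := h2.of_linkType_eq (hK.trans hN.symm)
  obtain ⟨x, y, hxy, hne⟩ := hcol.of_linkType_eq (hK.trans hN.symm)
  simp only [fourCheck, Bool.or_eq_true, beq_iff_eq, List.any_eq_true] at hL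
  rcases hL with h | h | h | ⟨r, hr, rfl⟩ | ⟨r, hr, rfl⟩
  · exact hsmaller (Occurs.pureCheck_sound hocc h)
  · rcases Occurs.moveCheck_sound hocc h with h | h
    · exact hc (hN ▸ h)
    · exact hsmaller h
  · rw [← hocc.tileCount_eq, Mosaic.tileCount, Set.ncard_eq_zero N.support_finite] at h
    have h0 : ∀ i j, N.board i j = T0 := fun i j => by
      by_contra hij
      exact Set.eq_empty_iff_forall_notMem.1 h (i, j) hij
    refine hne 0 fun i j => ?_
    have := hxy i j
    rw [h0, TileColoring] at this
    simp [this]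
  · exact hne _ (isConstant_of_knotRings hr hocc hxy)
  · exact not_twoConstant_of_linkRings hr hocc h2

/-- A knot with a colouring that stays non-constant after multiplication by `3` has mosaic number
at least five. -/
theorem mosaicNumber_eq_five {K : LinkType} {M N : Mosaic} (hM : M.linkType = K)
    (h2 : TwoConstant M.board) (hR : HasColoring R M.board) (hN : N.linkType = K)
    (hf : Fits 5 5 N.board) : mosaicNumber K = 5 ∧ ¬ HasUnknottedUnlinkedComponent K := by
  have hc := not_hasUnknottedUnlinkedComponent hM h2 hR
  refine ⟨le_antisymm (mosaicNumber_le hf hN) ?_, hc⟩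
  by_contra hlt
  obtain ⟨P, hP, hPK⟩ : mosaicNumber K ∈ {n | ∃ M : Mosaic, IsKnotMosaic n M.board ∧
      M.linkType = K} :=
    Nat.sInf_mem ⟨5, N, isKnotMosaic_iff.2 ⟨N.connected, hf⟩, hN⟩
  exact P.not_hasColoring_of_fits hPK
    ((isKnotMosaic_iff.1 hP).2.mono (by omega) (by omega)) (h2.of_linkType_eq (hM.trans hPK.symm))
    hc (hR.of_linkType_eq (hM.trans hPK.symm))

end Coloring

/-! ### Sequences of Reidemeister moves -/

/-- Recognition of the third Reidemeister move in standard position. -/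
def isReidemeisterBase₃ (P Q : Block 3) : Bool :=
  [false, true].any fun ab => [false, true].any fun ac => [false, true].any fun bc =>
    !(ab && bc && !ac) && !(!ab && !bc && ac) &&
    decide (∀ p : Fin 3 × Fin 3,
      P p.1 p.2 = !![T2, cross (!bc), T5; cross ac, cross ab, T5; T6, T6, T0] p.1 p.2 ∧
      Q p.1 p.2 = !![T0, T6, T2; T5, cross ab, cross ac; T2, cross (!bc), T4] p.1 p.2)

theorem reidemeisterMove_of_isReidemeisterBase₃ {P Q : Block 3}
    (h : isReidemeisterBase₃ P Q = true) : UpToSymmetry ReidemeisterMove₃ P Q := by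
  simp only [isReidemeisterBase₃, List.any_eq_true, Bool.and_eq_true, decide_eq_true_eq] at h
  obtain ⟨ab, -, ac, -, bc, -, ⟨h1, h2⟩, h⟩ := h
  have hP : P = _ := funext fun i => funext fun j => (h (i, j)).1
  have hQ : Q = _ := funext fun i => funext fun j => (h (i, j)).2
  rw [hP, hQ]
  refine .base (.three ab ac bc ?_ ?_)
  · rintro ⟨rfl, rfl, rfl⟩; cases h1
  · rintro ⟨rfl, rfl, rfl⟩; cases h2

/-- The third Reidemeister move, in either direction, leads from `P` to `Q`. -/
def reidemeisterCheck₃ (P Q : Block 3) : Bool :=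
  decide (P.Compatible Q) &&
    (dihedralCheck isReidemeisterBase₃ P Q || dihedralCheck isReidemeisterBase₃ Q P)

theorem Mosaic.exists_of_reidemeisterCheck₃ (M : Mosaic) {r c : ℕ} {P Q : Block 3}
    (hP : block 3 M.board r c = P) (h : reidemeisterCheck₃ P Q = true) :
    ∃ N : Mosaic, N.board = setBlock M.board r c Q ∧ M.linkType = N.linkType := by
  simp only [reidemeisterCheck₃, Bool.and_eq_true, decide_eq_true_eq, Bool.or_eq_true] at h
  obtain ⟨N, hN⟩ := M.exists_setBlock hP h.1
  refine ⟨N, hN, ?_⟩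
  rcases h.2 with h | h
  · have := upToSymmetry_of_dihedralCheck (fun _ _ => reidemeisterMove_of_isReidemeisterBase₃) h
    have hs : LinkStep M N := Or.inr (Or.inr (hN ▸ replaceBlock_setBlock hP this))
    exact Quot.sound hs
  · have := upToSymmetry_of_dihedralCheck (fun _ _ => reidemeisterMove_of_isReidemeisterBase₃) h
    have hs : LinkStep N M := Or.inr (Or.inr (hN ▸ replaceBlock_setBlock_symm hP this))
    exact (Quot.sound hs).symm

/-- Planar isotopy moves and Reidemeister moves. -/
def linkSystem : MoveSystem where
  forget := id
  forget_left _ := rfl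
  forget_top _ := rfl
  forget_T0 _ := Iff.rfl
  forget_T5 _ := Iff.rfl
  forget_T6 _ := Iff.rfl
  Rel M N := M.linkType = N.linkType
  of_planarIsotopic := PlanarIsotopic.linkType_eq
  trans := Eq.trans
  check₂ P Q := planarCheck P Q || reidemeisterCheck₂ P Q
  check₃ := reidemeisterCheck₃
  sound₂ {M _ _ Q} h := by
    rcases Bool.or_eq_true_iff.1 h with h | h
    · obtain ⟨N, hN, hMN⟩ := M.exists_of_planarCheck rfl h
      exact ⟨N, Q, rfl, hN, hMN.linkType_eq⟩
    · obtain ⟨N, hN, hMN⟩ := M.exists_of_reidemeisterCheck₂ rfl h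
      exact ⟨N, Q, rfl, hN, hMN.symm⟩
  sound₃ {M _ _ Q} h := by
    obtain ⟨N, hN, hMN⟩ := M.exists_of_reidemeisterCheck₃ rfl h
    exact ⟨N, Q, rfl, hN, hMN⟩

/-- A sequence of moves leads from the board of `M` to the board of `N`. -/
def joinCheck (m n : ℕ) (B B' : Board) (l : List Change) : Bool :=
  match linkSystem.run true ⟨m, m, tabulate m m B⟩ l with
  | some R => decide (n ≤ R.rows) && decide (n ≤ R.cols) &&
      (List.range R.rows).all fun i => (List.range R.cols).all fun j => tileAt R.tiles i j == B' i j
  | none => false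

theorem linkType_eq_of_joinCheck {M N : Mosaic} {m n : ℕ} {l : List Change}
    (hM : Fits m m M.board) (hN : Fits n n N.board)
    (h : joinCheck m n M.board N.board l = true) : M.linkType = N.linkType := by
  simp only [joinCheck] at h
  split at h
  · next R hR =>
    simp only [Bool.and_eq_true, decide_eq_true_eq, List.all_eq_true, List.mem_range,
      beq_iff_eq] at h
    obtain ⟨⟨hr, hc⟩, h⟩ := h
    obtain ⟨P, hMP, hP⟩ := MoveSystem.run_sound (M := M) (r₀ := 0) (c₀ := 0)
      ⟨fun i hi j hj => by
        rw [Nat.zero_add, Nat.zero_add]; exact (tileAt_tabulate hi hj).symm,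
        fun _ => ⟨rfl, rfl, hM⟩⟩ hR
    refine Eq.trans hMP (congrArg _ (Mosaic.ext (funext fun i => funext fun j => ?_)))
    by_cases hij : i < R.rows ∧ j < R.cols
    · have h1 := hP.1 i hij.1 j hij.2
      rw [Nat.zero_add, Nat.zero_add, h i hij.1 j hij.2] at h1
      exact h1
    · rw [(hP.2 rfl).2.2 i j (by omega), hN i j (by omega)]
  · cases h

/-- The change with over- and under-strands exchanged. -/
def Change.switch : Change → Change
  | .block₂ r c Q => .block₂ r c Q.switch
  | .block₃ r c Q => .block₃ r c Q.switch
  | s => s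

theorem boardOf_fits {n : ℕ} (P : Block n) : Fits n n (boardOf P) := fun i j h => by
  rw [boardOf, dif_neg (by omega)]

theorem Mosaic.fits_mirror {M : Mosaic} {a b : ℕ} (h : Fits a b M.board) :
    Fits a b M.mirror.board := fun i j hij => by
  simp [Mosaic.mirror, h i j hij, Tile.switch]

/-! ### A five by five mosaic of `6_1` -/

/-- A five by five mosaic of `6_1`. Its diagram has seven crossings and is not alternating. -/
def fiveMosaic6_1 : Mosaic where
  board := boardOf
    !![T0, T2,  T1,  T0,  T0;
       T2, T9,  T10, T1,  T0;
       T3, T10, T9,  T9,  T1;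
       T0, T3,  T9,  T10, T4;
       T0, T0,  T3,  T4,  T0]
  isMosaic := ⟨5, boardOf_isKnotMosaic _ (by decide) (by decide) (by decide) (by decide)⟩

/-- Moves from `fiveMosaic6_1` to the reduced alternating diagram of `6_1`. -/
def changes6_1 : List Change :=
  [.insertCol 2, .insertCol 2, .block₂ 3 2 !![T1, T2; T3, T4], .block₂ 2 2 !![T1, T2; T7, T8],
    .block₂ 3 2 !![T10, T10; T3, T4], .insertCol 5, .insertRow 4,
    .block₃ 2 3 !![T0, T6, T2; T5, T9, T10; T2, T9, T4], .insertCol 7, .insertRow 4,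
    .block₃ 2 5 !![T0, T6, T2; T5, T10, T10; T2, T9, T4], .block₂ 2 7 !![T2, T1; T8, T4],
    .block₂ 2 7 !![T0, T0; T1, T0], .deleteCol 8, .block₂ 5 2 !![T3, T5; T0, T0],
    .block₂ 5 5 !![T8, T4; T4, T0], .deleteCol 3, .block₂ 4 4 !![T2, T8; T9, T4],
    .block₂ 5 3 !![T7, T8; T3, T4], .block₂ 4 3 !![T3, T5; T1, T2],
    .block₂ 5 3 !![T5, T5; T0, T0], .deleteRow 6, .deleteCol 4, .block₂ 4 2 !![T3, T7; T0, T3],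
    .block₂ 3 0 !![T2, T8; T3, T4], .block₂ 4 1 !![T7, T7; T3, T4],
    .block₂ 3 1 !![T8, T8; T7, T9], .block₂ 2 1 !![T7, T1; T9, T8],
    .block₂ 1 0 !![T2, T8; T3, T10], .block₂ 3 0 !![T2, T8; T3, T10],
    .block₂ 2 1 !![T7, T1; T9, T8], .block₂ 1 1 !![T4, T2; T1, T6],
    .block₂ 1 0 !![T0, T6; T0, T6], .block₂ 0 1 !![T0, T2; T2, T8], .deleteRow 2,
    .block₂ 1 1 !![T2, T9; T8, T8], .block₂ 2 0 !![T2, T9; T3, T7],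
    .block₂ 3 1 !![T10, T8; T3, T4], .block₂ 3 2 !![T4, T3; T5, T5], .insertRow 5,
    .block₂ 4 2 !![T1, T2; T3, T4], .block₂ 3 2 !![T8, T8; T7, T8],
    .block₂ 2 2 !![T8, T8; T9, T8], .block₂ 2 3 !![T8, T8; T10, T8],
    .block₂ 2 4 !![T4, T0; T1, T0], .deleteCol 5, .block₂ 1 3 !![T7, T1; T9, T4], .insertCol 0,
    .block₂ 1 0 !![T2, T1; T3, T7], .block₂ 0 1 !![T2, T1; T7, T7],
    .block₂ 1 1 !![T9, T7; T7, T7], .block₂ 1 2 !![T10, T8; T7, T8],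
    .block₂ 1 3 !![T8, T7; T10, T7], .block₂ 1 4 !![T4, T0; T1, T0],
    .block₂ 0 3 !![T0, T0; T1, T0], .block₂ 2 1 !![T10, T7; T3, T7]]

set_option maxRecDepth 10000 in
theorem fiveMosaic6_1_linkType : fiveMosaic6_1.linkType = knot6_1.linkType :=
  linkType_eq_of_joinCheck (m := 6) (l := changes6_1)
    ((boardOf_fits _).mono (by decide) (by decide))
    (boardOf_fits _) (by decide +kernel)

set_option maxRecDepth 10000 in
theorem fiveMosaic6_1_mirror_linkType : fiveMosaic6_1.mirror.linkType = knot6_1.mirror.linkType :=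
  linkType_eq_of_joinCheck (m := 6) (l := changes6_1.map Change.switch)
    ((Mosaic.fits_mirror (boardOf_fits _)).mono (by decide) (by decide))
    (Mosaic.fits_mirror (boardOf_fits _)) (by decide +kernel)

/-! ### The knots `4_1`, `5_1`, `5_2`, `6_1`, `6_2`, `7_4` -/

/-- The board depicts a knot, and the tables describe a colouring that stays non-constant after
multiplication by `3`. -/
def knotColoringCheck {n : ℕ} (m : ℕ) (B : Board) (X Y : List (List (ZMod n))) : Bool :=
  knotCheck m B && tableCheck m B X Y && nonconstantCheck m B X Y 3

/-- The diagram `M` and the colouring show that the mosaic number is at least five, and the mosaic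
`N` of the same link that it is at most five. -/
theorem mosaicNumber_eq_five_of_check {M N : Mosaic} {n m : ℕ} {X Y : List (List (ZMod n))}
    (hM : Fits m m M.board) (h : knotColoringCheck m M.board X Y = true)
    (hN : N.linkType = M.linkType) (hf : Fits 5 5 N.board) :
    mosaicNumber M.linkType = 5 ∧ ¬ HasUnknottedUnlinkedComponent M.linkType := by
  simp only [knotColoringCheck, Bool.and_eq_true] at h
  exact mosaicNumber_eq_five rfl (M.twoConstant_of_knotCheck hM h.1.1)
    ⟨_, _, isColoring_table h.1.2 hM, not_isConstant_table h.2⟩ hN hf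

theorem knot4_1_mosaicNumber : mosaicNumber knot4_1.linkType = 5 ∧
    ¬ HasUnknottedUnlinkedComponent knot4_1.linkType :=
  mosaicNumber_eq_five_of_check (n := 5)
    (X := [[], [0, 4, 1, 1], [0, 4, 0, 4, 4], [0, 0, 4, 2, 4], [0, 0, 0, 4]])
    (Y := [[], [], [4, 0, 2, 1], [0, 4, 2, 2, 4], [0, 0, 4, 4]])
    (boardOf_fits _)
    (by decide +kernel) rfl (boardOf_fits _)

theorem knot4_1_mirror_mosaicNumber : mosaicNumber knot4_1.mirror.linkType = 5 ∧
    ¬ HasUnknottedUnlinkedComponent knot4_1.mirror.linkType :=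
  mosaicNumber_eq_five_of_check (n := 5)
    (X := [[], [0, 3, 3, 2], [0, 3, 1, 1, 3], [0, 0, 3, 2, 3], [0, 0, 0, 3]])
    (Y := [[], [], [3, 1, 0, 2], [0, 3, 2, 2, 3], [0, 0, 3, 3]])
    (Mosaic.fits_mirror (boardOf_fits _))
    (by decide +kernel) rfl (Mosaic.fits_mirror (boardOf_fits _))

theorem knot5_1_mosaicNumber : mosaicNumber knot5_1.linkType = 5 ∧
    ¬ HasUnknottedUnlinkedComponent knot5_1.linkType :=
  mosaicNumber_eq_five_of_check (n := 5)
    (X := [[], [0, 3, 2, 2], [0, 3, 3, 4, 4], [0, 0, 1, 1, 4], [0, 0, 0, 4]])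
    (Y := [[], [], [3, 0, 4, 2], [0, 1, 3, 1, 4], [0, 0, 4, 4]])
    (boardOf_fits _)
    (by decide +kernel) rfl (boardOf_fits _)

theorem knot5_1_mirror_mosaicNumber : mosaicNumber knot5_1.mirror.linkType = 5 ∧
    ¬ HasUnknottedUnlinkedComponent knot5_1.mirror.linkType :=
  mosaicNumber_eq_five_of_check (n := 5)
    (X := [[], [0, 1, 1, 4], [0, 1, 3, 0, 3], [0, 0, 2, 4, 3], [0, 0, 0, 3]])
    (Y := [[], [], [1, 2, 0, 4], [0, 2, 3, 4, 3], [0, 0, 3, 3]])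
    (Mosaic.fits_mirror (boardOf_fits _))
    (by decide +kernel) rfl (Mosaic.fits_mirror (boardOf_fits _))

theorem knot5_2_mosaicNumber : mosaicNumber knot5_2.linkType = 5 ∧
    ¬ HasUnknottedUnlinkedComponent knot5_2.linkType :=
  mosaicNumber_eq_five_of_check (n := 7)
    (X := [[], [0, 1, 6, 6], [0, 1, 1, 2, 2], [0, 0, 2, 5, 2], [0, 0, 0, 2]])
    (Y := [[], [], [1, 0, 5, 6], [0, 2, 5, 5, 2], [0, 0, 2, 2]])
    (boardOf_fits _)
    (by decide +kernel) rfl (boardOf_fits _)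

theorem knot5_2_mirror_mosaicNumber : mosaicNumber knot5_2.mirror.linkType = 5 ∧
    ¬ HasUnknottedUnlinkedComponent knot5_2.mirror.linkType :=
  mosaicNumber_eq_five_of_check (n := 7)
    (X := [[], [0, 1, 1, 6], [0, 1, 3, 3, 2], [0, 0, 2, 6, 2], [0, 0, 0, 2]])
    (Y := [[], [], [1, 2, 0, 6], [0, 2, 6, 6, 2], [0, 0, 2, 2]])
    (Mosaic.fits_mirror (boardOf_fits _))
    (by decide +kernel) rfl (Mosaic.fits_mirror (boardOf_fits _))

theorem knot6_1_mosaicNumber : mosaicNumber knot6_1.linkType = 5 ∧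
    ¬ HasUnknottedUnlinkedComponent knot6_1.linkType :=
  mosaicNumber_eq_five_of_check (n := 9)
    (X := [[], [0, 1, 1, 8], [0, 1, 3, 0, 7], [0, 0, 2, 3, 3, 2], [0, 0, 0, 2, 7, 2],
      [0, 0, 0, 0, 2]])
    (Y := [[], [], [1, 2, 0, 8], [0, 2, 3, 8, 7], [0, 0, 2, 7, 7, 2], [0, 0, 0, 2, 2]])
    (boardOf_fits _)
    (by decide +kernel) fiveMosaic6_1_linkType (boardOf_fits _)

theorem knot6_1_mirror_mosaicNumber : mosaicNumber knot6_1.mirror.linkType = 5 ∧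
    ¬ HasUnknottedUnlinkedComponent knot6_1.mirror.linkType :=
  mosaicNumber_eq_five_of_check (n := 9)
    (X := [[], [0, 8, 1, 1], [0, 8, 8, 2, 2], [0, 0, 7, 8, 7, 7], [0, 0, 0, 7, 3, 7],
      [0, 0, 0, 0, 7]])
    (Y := [[], [], [8, 0, 2, 1], [0, 7, 8, 3, 2], [0, 0, 7, 3, 3, 7], [0, 0, 0, 7, 7]])
    (Mosaic.fits_mirror (boardOf_fits _))
    (by decide +kernel) fiveMosaic6_1_mirror_linkType (Mosaic.fits_mirror (boardOf_fits _))

theorem knot6_2_mosaicNumber : mosaicNumber knot6_2.linkType = 5 ∧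
    ¬ HasUnknottedUnlinkedComponent knot6_2.linkType :=
  mosaicNumber_eq_five_of_check (n := 11)
    (X := [[], [0, 1, 10, 10], [0, 1, 1, 6, 6], [0, 0, 2, 2, 6], [0, 0, 0, 6]])
    (Y := [[], [], [1, 0, 9, 10], [0, 2, 9, 2, 6], [0, 0, 6, 6]])
    (boardOf_fits _)
    (by decide +kernel) rfl (boardOf_fits _)

theorem knot6_2_mirror_mosaicNumber : mosaicNumber knot6_2.mirror.linkType = 5 ∧
    ¬ HasUnknottedUnlinkedComponent knot6_2.mirror.linkType :=
  mosaicNumber_eq_five_of_check (n := 11)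
    (X := [[], [0, 1, 1, 10], [0, 1, 3, 3, 6], [0, 0, 2, 10, 6], [0, 0, 0, 6]])
    (Y := [[], [], [1, 2, 0, 10], [0, 2, 6, 10, 6], [0, 0, 6, 6]])
    (Mosaic.fits_mirror (boardOf_fits _))
    (by decide +kernel) rfl (Mosaic.fits_mirror (boardOf_fits _))

theorem knot7_4_mosaicNumber : mosaicNumber knot7_4.linkType = 5 ∧
    ¬ HasUnknottedUnlinkedComponent knot7_4.linkType :=
  mosaicNumber_eq_five_of_check (n := 5)
    (X := [[], [0, 1, 1, 4], [0, 1, 3, 3], [0, 0, 2], [0, 0, 0, 1]])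
    (Y := [[], [], [1, 2, 0, 4], [0, 2, 1, 4], [0, 0, 1, 1]])
    (boardOf_fits _)
    (by decide +kernel) rfl (boardOf_fits _)

theorem knot7_4_mirror_mosaicNumber : mosaicNumber knot7_4.mirror.linkType = 5 ∧
    ¬ HasUnknottedUnlinkedComponent knot7_4.mirror.linkType :=
  mosaicNumber_eq_five_of_check (n := 5)
    (X := [[], [0, 1, 4, 4], [0, 1, 1], [0, 0, 2, 2], [0, 0, 0, 1]])
    (Y := [[], [], [1, 0, 3, 4], [0, 2, 3, 1], [0, 0, 1, 1]])
    (Mosaic.fits_mirror (boardOf_fits _))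
    (by decide +kernel) rfl (Mosaic.fits_mirror (boardOf_fits _))

theorem mainTheorem4 :
    (∀ K : LinkType, mosaicNumber K = 5 → ¬ HasUnknottedUnlinkedComponent K →
      tileNumber K = 17 ∧ minimalMosaicTileNumber K = 17 ∧
      ∀ M : Mosaic, M.linkType = K → IsSpaceEfficient 5 M → HasLayout M) ∧
    (∀ M ∈ [knot4_1, knot5_1, knot5_2, knot6_1, knot6_2, knot7_4],
      ∀ K : LinkType, K = M.linkType ∨ K = M.mirror.linkType →
        mosaicNumber K = 5 ∧ ¬ HasUnknottedUnlinkedComponent K ∧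
        tileNumber K = 17 ∧ minimalMosaicTileNumber K = 17) := by
  refine ⟨fun K hK hc => ?_, fun M hM K hMK => ?_⟩
  · obtain ⟨h1, h2⟩ := tileNumber_eq hK hc
    exact ⟨h1, h2, fun M hM h => h.hasLayout hK hc hM⟩
  · have key : mosaicNumber K = 5 ∧ ¬ HasUnknottedUnlinkedComponent K := by
      simp only [List.mem_cons, List.not_mem_nil, or_false] at hM
      rcases hM with rfl | rfl | rfl | rfl | rfl | rfl <;> rcases hMK with rfl | rfl
      exacts [knot4_1_mosaicNumber, knot4_1_mirror_mosaicNumber, knot5_1_mosaicNumber,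
        knot5_1_mirror_mosaicNumber, knot5_2_mosaicNumber, knot5_2_mirror_mosaicNumber,
        knot6_1_mosaicNumber, knot6_1_mirror_mosaicNumber, knot6_2_mosaicNumber,
        knot6_2_mirror_mosaicNumber, knot7_4_mosaicNumber, knot7_4_mirror_mosaicNumber]
    exact ⟨key.1, key.2, tileNumber_eq key.1 key.2⟩
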